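/- Let $q\in\mathbb C$ with $0<|q|<1$, let $A,B,C,D\in\mathbb C\setminus\{0\}$, $z\in\mathbb C$, and let $n_0\le 0$ be an integer. Consider sequences $(X_n)_{n\ge n_0}$ and the associated continuous dual $q$-Hahn recurrence $$X_{n+1}-(z-a_n)X_n+b_n^2X_{n-1}=0\qquad(n>n_0),\tag{R}$$ $$a_n=\Big(\tfrac1A+\tfrac1B+\tfrac1C+\tfrac1D\Big)q^n-(1+q)q^{2n-1},\qquad b_n^2=\tfrac{q}{ABCD}(1-Aq^{n-1})(1-Bq^{n-1})(1-Cq^{n-1})(1-Dq^{n-1}),$$ where $b_n^2\ne0$ for all $n>n_0$. Put $\lambda_\pm=\frac12\big(z\pm\sqrt{z^2-4q/(ABCD)}\big)$ for a choice of the square root. For $n\in\mathbb Z$ let $(a)_n=\prod_{j=0}^{n-1}(1-aq^j)$ if $n\ge0$ and $(a)_n=\prod_{j=1}^{-n}(1-aq^{-j})^{-1}$ if $n<0$, and write $(a_1,\dots,a_m)_n=(a_1)_n\cdots(a_m)_n$. Let ${}_3\phi_2\big({a,b,c\atop d,e};w\big)$ be the sum of $\sum_{k\ge0}\frac{(a,b,c)_k}{(d,e,q)_k}w^k$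 for $|w|<1$ and its analytic continuation in $w$ to $\mathbb C\setminus\{q^{-k}:k\ge0\}$ otherwise. Define $$X_n^{(1),\pm}=\frac{(A,B,C,D)_n}{(BCD\lambda_\pm,ABC\lambda_\pm)_n}\lambda_\pm^n\;{}_3\phi_2\Big({BC\lambda_\pm,\,Bq^n,\,Cq^n\atop BCD\lambda_\pm q^n,\,ABC\lambda_\pm q^n};AD\lambda_\pm\Big),$$ $$X_n^{(2)}=\frac{(A,B)_n}{(AB)^n}\,{}_3\phi_2\Big({Aq^n,AB\lambda_+,AB\lambda_-\atop Aq/C,\,Aq/D};\frac{q^{1-n}}B\Big),\qquad X_n^{(3)}=\frac{(A,B)_n}{(AB)^n}\,{}_3\phi_2\Big({Bq^n,AB\lambda_+,AB\lambda_-\atop Bq/C,\,Bq/D};\frac{q^{1-n}}A\Big),$$ $$X_n^{(4)}=\frac{(B,C)_n}{(BC)^n}\,{}_3\phi_2\Big({Cq^n,BC\lambda_+,BC\lambda_-\atop Cq/A,\,Cq/D};\frac{q^{1-n}}B\Big),\qquad X_n^{(5)}=\frac{(B,D)_n}{(BD)^n}\,{}_3\phi_2\Big({Dq^n,BD\lambda_+,BD\lambda_-\atop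 Dq/C,\,Dq/A};\frac{q^{1-n}}B\Big).$$ Call one of these six functions well defined if, for all $n\ge n_0$, the denominator parameters of its ${}_3\phi_2$ are not in $\{q^{-k}:k\ge0\}$ and neither is its argument (for $X^{(1),\pm}$ this also makes the prefactor meaningful). (i) Each of $X_n^{(1),+},X_n^{(1),-},X_n^{(2)},X_n^{(3)},X_n^{(4)},X_n^{(5)}$ that is well defined is a solution of (R). (ii) For parameters in general position, i.e. if none of the numbers $A,B,C,D$, $A/B,A/C,A/D,B/C,B/D,C/D$, $\lambda_+/\lambda_-$, $Y\lambda_\pm$ for $Y\in\{A,B,C,D,AB,AC,AD,BC,BD,CD\}$ is an integer power of $q$, the six functions are well defined and pairwise linearly independent as sequences on $\{n\ge n_0\}$. (iii) Let $\alpha=\frac12\sqrt{ABCD/q}$ (either root) and suppose $x=\alpha z\in\mathbb C\setminus[-1,1]$. Then there is exactly one choice of the square root in $\lambda_\pm$ for which $(\lambda_- /\lambda_+)^n\to0$ as $n\to\infty$. If, for this choice, $X_n^{(1),-}$ is well defined, then the minimal solutions of (R) are exactly the nonzero constant multiples of $X_n^{(1),-}$. Here a minimal solution is a solution $X$, not identically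 zero, such that for every solution $Y$ linearly independent of $X$ one has $Y_n\ne0$ for all large $n$ and $X_n/Y_n\to0$ as $n\to\infty$. -/

import Mathlib

open Filter Topology

noncomputable section

namespace QHahn

/-- The `q`-shifted factorial `(a)_n = (a;q)_n` for an integer `n`: the product of `1 - a q^j`,
`0 ≤ j < n`, if `n ≥ 0`, and `1 / ((1 - a q⁻¹) ⋯ (1 - a q^n))` if `n < 0`, i.e.
`(a)_∞ / (a q^n)_∞` whenever that quotient makes sense. -/
def qPoch (q a : ℂ) : ℤ → ℂ
  | Int.ofNat n => ∏ j ∈ Finset.range n, (1 - a * q ^ j)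
  | Int.negSucc m => (∏ j ∈ Finset.range (m + 1), (1 - a * (q ^ (j + 1))⁻¹))⁻¹

/-- The coefficient `(a,b,c)_k / (d,e,q)_k` of a `₃φ₂` series. -/
def phiCoeff (q a b c d e : ℂ) (k : ℕ) : ℂ :=
  qPoch q a k * qPoch q b k * qPoch q c k / (qPoch q d k * qPoch q e k * qPoch q q k)

/-- The `₃φ₂` series with argument `w`. -/
def phiSeries (q a b c d e w : ℂ) : ℂ := ∑' k : ℕ, phiCoeff q a b c d e k * w ^ k

/-- The plane without the points `q^{-k}`, `k = 0, 1, 2, …`. -/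
def phiDomain (q : ℂ) : Set ℂ := {w | ∀ k : ℕ, w * q ^ k ≠ 1}

/-- `g` is an analytic continuation of the `₃φ₂` series (as a function of its argument) from the
open unit disc to the plane without the points `q^{-k}`. -/
def IsPhiContinuation (q a b c d e : ℂ) (g : ℂ → ℂ) : Prop :=
  DifferentiableOn ℂ g (phiDomain q) ∧
    ∀ w : ℂ, ‖w‖ < 1 → g w = phiSeries q a b c d e w

open scoped Classical in
/-- The function `₃φ₂(a, b, c; d, e; w)`: the sum of the series for `‖w‖ < 1`, and its analytic
continuation in `w` to the plane without the points `q^{-k}`. -/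
def phi (q a b c d e w : ℂ) : ℂ :=
  if h : ∃ g, IsPhiContinuation q a b c d e g then h.choose w else 0

section Continuation

theorem qPoch_natCast (q a : ℂ) (k : ℕ) :
    qPoch q a (k : ℤ) = ∏ j ∈ Finset.range k, (1 - a * q ^ j) := rfl

theorem phiCoeff_succ {q : ℂ} (hq1 : ‖q‖ < 1) (a b c : ℂ) {d e : ℂ}
    (hd : ∀ k : ℕ, d * q ^ k ≠ 1) (he : ∀ k : ℕ, e * q ^ k ≠ 1) (k : ℕ) :
    phiCoeff q a b c d e (k + 1)
        * ((1 - d * q ^ k) * (1 - e * q ^ k) * (1 - q ^ (k + 1)))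
      = phiCoeff q a b c d e k
        * ((1 - a * q ^ k) * (1 - b * q ^ k) * (1 - c * q ^ k)) := by
  have hq : ∀ k : ℕ, q * q ^ k ≠ 1 := by
    intro k h
    have h2 : ‖q ^ (k + 1)‖ = 1 := by rw [pow_succ', h, norm_one]
    rw [norm_pow] at h2
    exact absurd h2 (pow_lt_one₀ (norm_nonneg _) hq1 (by omega)).ne
  have hne : ∀ x : ℂ, (∀ k : ℕ, x * q ^ k ≠ 1) → ∀ k : ℕ,
      ∏ j ∈ Finset.range k, (1 - x * q ^ j) ≠ 0 := fun x hx k =>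
    Finset.prod_ne_zero_iff.2 fun j _ => sub_ne_zero.2 (hx j).symm
  have h1 := hne d hd k
  have h2 := hne e he k
  have h3 := hne q hq k
  have h4 : 1 - d * q ^ k ≠ 0 := sub_ne_zero.2 (hd k).symm
  have h5 : 1 - e * q ^ k ≠ 0 := sub_ne_zero.2 (he k).symm
  have h6 : 1 - q * q ^ k ≠ 0 := sub_ne_zero.2 (hq k).symm
  have h0 : ∀ x : ℂ, qPoch q x ((k + 1 : ℕ) : ℤ) = qPoch q x (k : ℤ) * (1 - x * q ^ k) := fun x => by
    rw [qPoch_natCast, qPoch_natCast, Finset.prod_range_succ]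
  rw [← qPoch_natCast] at h1 h2 h3
  simp only [phiCoeff, h0, pow_succ']
  rw [div_mul_eq_mul_div, div_mul_eq_mul_div, div_eq_div_iff
    (by simp only [mul_ne_zero_iff]; tauto) (by simp only [mul_ne_zero_iff]; tauto)]
  ring

theorem summable_phi {q : ℂ} (hq1 : ‖q‖ < 1) (a b c : ℂ) {d e : ℂ}
    (hd : ∀ k : ℕ, d * q ^ k ≠ 1) (he : ∀ k : ℕ, e * q ^ k ≠ 1) {w : ℂ} (hw : ‖w‖ < 1) :
    Summable fun k : ℕ => ‖phiCoeff q a b c d e k * w ^ k‖ := by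
  obtain ⟨r, hr1, hr2⟩ := exists_between hw
  have hq0 : Tendsto (fun k : ℕ => q ^ k) atTop (𝓝 0) :=
    tendsto_pow_atTop_nhds_zero_of_norm_lt_one hq1
  have hl : ∀ x : ℂ, Tendsto (fun k : ℕ => 1 - x * q ^ k) atTop (𝓝 1) := by
    intro x
    simpa using (hq0.const_mul x).const_sub 1
  have hq0' : Tendsto (fun k : ℕ => 1 - q ^ (k + 1)) atTop (𝓝 1) := by
    simpa using (hq0.comp (tendsto_add_atTop_nat 1)).const_sub 1
  have hden : Tendsto (fun k : ℕ => (1 - d * q ^ k) * (1 - e * q ^ k) * (1 - q ^ (k + 1)))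
      atTop (𝓝 1) := by simpa using ((hl d).mul (hl e)).mul hq0'
  have hnum : Tendsto (fun k : ℕ => (1 - a * q ^ k) * (1 - b * q ^ k) * (1 - c * q ^ k))
      atTop (𝓝 1) := by simpa using ((hl a).mul (hl b)).mul (hl c)
  have hrat : Tendsto (fun k : ℕ =>
      ‖(1 - a * q ^ k) * (1 - b * q ^ k) * (1 - c * q ^ k) /
        ((1 - d * q ^ k) * (1 - e * q ^ k) * (1 - q ^ (k + 1))) * w‖) atTop (𝓝 ‖w‖) := by
    simpa using ((hnum.div hden one_ne_zero).mul_const w).norm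
  have hev := hrat.eventually (gt_mem_nhds hr1)
  have hdne := hden.eventually_ne one_ne_zero
  refine summable_of_ratio_norm_eventually_le hr2 ?_
  filter_upwards [hev, hdne] with k hk hk'
  have hs := phiCoeff_succ hq1 a b c hd he k
  rw [← eq_div_iff hk'] at hs
  rw [norm_norm, norm_norm, hs, mul_div_assoc, pow_succ']
  calc _ = ‖(1 - a * q ^ k) * (1 - b * q ^ k) * (1 - c * q ^ k) /
        ((1 - d * q ^ k) * (1 - e * q ^ k) * (1 - q ^ (k + 1))) * w‖
        * ‖phiCoeff q a b c d e k * w ^ k‖ := by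
          rw [← norm_mul]; congr 1; ring
    _ ≤ _ := by gcongr

theorem differentiableAt_phiSeries {q : ℂ} (hq1 : ‖q‖ < 1) (a b c : ℂ) {d e : ℂ}
    (hd : ∀ k : ℕ, d * q ^ k ≠ 1) (he : ∀ k : ℕ, e * q ^ k ≠ 1) {w : ℂ} (hw : ‖w‖ < 1) :
    DifferentiableAt ℂ (phiSeries q a b c d e) w := by
  obtain ⟨r, hr1, hr2⟩ := exists_between hw
  have hr0 : 0 ≤ r := (norm_nonneg w).trans hr1.le
  have hs := summable_phi hq1 a b c hd he (w := (r : ℂ)) (by simpa [abs_of_nonneg hr0] using hr2)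
  have hD : DifferentiableOn ℂ (phiSeries q a b c d e) (Metric.ball 0 r) := by
    refine Complex.differentiableOn_tsum_of_summable_norm hs
      (fun k => by fun_prop) Metric.isOpen_ball ?_
    intro k z hz
    rw [mem_ball_zero_iff] at hz
    rw [norm_mul, norm_mul, norm_pow, norm_pow, Complex.norm_real, Real.norm_of_nonneg hr0]
    gcongr
  exact hD.differentiableAt (Metric.isOpen_ball.mem_nhds (by simpa using hr1))

theorem phiSeries_functional {q : ℂ} (hq0 : q ≠ 0) (hq1 : ‖q‖ < 1) (a b c : ℂ) {d e : ℂ}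
    (hd : ∀ k : ℕ, d * q ^ k ≠ 1) (he : ∀ k : ℕ, e * q ^ k ≠ 1) {w : ℂ} (hw : ‖w‖ < 1) :
    (1 - w) * phiSeries q a b c d e w =
      ((1 + d / q + e / q) - w * (a + b + c)) * phiSeries q a b c d e (q * w)
      + (w * (a * b + a * c + b * c) - (d / q + e / q + d / q * (e / q)))
        * phiSeries q a b c d e (q ^ 2 * w)
      + (d / q * (e / q) - w * (a * b * c)) * phiSeries q a b c d e (q ^ 3 * w) := by
  have hwj : ∀ j : ℕ, ‖q ^ j * w‖ < 1 := by
    intro j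
    rw [norm_mul, norm_pow]
    calc ‖q‖ ^ j * ‖w‖ ≤ 1 * ‖w‖ := by
          gcongr; exact pow_le_one₀ (norm_nonneg _) hq1.le
      _ < 1 := by simpa using hw
  have hS : ∀ j : ℕ, HasSum (fun k : ℕ => phiCoeff q a b c d e k * (q ^ j * w) ^ k)
      (phiSeries q a b c d e (q ^ j * w)) := fun j =>
    (summable_phi hq1 a b c hd he (hwj j)).of_norm.hasSum
  set c' := phiCoeff q a b c d e with hc'
  set F := phiSeries q a b c d e with hF
  have hL : HasSum (fun k : ℕ =>
      c' k * ((1 - q ^ k) * (1 - d / q * q ^ k) * (1 - e / q * q ^ k)) * w ^ k)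
      (F (q ^ 0 * w) - (1 + d / q + e / q) * F (q ^ 1 * w)
        + (d / q + e / q + d / q * (e / q)) * F (q ^ 2 * w)
        - d / q * (e / q) * F (q ^ 3 * w)) := by
    refine ((((hS 0).sub ((hS 1).mul_left (1 + d / q + e / q))).add
      ((hS 2).mul_left (d / q + e / q + d / q * (e / q)))).sub
      ((hS 3).mul_left (d / q * (e / q)))).congr_fun ?_
    intro k
    simp only [mul_pow, ← pow_mul]
    ring
  have hR : HasSum (fun k : ℕ =>
      c' k * ((1 - a * q ^ k) * (1 - b * q ^ k) * (1 - c * q ^ k)) * w ^ (k + 1))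
      (w * (F (q ^ 0 * w) - (a + b + c) * F (q ^ 1 * w)
        + (a * b + a * c + b * c) * F (q ^ 2 * w)
        - a * b * c * F (q ^ 3 * w))) := by
    refine (((((hS 0).sub ((hS 1).mul_left (a + b + c))).add
      ((hS 2).mul_left (a * b + a * c + b * c))).sub
      ((hS 3).mul_left (a * b * c))).mul_left w).congr_fun ?_
    intro k
    simp only [mul_pow, ← pow_mul]
    ring
  have hL' := (hasSum_nat_add_iff' 1).2 hL
  simp only [Finset.sum_range_one, pow_zero, sub_self, zero_mul, mul_zero, sub_zero] at hL'
  have hfun : (fun k : ℕ => c' (k + 1) * ((1 - q ^ (k + 1)) * (1 - d / q * q ^ (k + 1))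
      * (1 - e / q * q ^ (k + 1))) * w ^ (k + 1)) = fun k : ℕ =>
      c' k * ((1 - a * q ^ k) * (1 - b * q ^ k) * (1 - c * q ^ k)) * w ^ (k + 1) := by
    funext k
    have e1 : ∀ x : ℂ, x / q * q ^ (k + 1) = x * q ^ k := by
      intro x; rw [pow_succ']; field_simp
    rw [e1, e1, ← phiCoeff_succ hq1 a b c hd he k]
    ring
  rw [hfun] at hL'
  have key := hL'.unique hR
  simp only [pow_zero, one_mul, pow_one] at key
  linear_combination key

theorem phi_step_mem {q w : ℂ} {r : ℕ} (hq1 : ‖q‖ < 1) (hw : ‖w‖ * ‖q‖ ^ (r + 1) < 1) (j : ℕ) :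
    ‖q ^ (j + 1) * w‖ * ‖q‖ ^ r < 1 := by
  rw [norm_mul, norm_pow]
  calc ‖q‖ ^ (j + 1) * ‖w‖ * ‖q‖ ^ r = ‖q‖ ^ j * (‖w‖ * ‖q‖ ^ (r + 1)) := by ring
    _ ≤ 1 * (‖w‖ * ‖q‖ ^ (r + 1)) := by gcongr; exact pow_le_one₀ (norm_nonneg _) hq1.le
    _ < 1 := by simpa using hw

/-- The continuation exists as soon as no denominator of the series vanishes. -/
theorem exists_isPhiContinuation {q : ℂ} (hq0 : q ≠ 0) (hq1 : ‖q‖ < 1) (a b c : ℂ) {d e : ℂ}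
    (hd : ∀ k : ℕ, d * q ^ k ≠ 1) (he : ∀ k : ℕ, e * q ^ k ≠ 1) :
    ∃ g, IsPhiContinuation q a b c d e g := by
  let step : (ℂ → ℂ) → ℂ → ℂ := fun f w =>
    (((1 + d / q + e / q) - w * (a + b + c)) * f (q ^ (0 + 1) * w)
      + (w * (a * b + a * c + b * c) - (d / q + e / q + d / q * (e / q))) * f (q ^ (1 + 1) * w)
      + (d / q * (e / q) - w * (a * b * c)) * f (q ^ (2 + 1) * w)) / (1 - w)
  let G : ℕ → ℂ → ℂ := fun r => step^[r] (phiSeries q a b c d e)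
  have hGs : ∀ r, G (r + 1) = step (G r) := fun r => Function.iterate_succ_apply' _ _ _
  have hagree : ∀ r w, ‖w‖ * ‖q‖ ^ r < 1 → G (r + 1) w = G r w := by
    intro r
    induction r with
    | zero =>
      intro w hw
      have hw' : ‖w‖ < 1 := by simpa using hw
      have hne : 1 - w ≠ 0 := by
        intro h
        rw [← sub_eq_zero.1 h, norm_one] at hw'
        exact lt_irrefl _ hw'
      have := phiSeries_functional hq0 hq1 a b c hd he hw'
      rw [hGs]
      change _ / (1 - w) = phiSeries q a b c d e w
      rw [div_eq_iff hne, mul_comm (phiSeries q a b c d e w), this]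
      norm_num [G]
    | succ r ih =>
      intro w hw
      have hm := phi_step_mem hq1 hw
      have e0 := ih _ (hm 0)
      have e1 := ih _ (hm 1)
      have e2 := ih _ (hm 2)
      rw [hGs (r + 1)]
      conv_rhs => rw [hGs r]
      simp only [step, e0, e1, e2]
  have hdiff : ∀ r w, ‖w‖ * ‖q‖ ^ r < 1 → w ∈ phiDomain q → DifferentiableAt ℂ (G r) w := by
    intro r
    induction r with
    | zero =>
      intro w hw _
      exact differentiableAt_phiSeries hq1 a b c hd he (by simpa using hw)
    | succ r ih =>
      intro w hw hU
      have hm := phi_step_mem hq1 hw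
      have hne : 1 - w ≠ 0 := sub_ne_zero.2 (by simpa using (hU 0).symm)
      have hc : ∀ j : ℕ, DifferentiableAt ℂ (fun w => G r (q ^ (j + 1) * w)) w := by
        intro j
        have hU' : q ^ (j + 1) * w ∈ phiDomain q := by
          intro k h
          exact hU (j + 1 + k) (by rw [← h]; ring)
        exact DifferentiableAt.comp w (ih _ (hm j) hU') (by fun_prop)
      have h0 := hc 0
      have h1 := hc 1
      have h2 := hc 2
      rw [hGs]
      simp only [step]
      refine DifferentiableAt.div ?_ (by fun_prop) hne
      exact (((by fun_prop : DifferentiableAt ℂ _ w).mul h0).add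
        ((by fun_prop : DifferentiableAt ℂ _ w).mul h1)).add
        ((by fun_prop : DifferentiableAt ℂ _ w).mul h2)
  have hmono : ∀ r s w, ‖w‖ * ‖q‖ ^ r < 1 → G (r + s) w = G r w := by
    intro r s w hw
    induction s with
    | zero => rfl
    | succ s ih =>
      rw [← ih, ← add_assoc]
      refine hagree _ _ (lt_of_le_of_lt ?_ hw)
      rw [pow_add]
      gcongr
      exact mul_le_of_le_one_right (by positivity) (pow_le_one₀ (norm_nonneg _) hq1.le)
  have hex : ∀ w : ℂ, ∃ r : ℕ, ‖w‖ * ‖q‖ ^ r < 1 := by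
    intro w
    have : Tendsto (fun r : ℕ => ‖w‖ * ‖q‖ ^ r) atTop (𝓝 (‖w‖ * 0)) :=
      (tendsto_pow_atTop_nhds_zero_of_lt_one (norm_nonneg _) hq1).const_mul _
    rw [mul_zero] at this
    exact (this.eventually (gt_mem_nhds one_pos)).exists
  choose N hN using hex
  have hval : ∀ r w, ‖w‖ * ‖q‖ ^ r < 1 → G (N w) w = G r w := by
    intro r w hw
    rw [← hmono r (N w) w hw, ← hmono (N w) r w (hN w), add_comm]
  refine ⟨fun w => G (N w) w, ?_, ?_⟩
  · intro w hU
    have hopen : ∀ᶠ v in 𝓝 w, ‖v‖ * ‖q‖ ^ (N w) < 1 :=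
      (by fun_prop : Continuous fun v : ℂ => ‖v‖ * ‖q‖ ^ (N w)).continuousAt.eventually
        (gt_mem_nhds (hN w))
    refine ((hdiff (N w) w (hN w) hU).congr_of_eventuallyEq ?_).differentiableWithinAt
    filter_upwards [hopen] with v hv using hval _ _ hv
  · intro w hw
    exact hval 0 w (by simpa using hw)

theorem isOpen_phiDomain {q : ℂ} (hq1 : ‖q‖ < 1) : IsOpen (phiDomain q) := by
  rw [isOpen_iff_mem_nhds]
  intro w hw
  have ht : Tendsto (fun r : ℕ => ‖w‖ * ‖q‖ ^ r) atTop (𝓝 (‖w‖ * 0)) :=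
    (tendsto_pow_atTop_nhds_zero_of_lt_one (norm_nonneg _) hq1).const_mul _
  rw [mul_zero] at ht
  obtain ⟨r, hr⟩ := (ht.eventually (gt_mem_nhds one_pos)).exists
  have h1 : ∀ᶠ v in 𝓝 w, ‖v‖ * ‖q‖ ^ r < 1 :=
    (by fun_prop : Continuous fun v : ℂ => ‖v‖ * ‖q‖ ^ r).continuousAt.eventually
      (gt_mem_nhds hr)
  have h2 : ∀ᶠ v in 𝓝 w, ∀ k ∈ Finset.range r, v * q ^ k ≠ 1 := by
    rw [Filter.eventually_all_finset]
    intro k _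
    exact (by fun_prop : Continuous fun v : ℂ => v * q ^ k).continuousAt.eventually_ne (hw k)
  filter_upwards [h1, h2] with v hv1 hv2 k hk
  rcases lt_or_ge k r with hkr | hkr
  · exact hv2 k (Finset.mem_range.2 hkr) hk
  · have : ‖v‖ * ‖q‖ ^ k < 1 := lt_of_le_of_lt
      (mul_le_mul_of_nonneg_left (pow_le_pow_of_le_one (norm_nonneg _) hq1.le hkr)
        (norm_nonneg _)) hv1
    rw [← norm_pow, ← norm_mul, hk, norm_one] at this
    exact lt_irrefl _ this

/-- The continuation is unique on its domain. -/
theorem IsPhiContinuation.eqOn {q a b c d e : ℂ} (hq0 : q ≠ 0) (hq1 : ‖q‖ < 1) {g h : ℂ → ℂ}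
    (hg : IsPhiContinuation q a b c d e g) (hh : IsPhiContinuation q a b c d e h) :
    Set.EqOn g h (phiDomain q) := by
  have hU := isOpen_phiDomain hq1
  have hcompl : phiDomain q = (Set.range fun k : ℕ => (q ^ k)⁻¹)ᶜ := by
    ext w
    simp only [phiDomain, Set.mem_ofPred_eq, Set.mem_compl_iff, Set.mem_range, not_exists]
    refine forall_congr' fun k => not_congr ?_
    have hk := pow_ne_zero k hq0
    constructor
    · intro h
      exact (eq_inv_of_mul_eq_one_left h).symm
    · rintro rfl
      exact inv_mul_cancel₀ hk
  have hconn : IsPreconnected (phiDomain q) := by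
    rw [hcompl]
    refine ((Set.countable_range _).isConnected_compl_of_one_lt_rank ?_).isPreconnected
    rw [Complex.rank_real_complex]
    exact Nat.one_lt_ofNat
  have h0 : (0 : ℂ) ∈ phiDomain q := fun k => by simp
  refine (hg.1.analyticOnNhd hU).eqOn_of_preconnected_of_eventuallyEq
    (hh.1.analyticOnNhd hU) hconn h0 ?_
  filter_upwards [Metric.ball_mem_nhds (0 : ℂ) one_pos] with w hw
  rw [mem_ball_zero_iff] at hw
  rw [hg.2 w hw, hh.2 w hw]

end Continuation

/-- The coefficient `a_n`. -/
def coeffA (q A B C D : ℂ) (n : ℤ) : ℂ :=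
  (1 / A + 1 / B + 1 / C + 1 / D) * q ^ n - (1 + q) * q ^ (2 * n - 1)

/-- The coefficient `b_n²`. -/
def coeffBsq (q A B C D : ℂ) (n : ℤ) : ℂ :=
  q / (A * B * C * D) * (1 - A * q ^ (n - 1)) * (1 - B * q ^ (n - 1)) * (1 - C * q ^ (n - 1))
    * (1 - D * q ^ (n - 1))

/-- `(X_n)_{n ≥ n₀}` satisfies `X_{n+1} - (z - a_n) X_n + b_n² X_{n-1} = 0` for `n > n₀`.
Only the values of `X` at the integers `n ≥ n₀` matter. -/
def IsSolution (q A B C D z : ℂ) (n₀ : ℤ) (X : ℤ → ℂ) : Prop :=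
  ∀ n : ℤ, n₀ < n →
    X (n + 1) - (z - coeffA q A B C D n) * X n + coeffBsq q A B C D n * X (n - 1) = 0

/-- Linear independence of the sequences `(X_n)_{n ≥ n₀}` and `(Y_n)_{n ≥ n₀}`. -/
def IndepSeq (n₀ : ℤ) (X Y : ℤ → ℂ) : Prop :=
  LinearIndependent ℂ ![fun n : Set.Ici n₀ => X n, fun n : Set.Ici n₀ => Y n]

/-- `(X_n)_{n ≥ n₀}` is a minimal (subdominant) solution: a nonzero solution with `X_n / Y_n → 0`
as `n → ∞` for every solution `Y` that is linearly independent of `X`. -/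
def IsMinimal (q A B C D z : ℂ) (n₀ : ℤ) (X : ℤ → ℂ) : Prop :=
  IsSolution q A B C D z n₀ X ∧ (∃ n : ℤ, n₀ ≤ n ∧ X n ≠ 0) ∧
    ∀ Y : ℤ → ℂ, IsSolution q A B C D z n₀ Y → IndepSeq n₀ X Y →
      (∀ᶠ n in atTop, Y n ≠ 0) ∧ Tendsto (fun n : ℤ => X n / Y n) atTop (𝓝 0)

/-- `λ₊ = (z + r) / 2`, where `r` is a square root of `z² - 4q/(ABCD)`. -/
def lamP (z r : ℂ) : ℂ := (z + r) / 2

/-- `λ₋ = (z - r) / 2`, where `r` is a square root of `z² - 4q/(ABCD)`. -/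
def lamM (z r : ℂ) : ℂ := (z - r) / 2

/-- `X_n^{(1),±}`, where `l` is `λ_±`. -/
def X1 (q A B C D l : ℂ) (n : ℤ) : ℂ :=
  qPoch q A n * qPoch q B n * qPoch q C n * qPoch q D n
      / (qPoch q (B * C * D * l) n * qPoch q (A * B * C * l) n) * l ^ n
    * phi q (B * C * l) (B * q ^ n) (C * q ^ n) (B * C * D * l * q ^ n) (A * B * C * l * q ^ n)
        (A * D * l)

/-- `X_n^{(2)}`, where `lp = λ₊` and `lm = λ₋`. -/
def X2 (q A B C D lp lm : ℂ) (n : ℤ) : ℂ :=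
  qPoch q A n * qPoch q B n / (A * B) ^ n
    * phi q (A * q ^ n) (A * B * lp) (A * B * lm) (A * q / C) (A * q / D) (q ^ (1 - n) / B)

/-- `X_n^{(3)}`, where `lp = λ₊` and `lm = λ₋`. -/
def X3 (q A B C D lp lm : ℂ) (n : ℤ) : ℂ :=
  qPoch q A n * qPoch q B n / (A * B) ^ n
    * phi q (B * q ^ n) (A * B * lp) (A * B * lm) (B * q / C) (B * q / D) (q ^ (1 - n) / A)

/-- `X_n^{(4)}`, where `lp = λ₊` and `lm = λ₋`. -/
def X4 (q A B C D lp lm : ℂ) (n : ℤ) : ℂ :=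
  qPoch q B n * qPoch q C n / (B * C) ^ n
    * phi q (C * q ^ n) (B * C * lp) (B * C * lm) (C * q / A) (C * q / D) (q ^ (1 - n) / B)

/-- `X_n^{(5)}`, where `lp = λ₊` and `lm = λ₋`. -/
def X5 (q A B C D lp lm : ℂ) (n : ℤ) : ℂ :=
  qPoch q B n * qPoch q D n / (B * D) ^ n
    * phi q (D * q ^ n) (B * D * lp) (B * D * lm) (D * q / C) (D * q / A) (q ^ (1 - n) / B)

/-- The six functions `X^{(1),+}, X^{(1),-}, X^{(2)}, X^{(3)}, X^{(4)}, X^{(5)}`. -/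
def family (q A B C D lp lm : ℂ) : Fin 6 → ℤ → ℂ :=
  ![X1 q A B C D lp, X1 q A B C D lm, X2 q A B C D lp lm, X3 q A B C D lp lm,
    X4 q A B C D lp lm, X5 q A B C D lp lm]

/-- `y` is not an integer power of `q`. -/
def NotPow (q y : ℂ) : Prop := ∀ k : ℤ, y ≠ q ^ k

/-- No denominator of `X_n^{(1),±}` vanishes for `n ≥ n₀` (`n₀ ≤ 0`), and the argument of its
`₃φ₂` is not a pole. -/
def X1Defined (q A B C D l : ℂ) (n₀ : ℤ) : Prop :=
  (∀ m : ℤ, n₀ ≤ m → B * C * D * l * q ^ m ≠ 1) ∧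
  (∀ m : ℤ, n₀ ≤ m → A * B * C * l * q ^ m ≠ 1) ∧
  ∀ k : ℕ, A * D * l * q ^ k ≠ 1

/-- No denominator of `₃φ₂(…; A₁q/A₂, A₁q/A₃; q^{1-n}/A₄)` vanishes, and the argument is not a pole
for any `n ≥ n₀`. -/
def XkDefined (q A₁ A₂ A₃ A₄ : ℂ) (n₀ : ℤ) : Prop :=
  (∀ k : ℕ, A₁ * q / A₂ * q ^ k ≠ 1) ∧ (∀ k : ℕ, A₁ * q / A₃ * q ^ k ≠ 1) ∧
  ∀ n : ℤ, n₀ ≤ n → ∀ k : ℕ, q ^ (1 - n) / A₄ * q ^ k ≠ 1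

/-- The members of `family` are well defined for `n ≥ n₀`. -/
def familyDefined (q A B C D lp lm : ℂ) (n₀ : ℤ) : Fin 6 → Prop :=
  ![X1Defined q A B C D lp n₀, X1Defined q A B C D lm n₀, XkDefined q A C D B n₀,
    XkDefined q B C D A n₀, XkDefined q C A D B n₀, XkDefined q D C A B n₀]

/-- General position: none of `A, B, C, D`, of their mutual ratios, of `λ₊/λ₋`, of the products of
one or of two distinct parameters with `λ₊` or `λ₋`, is an integer power of `q`. -/
def GeneralPosition (q A B C D lp lm : ℂ) : Prop :=
  (∀ y ∈ [A, B, C, D, A / B, A / C, A / D, B / C, B / D, C / D, lp / lm], NotPow q y) ∧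
  ∀ l ∈ [lp, lm], ∀ y ∈ [A, B, C, D, A * B, A * C, A * D, B * C, B * D, C * D],
    NotPow q (y * l)

end QHahn

end

/-! Everything is transferred to an entire function. Multiplying `₃φ₂` by `(w, d, e)_∞` removes the
poles in the argument and in the denominator parameters. The resulting `Psi` is holomorphic along
every holomorphic curve in the space of its six arguments, so identities checked for `‖w‖ < 1` hold
everywhere. Raising one parameter by `q` costs a dilation `w ↦ q w` (`Psi_mul_left`,
`Psi_eq_mul_denom`), and `Psi_functional` is a linear relation between four successive dilates.

For (i), put `t = q^n`. Up to constants and infinite products, the six solutions are `hahnU` (for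
`X^{(2)}` to `X^{(5)}`, after permuting the parameters) or `hahnV` (for `X^{(1),±}`) evaluated at
`t`. The contiguous relations express the values at `s`, `qs`, `q²s` through dilates of one `Psi`.
The functional equation then yields the recurrence, because the argument is exactly the one for
which its highest dilate drops out (`hahnU_recurrence`, `hahnV_recurrence`).

For (ii), suppose the Casoratian of two of the functions vanishes at `n = 0`. As a function of
continuous `t`, a normalised Wronskian satisfies a first-order `q`-difference equation, so it
vanishes on a `q`-orbit. This alone does not make it zero. After division by infinite products it
becomes a quasi-periodic function on a punctured disc. Such functions are multiples of a theta
function, because quasi-periodicity ties all Laurent coefficients to a single one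
(`eq_zero_of_quasiperiodic`). General position keeps the orbit away from the theta zeros, so the
Wronskian is identically zero (`wronskian_UV_eq_zero`, `wronskian_UU_eq_zero`). It is then evaluated
where one of its two terms drops out and the other is a product of closed forms, given by a
terminating case, the `q`-Gauss sum or the value at argument `1`; that product is nonzero. For the
pair `X^{(1),±}` the Wronskian extends continuously to `t = 0`, and its value there suffices
(`indepSeq_VV`).

For (iii), the numbers `2αλ_±` have product `1` and half-sum `x`, so `x ∉ [-1, 1]` forces `|λ₊| ≠
|λ₋|`. With `|λ₋| < |λ₊|`, the `q`-binomial theorem gives `X^{(1),-}_n ~ c λ₋^n` with `c ≠ 0`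
(`exists_tendsto_X1`), while every Casoratian of independent solutions behaves like `(λ₊λ₋)^n`.
Hence an independent solution grows like `λ₊^n` (`tendsto_div_of_casoratian`). -/

noncomputable section

namespace QHahn

variable {q : ℂ}

/-! ### Infinite `q`-shifted factorials and first-order `q`-difference equations -/

/-- The infinite `q`-shifted factorial `(x; q)_∞`. -/
def qInf (q x : ℂ) : ℂ := ∏' j : ℕ, (1 - x * q ^ j)

theorem summable_mul_pow (hq1 : ‖q‖ < 1) (x : ℂ) : Summable fun j : ℕ => ‖-(x * q ^ j)‖ := by
  simp only [norm_neg, norm_mul, norm_pow]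
  exact (summable_geometric_of_lt_one (norm_nonneg _) hq1).mul_left _

theorem multipliable_qInf (hq1 : ‖q‖ < 1) (x : ℂ) : Multipliable fun j : ℕ => 1 - x * q ^ j := by
  simpa [sub_eq_add_neg] using multipliable_one_add_of_summable (summable_mul_pow hq1 x)

theorem qInf_ne_zero (hq1 : ‖q‖ < 1) {x : ℂ} (hx : ∀ k : ℕ, x * q ^ k ≠ 1) : qInf q x ≠ 0 := by
  have := tprod_one_add_ne_zero_of_summable (f := fun j : ℕ => -(x * q ^ j))
    (fun j => by simpa [← sub_eq_add_neg, sub_eq_zero] using (hx j).symm) (summable_mul_pow hq1 x)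
  simpa [qInf, sub_eq_add_neg] using this

theorem qInf_zero_right (q : ℂ) : qInf q 0 = 1 := by simp [qInf]

theorem qInf_eq (hq1 : ‖q‖ < 1) (x : ℂ) : qInf q x = (1 - x) * qInf q (q * x) := by
  unfold qInf
  rw [tprod_eq_zero_mul' ?_]
  · simp only [pow_zero, mul_one, pow_succ']
    congr 1
    exact tprod_congr fun j => by ring
  · convert multipliable_qInf hq1 (q * x) using 2 with j
    rw [pow_succ']; ring

theorem differentiable_qInf (hq1 : ‖q‖ < 1) : Differentiable ℂ (qInf q) := by
  have key : ∀ R : ℝ, DifferentiableOn ℂ (qInf q) (Metric.ball 0 R) := by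
    intro R
    have h := Summable.hasProdLocallyUniformlyOn_nat_one_add (K := Metric.ball (0 : ℂ) R)
      (f := fun (j : ℕ) (x : ℂ) => -(x * q ^ j)) (u := fun j => R * ‖q‖ ^ j) Metric.isOpen_ball
      ((summable_geometric_of_lt_one (norm_nonneg _) hq1).mul_left _)
      (Eventually.of_forall fun j x hx => by
        rw [mem_ball_zero_iff] at hx
        rw [norm_neg, norm_mul, norm_pow]
        gcongr) (fun j => by fun_prop)
    have h2 := h.differentiableOn (Eventually.of_forall fun s => by
      simpa [Finset.prod_fn] using DifferentiableOn.finsetProd (fun _ _ => by fun_prop))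
      Metric.isOpen_ball
    have h3 : qInf q = fun x => ∏' i : ℕ, (1 + -(x * q ^ i)) := by
      funext x; simp [qInf, sub_eq_add_neg]
    rwa [h3]
  intro x
  exact (key (‖x‖ + 1)).differentiableAt (Metric.isOpen_ball.mem_nhds (by simp))

/-- Comparing with a geometric series makes the bound independent of `n`; it therefore passes to the
infinite product and later bounds all series coefficients at once. -/
theorem norm_prod_le (hq1 : ‖q‖ < 1) (x : ℂ) (n : ℕ) :
    ‖∏ j ∈ Finset.range n, (1 - x * q ^ j)‖ ≤ Real.exp (‖x‖ * (1 - ‖q‖)⁻¹) := by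
  calc ‖∏ j ∈ Finset.range n, (1 - x * q ^ j)‖
      ≤ ∏ j ∈ Finset.range n, (1 + ‖x‖ * ‖q‖ ^ j) := by
        rw [norm_prod]
        refine Finset.prod_le_prod (fun _ _ => norm_nonneg _) fun j _ => ?_
        refine (norm_sub_le _ _).trans ?_
        simp
    _ ≤ Real.exp (∑ j ∈ Finset.range n, ‖x‖ * ‖q‖ ^ j) :=
        Real.prod_one_add_le_exp_sum _ fun j => by positivity
    _ ≤ _ := by
        rw [← Finset.mul_sum, ← tsum_geometric_of_lt_one (norm_nonneg _) hq1]
        gcongr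
        exact (summable_geometric_of_lt_one (norm_nonneg _) hq1).sum_le_tsum _
          fun j _ => by positivity

theorem norm_qInf_le (hq1 : ‖q‖ < 1) (x : ℂ) :
    ‖qInf q x‖ ≤ Real.exp (‖x‖ * (1 - ‖q‖)⁻¹) :=
  le_of_tendsto (multipliable_qInf hq1 x).hasProd.tendsto_prod_nat.norm
    (Eventually.of_forall (norm_prod_le hq1 x))

theorem tendsto_pow_mul_nhds_zero (hq1 : ‖q‖ < 1) (x : ℂ) :
    Tendsto (fun n : ℕ => q ^ n * x) atTop (𝓝 0) := by
  simpa using (tendsto_pow_atTop_nhds_zero_of_norm_lt_one hq1).mul_const x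

/-- A function continuous at `0` with `f x = (1 - α x) (1 - β x) f (q x)` is a product of infinite
`q`-shifted factorials. -/
theorem eq_qInf_mul_of_functional (hq1 : ‖q‖ < 1) {f : ℂ → ℂ} (hf : ContinuousAt f 0) (α β : ℂ)
    -- The equation is iterated `n` times; since `q ^ n * x → 0`, continuity at `0` lets `n → ∞`.
    (h : ∀ x, f x = (1 - α * x) * (1 - β * x) * f (q * x)) (x : ℂ) :
    f x = qInf q (α * x) * qInf q (β * x) * f 0 := by
  have hn : ∀ n : ℕ, f x = (∏ j ∈ Finset.range n, (1 - α * x * q ^ j))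
      * (∏ j ∈ Finset.range n, (1 - β * x * q ^ j)) * f (q ^ n * x) := by
    intro n
    induction n with
    | zero => simp
    | succ n ih =>
      rw [ih, h (q ^ n * x), Finset.prod_range_succ, Finset.prod_range_succ]
      have : q * (q ^ n * x) = q ^ (n + 1) * x := by ring
      rw [this]
      ring
  have hl : Tendsto (fun n : ℕ => (∏ j ∈ Finset.range n, (1 - α * x * q ^ j))
      * (∏ j ∈ Finset.range n, (1 - β * x * q ^ j)) * f (q ^ n * x)) atTop
      (𝓝 (qInf q (α * x) * qInf q (β * x) * f 0)) :=
    (((multipliable_qInf hq1 _).hasProd.tendsto_prod_nat).mul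
      ((multipliable_qInf hq1 _).hasProd.tendsto_prod_nat)).mul
      (hf.tendsto.comp (tendsto_pow_mul_nhds_zero hq1 x))
  exact tendsto_nhds_unique (tendsto_const_nhds.congr hn) hl

theorem eq_qInf_mul_of_functional_one (hq1 : ‖q‖ < 1) {f : ℂ → ℂ} (hf : ContinuousAt f 0) (α : ℂ)
    (h : ∀ x, f x = (1 - α * x) * f (q * x)) (x : ℂ) : f x = qInf q (α * x) * f 0 := by
  simpa [qInf_zero_right] using eq_qInf_mul_of_functional hq1 hf α 0 (by simpa using h) x

/-! ### The series with its denominators cleared -/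

/-- The coefficients of the series `(d, e)_∞ ₃φ₂(a, b, c; d, e; w)`. -/
def regCoeff (q a b c d e : ℂ) (k : ℕ) : ℂ :=
  qPoch q a k * qPoch q b k * qPoch q c k * (qInf q (d * q ^ k) * qInf q (e * q ^ k))
    / qPoch q q k

theorem qPoch_succ_natCast (q x : ℂ) (k : ℕ) :
    qPoch q x ((k + 1 : ℕ) : ℤ) = qPoch q x (k : ℤ) * (1 - x * q ^ k) := by
  rw [qPoch_natCast, qPoch_natCast, Finset.prod_range_succ]

theorem mul_pow_ne_one_of_norm_lt (hq1 : ‖q‖ < 1) {x : ℂ} (hx : ‖x‖ < 1) (k : ℕ) :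
    x * q ^ k ≠ 1 := by
  intro h
  have h2 : ‖x * q ^ k‖ < 1 := by
    rw [norm_mul, norm_pow]
    exact mul_lt_one_of_nonneg_of_lt_one_left (norm_nonneg _) hx
      (pow_le_one₀ (norm_nonneg _) hq1.le)
  rw [h, norm_one] at h2
  exact lt_irrefl _ h2

theorem regCoeff_zero (q a b c d e : ℂ) : regCoeff q a b c d e 0 = qInf q d * qInf q e := by
  simp [regCoeff, qPoch]

theorem regCoeff_succ (hq1 : ‖q‖ < 1) (a b c d e : ℂ) (k : ℕ) :
    regCoeff q a b c d e (k + 1)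
        * ((1 - d * q ^ k) * (1 - e * q ^ k) * (1 - q ^ (k + 1)))
      = regCoeff q a b c d e k
        * ((1 - a * q ^ k) * (1 - b * q ^ k) * (1 - c * q ^ k)) := by
  have hk : 1 - q * q ^ k ≠ 0 := sub_ne_zero.2 (mul_pow_ne_one_of_norm_lt hq1 hq1 k).symm
  have e1 : ∀ x : ℂ, q * (x * q ^ k) = x * q ^ (k + 1) := fun x => by ring
  simp only [regCoeff]
  rw [qInf_eq hq1 (d * q ^ k), qInf_eq hq1 (e * q ^ k), e1, e1]
  rw [mul_comm] at hk
  simp only [qPoch_succ_natCast, pow_succ q k]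
  rw [mul_comm q (q ^ k)]
  field_simp

theorem exists_inv_qPoch_self_bound (hq1 : ‖q‖ < 1) : ∃ K : ℝ, 0 ≤ K ∧
    ∀ k : ℕ, ‖(qPoch q q k)⁻¹‖ ≤ K := by
  have ht : Tendsto (fun k : ℕ => (qPoch q q k)⁻¹) atTop (𝓝 (qInf q q)⁻¹) := by
    simp only [qPoch_natCast]
    exact ((multipliable_qInf hq1 q).hasProd.tendsto_prod_nat).inv₀
      (qInf_ne_zero hq1 (mul_pow_ne_one_of_norm_lt hq1 hq1))
  obtain ⟨K, hK⟩ := (Metric.isBounded_range_of_tendsto _ ht).exists_norm_le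
  exact ⟨K, (norm_nonneg _).trans (hK _ ⟨0, rfl⟩), fun k => hK _ ⟨k, rfl⟩⟩

/-- The bound is uniform in `k` and in parameters of bounded size. This gives locally uniform
convergence when the parameters move together with the argument. -/
theorem exists_regCoeff_bound (hq1 : ‖q‖ < 1) (R : ℝ) : ∃ K : ℝ, ∀ a b c d e : ℂ,
    ‖a‖ ≤ R → ‖b‖ ≤ R → ‖c‖ ≤ R → ‖d‖ ≤ R → ‖e‖ ≤ R → ∀ k : ℕ,
      ‖regCoeff q a b c d e k‖ ≤ K := by
  obtain ⟨K, hK0, hK⟩ := exists_inv_qPoch_self_bound hq1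
  have hq' : 0 ≤ (1 - ‖q‖)⁻¹ := inv_nonneg.2 (sub_nonneg.2 hq1.le)
  set E := Real.exp (R * (1 - ‖q‖)⁻¹) with hE
  have h1 : ∀ x : ℂ, ‖x‖ ≤ R → ∀ k : ℕ, ‖qPoch q x k‖ ≤ E := fun x hx k => by
    rw [qPoch_natCast]
    exact (norm_prod_le hq1 x k).trans (Real.exp_le_exp.2 (by gcongr))
  have h2 : ∀ x : ℂ, ‖x‖ ≤ R → ∀ k : ℕ, ‖qInf q (x * q ^ k)‖ ≤ E := fun x hx k => by
    refine (norm_qInf_le hq1 _).trans (Real.exp_le_exp.2 ?_)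
    gcongr
    refine le_trans ?_ hx
    rw [norm_mul, norm_pow]
    exact mul_le_of_le_one_right (norm_nonneg _) (pow_le_one₀ (norm_nonneg _) hq1.le)
  refine ⟨E * E * E * (E * E) * K, fun a b c d e ha hb hc hd he k => ?_⟩
  rw [regCoeff, div_eq_mul_inv]
  simp only [norm_mul]
  gcongr
  exacts [h1 a ha k, h1 b hb k, h1 c hc k, h2 d hd k, h2 e he k, hK k]

theorem summable_reg (hq1 : ‖q‖ < 1) (a b c d e : ℂ) {w : ℂ} (hw : ‖w‖ < 1) :
    Summable fun k : ℕ => regCoeff q a b c d e k * w ^ k := by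
  obtain ⟨K, hK⟩ := exists_regCoeff_bound hq1 (‖a‖ + ‖b‖ + ‖c‖ + ‖d‖ + ‖e‖)
  have := norm_nonneg a
  have := norm_nonneg b
  have := norm_nonneg c
  have := norm_nonneg d
  have := norm_nonneg e
  refine Summable.of_norm_bounded
    ((summable_geometric_of_lt_one (norm_nonneg w) hw).mul_left K) fun k => ?_
  rw [norm_mul, norm_pow]
  gcongr
  exact hK a b c d e (by linarith) (by linarith) (by linarith) (by linarith) (by linarith) k

/-- The series `(d, e)_∞ ₃φ₂(a, b, c; d, e; w)`. -/
def regSeries (q a b c d e w : ℂ) : ℂ := ∑' k : ℕ, regCoeff q a b c d e k * w ^ k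

/-- Holomorphy along one-variable curves replaces holomorphy in several variables; every later use
moves the arguments along such a curve. -/
theorem differentiableOn_regSeries (hq1 : ‖q‖ < 1) {U : Set ℂ} (hU : IsOpen U)
    {a b c d e w : ℂ → ℂ} (ha : DifferentiableOn ℂ a U) (hb : DifferentiableOn ℂ b U)
    (hc : DifferentiableOn ℂ c U) (hd : DifferentiableOn ℂ d U) (he : DifferentiableOn ℂ e U)
    (hw : DifferentiableOn ℂ w U) (hw1 : ∀ x ∈ U, ‖w x‖ < 1) :
    DifferentiableOn ℂ (fun x => regSeries q (a x) (b x) (c x) (d x) (e x) (w x)) U := by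
  intro x₀ hx₀
  obtain ⟨ρ, hρ0, hρ1⟩ := exists_between (hw1 x₀ hx₀)
  have hρ : 0 ≤ ρ := (norm_nonneg _).trans hρ0.le
  have hbd : ∀ {f : ℂ → ℂ}, DifferentiableOn ℂ f U → ∀ r : ℝ, ‖f x₀‖ < r →
      ∀ᶠ x in 𝓝 x₀, ‖f x‖ < r := fun {f} hf r hr =>
    ((hf.differentiableAt (hU.mem_nhds hx₀)).continuousAt.norm).eventually (gt_mem_nhds hr)
  set R : ℝ := ‖a x₀‖ + ‖b x₀‖ + ‖c x₀‖ + ‖d x₀‖ + ‖e x₀‖ + 1 with hR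
  have n1 := norm_nonneg (a x₀)
  have n2 := norm_nonneg (b x₀)
  have n3 := norm_nonneg (c x₀)
  have n4 := norm_nonneg (d x₀)
  have n5 := norm_nonneg (e x₀)
  obtain ⟨K, hK⟩ := exists_regCoeff_bound hq1 R
  have hev := (hU.eventually_mem hx₀).and <| (hbd ha R (by linarith)).and <|
    (hbd hb R (by linarith)).and <| (hbd hc R (by linarith)).and <|
    (hbd hd R (by linarith)).and <| (hbd he R (by linarith)).and (hbd hw ρ hρ0)
  obtain ⟨V, hV, hVo, hxV⟩ := eventually_nhds_iff.1 hev
  have hVU : V ⊆ U := fun x hx => (hV x hx).1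
  have hpoch : ∀ {f : ℂ → ℂ}, DifferentiableOn ℂ f U → ∀ k : ℕ,
      DifferentiableOn ℂ (fun x => qPoch q (f x) k) V := by
    intro f hf k
    simp only [qPoch_natCast]
    have hf' := hf.mono hVU
    exact DifferentiableOn.fun_finsetProd fun j _ => by fun_prop
  have hinf : ∀ {f : ℂ → ℂ}, DifferentiableOn ℂ f U → ∀ k : ℕ,
      DifferentiableOn ℂ (fun x => qInf q (f x * q ^ k)) V := by
    intro f hf k
    have hf' := hf.mono hVU
    exact (differentiable_qInf hq1).comp_differentiableOn (by fun_prop)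
  have key : DifferentiableOn ℂ
      (fun x => regSeries q (a x) (b x) (c x) (d x) (e x) (w x)) V := by
    refine Complex.differentiableOn_tsum_of_summable_norm
      (u := fun k => K * ρ ^ k) ((summable_geometric_of_lt_one hρ hρ1).mul_left K)
      (fun k => ?_) hVo fun k x hx => ?_
    · simp only [regCoeff]
      exact ((((hpoch ha k).mul (hpoch hb k)).mul (hpoch hc k)).mul
        ((hinf hd k).mul (hinf he k))).div_const _ |>.mul ((hw.mono hVU).pow k)
    · obtain ⟨-, h1, h2, h3, h4, h5, h6⟩ := hV x hx
      rw [norm_mul, norm_pow]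
      have := hK _ _ _ _ _ h1.le h2.le h3.le h4.le h5.le k
      have hK0 : 0 ≤ K := (norm_nonneg _).trans this
      gcongr
  exact (key.differentiableAt (hVo.mem_nhds hxV)).differentiableWithinAt

/-- A factor `q ^ k` in the coefficients is a dilation `w ↦ q w` of the sum. The two sides of
`regCoeff_succ`, multiplied by `w ^ (k + 1)` and summed, are expanded in this way. -/
theorem regSeries_functional (hq0 : q ≠ 0) (hq1 : ‖q‖ < 1) (a b c d e : ℂ) {w : ℂ}
    (hw : ‖w‖ < 1) :
    (1 - w) * regSeries q a b c d e w =
      ((1 + d / q + e / q) - w * (a + b + c)) * regSeries q a b c d e (q * w)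
      + (w * (a * b + a * c + b * c) - (d / q + e / q + d / q * (e / q)))
        * regSeries q a b c d e (q ^ 2 * w)
      + (d / q * (e / q) - w * (a * b * c)) * regSeries q a b c d e (q ^ 3 * w) := by
  have hwj : ∀ j : ℕ, ‖q ^ j * w‖ < 1 := by
    intro j
    rw [norm_mul, norm_pow]
    exact mul_lt_one_of_nonneg_of_lt_one_right (pow_le_one₀ (norm_nonneg _) hq1.le)
      (norm_nonneg _) hw
  have hS : ∀ j : ℕ, HasSum (fun k : ℕ => regCoeff q a b c d e k * (q ^ j * w) ^ k)
      (regSeries q a b c d e (q ^ j * w)) := fun j => (summable_reg hq1 a b c d e (hwj j)).hasSum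
  set s := regCoeff q a b c d e with hs
  set F := regSeries q a b c d e with hF
  have hL : HasSum (fun k : ℕ =>
      s k * ((1 - q ^ k) * (1 - d / q * q ^ k) * (1 - e / q * q ^ k)) * w ^ k)
      (F (q ^ 0 * w) - (1 + d / q + e / q) * F (q ^ 1 * w)
        + (d / q + e / q + d / q * (e / q)) * F (q ^ 2 * w)
        - d / q * (e / q) * F (q ^ 3 * w)) := by
    refine ((((hS 0).sub ((hS 1).mul_left (1 + d / q + e / q))).add
      ((hS 2).mul_left (d / q + e / q + d / q * (e / q)))).sub
      ((hS 3).mul_left (d / q * (e / q)))).congr_fun ?_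
    intro k
    simp only [mul_pow, ← pow_mul]
    ring
  have hR : HasSum (fun k : ℕ =>
      s k * ((1 - a * q ^ k) * (1 - b * q ^ k) * (1 - c * q ^ k)) * w ^ (k + 1))
      (w * (F (q ^ 0 * w) - (a + b + c) * F (q ^ 1 * w)
        + (a * b + a * c + b * c) * F (q ^ 2 * w)
        - a * b * c * F (q ^ 3 * w))) := by
    refine (((((hS 0).sub ((hS 1).mul_left (a + b + c))).add
      ((hS 2).mul_left (a * b + a * c + b * c))).sub
      ((hS 3).mul_left (a * b * c))).mul_left w).congr_fun ?_
    intro k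
    simp only [mul_pow, ← pow_mul]
    ring
  have hL' := (hasSum_nat_add_iff' 1).2 hL
  simp only [Finset.sum_range_one, pow_zero, sub_self, zero_mul, mul_zero, sub_zero] at hL'
  have hfun : (fun k : ℕ => s (k + 1) * ((1 - q ^ (k + 1)) * (1 - d / q * q ^ (k + 1))
      * (1 - e / q * q ^ (k + 1))) * w ^ (k + 1)) = fun k : ℕ =>
      s k * ((1 - a * q ^ k) * (1 - b * q ^ k) * (1 - c * q ^ k)) * w ^ (k + 1) := by
    funext k
    have e1 : ∀ x : ℂ, x / q * q ^ (k + 1) = x * q ^ k := by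
      intro x; rw [pow_succ']; field_simp
    rw [e1, e1, ← regCoeff_succ hq1 a b c d e k]
    ring
  rw [hfun] at hL'
  have key := hL'.unique hR
  simp only [pow_zero, one_mul, pow_one] at key
  linear_combination key

/-! ### The entire function `Psi` -/

/-- The functional equation of `(w, d, e)_∞ ₃φ₂(a, b, c; d, e; w)` as an operator on functions
of `w`. -/
def psiStep (q a b c d e : ℂ) (f : ℂ → ℂ) (w : ℂ) : ℂ :=
  ((1 + d / q + e / q) - w * (a + b + c)) * f (q ^ (0 + 1) * w)
    + (w * (a * b + a * c + b * c) - (d / q + e / q + d / q * (e / q))) * (1 - q * w)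
      * f (q ^ (1 + 1) * w)
    + (d / q * (e / q) - w * (a * b * c)) * ((1 - q * w) * (1 - q ^ 2 * w))
      * f (q ^ (2 + 1) * w)

/-- The iterates of the functional equation, started from the series. -/
def psiIter (q a b c d e : ℂ) : ℕ → ℂ → ℂ
  | 0 => fun w => qInf q w * regSeries q a b c d e w
  | r + 1 => psiStep q a b c d e (psiIter q a b c d e r)

/-- The entire function `(w, d, e)_∞ ₃φ₂(a, b, c; d, e; w)` of all its arguments. -/
def Psi (q a b c d e w : ℂ) : ℂ := limUnder atTop fun r : ℕ => psiIter q a b c d e r w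

theorem exists_norm_mul_pow_lt (hq1 : ‖q‖ < 1) (w : ℂ) : ∃ r : ℕ, ‖w‖ * ‖q‖ ^ r < 1 := by
  have : Tendsto (fun r : ℕ => ‖w‖ * ‖q‖ ^ r) atTop (𝓝 (‖w‖ * 0)) :=
    (tendsto_pow_atTop_nhds_zero_of_lt_one (norm_nonneg _) hq1).const_mul _
  rw [mul_zero] at this
  exact (this.eventually (gt_mem_nhds one_pos)).exists

/-- The factor `(w)_∞` absorbs the division by `1 - w` in the functional equation. Each step
therefore enlarges the disc by the factor `‖q‖⁻¹` without creating poles, and agrees with the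
previous step on the smaller disc. -/
theorem psiIter_succ_eq (hq0 : q ≠ 0) (hq1 : ‖q‖ < 1) (a b c d e : ℂ) (r : ℕ) :
    ∀ w : ℂ, ‖w‖ * ‖q‖ ^ r < 1 → psiIter q a b c d e (r + 1) w = psiIter q a b c d e r w := by
  induction r with
  | zero =>
    intro w hw
    have hw' : ‖w‖ < 1 := by simpa using hw
    have h := regSeries_functional hq0 hq1 a b c d e hw'
    have e1 := qInf_eq hq1 w
    have e2 := qInf_eq hq1 (q * w)
    have e3 := qInf_eq hq1 (q * (q * w))
    have s2 : q * (q * w) = q ^ 2 * w := by ring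
    have s3 : q * (q ^ 2 * w) = q ^ 3 * w := by ring
    rw [s2] at e2 e3
    rw [s3] at e3
    simp only [psiIter, psiStep, zero_add, pow_one, Nat.reduceAdd]
    rw [e1]
    rw [show (1 - w) * qInf q (q * w) * regSeries q a b c d e w
      = qInf q (q * w) * ((1 - w) * regSeries q a b c d e w) by ring, h, e2, e3]
    ring
  | succ r ih =>
    intro w hw
    have hm := phi_step_mem hq1 hw
    conv_lhs => rw [psiIter]
    conv_rhs => rw [psiIter]
    simp only [psiStep, ih _ (hm 0), ih _ (hm 1), ih _ (hm 2)]

theorem Psi_eq_psiIter (hq0 : q ≠ 0) (hq1 : ‖q‖ < 1) (a b c d e : ℂ) {r : ℕ} {w : ℂ}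
    (hw : ‖w‖ * ‖q‖ ^ r < 1) : Psi q a b c d e w = psiIter q a b c d e r w := by
  have h : ∀ s : ℕ, psiIter q a b c d e (r + s) w = psiIter q a b c d e r w := by
    intro s
    induction s with
    | zero => rfl
    | succ s ih =>
      rw [← ih, ← add_assoc]
      refine psiIter_succ_eq hq0 hq1 _ _ _ _ _ _ _ (lt_of_le_of_lt ?_ hw)
      rw [pow_add]
      gcongr
      exact mul_le_of_le_one_right (by positivity) (pow_le_one₀ (norm_nonneg _) hq1.le)
  refine Tendsto.limUnder_eq (tendsto_const_nhds.congr' ?_)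
  filter_upwards [eventually_ge_atTop r] with s hs
  rw [← h (s - r), Nat.add_sub_cancel' hs]

theorem Psi_eq_regSeries (hq0 : q ≠ 0) (hq1 : ‖q‖ < 1) (a b c d e : ℂ) {w : ℂ} (hw : ‖w‖ < 1) :
    Psi q a b c d e w = qInf q w * regSeries q a b c d e w :=
  Psi_eq_psiIter hq0 hq1 a b c d e (r := 0) (by simpa using hw)

theorem differentiableOn_psiIter (hq1 : ‖q‖ < 1) {a b c d e : ℂ → ℂ} {U : Set ℂ}
    (hU : IsOpen U) (ha : DifferentiableOn ℂ a U) (hb : DifferentiableOn ℂ b U)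
    (hc : DifferentiableOn ℂ c U) (hd : DifferentiableOn ℂ d U) (he : DifferentiableOn ℂ e U)
    (r : ℕ) : ∀ w : ℂ → ℂ, DifferentiableOn ℂ w U → (∀ x ∈ U, ‖w x‖ * ‖q‖ ^ r < 1) →
      DifferentiableOn ℂ (fun x => psiIter q (a x) (b x) (c x) (d x) (e x) r (w x)) U := by
  induction r with
  | zero =>
    intro w hw hw1
    exact ((differentiable_qInf hq1).comp_differentiableOn hw).mul
      (differentiableOn_regSeries hq1 hU ha hb hc hd he hw (by simpa using hw1))
  | succ r ih =>
    intro w hw hw1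
    have h : ∀ j : ℕ, DifferentiableOn ℂ
        (fun x => psiIter q (a x) (b x) (c x) (d x) (e x) r (q ^ (j + 1) * w x)) U := fun j =>
      ih (fun x => q ^ (j + 1) * w x) (by fun_prop) fun x hx => phi_step_mem hq1 (hw1 x hx) j
    have h0 := h 0
    have h1 := h 1
    have h2 := h 2
    simp only [psiIter, psiStep]
    fun_prop

/-- Near each point a single iterate represents `Psi`, because the condition `‖w‖ * ‖q‖ ^ r < 1` is
open. -/
theorem differentiableOn_Psi (hq0 : q ≠ 0) (hq1 : ‖q‖ < 1) {U : Set ℂ} (hU : IsOpen U)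
    {a b c d e w : ℂ → ℂ} (ha : DifferentiableOn ℂ a U) (hb : DifferentiableOn ℂ b U)
    (hc : DifferentiableOn ℂ c U) (hd : DifferentiableOn ℂ d U) (he : DifferentiableOn ℂ e U)
    (hw : DifferentiableOn ℂ w U) :
    DifferentiableOn ℂ (fun x => Psi q (a x) (b x) (c x) (d x) (e x) (w x)) U := by
  intro x₀ hx₀
  obtain ⟨r, hr⟩ := exists_norm_mul_pow_lt hq1 (w x₀)
  have hev : ∀ᶠ x in 𝓝 x₀, x ∈ U ∧ ‖w x‖ * ‖q‖ ^ r < 1 :=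
    (hU.eventually_mem hx₀).and
      ((((hw.differentiableAt (hU.mem_nhds hx₀)).continuousAt.norm).mul_const _).eventually
        (gt_mem_nhds hr))
  obtain ⟨V, hV, hVo, hxV⟩ := eventually_nhds_iff.1 hev
  have hVU : V ⊆ U := fun x hx => (hV x hx).1
  have key := differentiableOn_psiIter hq1 hVo (ha.mono hVU) (hb.mono hVU) (hc.mono hVU)
    (hd.mono hVU) (he.mono hVU) r w (hw.mono hVU) fun x hx => (hV x hx).2
  have key' := key.congr fun x hx =>
    Psi_eq_psiIter hq0 hq1 (a x) (b x) (c x) (d x) (e x) (hV x hx).2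
  exact (key'.differentiableAt (hVo.mem_nhds hxV)).differentiableWithinAt

theorem differentiable_Psi (hq0 : q ≠ 0) (hq1 : ‖q‖ < 1) {a b c d e w : ℂ → ℂ}
    (ha : Differentiable ℂ a) (hb : Differentiable ℂ b) (hc : Differentiable ℂ c)
    (hd : Differentiable ℂ d) (he : Differentiable ℂ e) (hw : Differentiable ℂ w) :
    Differentiable ℂ fun x => Psi q (a x) (b x) (c x) (d x) (e x) (w x) :=
  differentiableOn_univ.1 (differentiableOn_Psi hq0 hq1 isOpen_univ ha.differentiableOn
    hb.differentiableOn hc.differentiableOn hd.differentiableOn he.differentiableOn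
    hw.differentiableOn)

/-- This transfers identities between power series to identities valid for every argument of `Psi`.
-/
theorem eq_of_eq_on_unit_ball {f g : ℂ → ℂ} (hf : Differentiable ℂ f) (hg : Differentiable ℂ g)
    (h : ∀ w : ℂ, ‖w‖ < 1 → f w = g w) (w : ℂ) : f w = g w := by
  have := (hf.differentiableOn.analyticOnNhd isOpen_univ).eq_of_eventuallyEq (z₀ := 0)
    (hg.differentiableOn.analyticOnNhd isOpen_univ) (by
      filter_upwards [Metric.ball_mem_nhds (0 : ℂ) one_pos] with w hw
      exact h w (by simpa using hw))
  exact congrFun this w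

theorem differentiable_Psi_arg (hq0 : q ≠ 0) (hq1 : ‖q‖ < 1) (a b c d e : ℂ) :
    Differentiable ℂ (Psi q a b c d e) :=
  differentiable_Psi hq0 hq1 (a := fun _ => a) (b := fun _ => b) (c := fun _ => c)
    (d := fun _ => d) (e := fun _ => e) (w := fun x => x) (by fun_prop) (by fun_prop)
    (by fun_prop) (by fun_prop) (by fun_prop) (by fun_prop)

theorem norm_mul_lt_one (hq1 : ‖q‖ < 1) {w : ℂ} (hw : ‖w‖ < 1) : ‖q * w‖ < 1 := by
  rw [norm_mul]
  exact mul_lt_one_of_nonneg_of_lt_one_right hq1.le (norm_nonneg _) hw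

theorem Psi_functional (hq0 : q ≠ 0) (hq1 : ‖q‖ < 1) (a b c d e w : ℂ) :
    Psi q a b c d e w =
      ((1 + d / q + e / q) - w * (a + b + c)) * Psi q a b c d e (q * w)
      + (w * (a * b + a * c + b * c) - (d / q + e / q + d / q * (e / q))) * (1 - q * w)
        * Psi q a b c d e (q ^ 2 * w)
      + (d / q * (e / q) - w * (a * b * c)) * ((1 - q * w) * (1 - q ^ 2 * w))
        * Psi q a b c d e (q ^ 3 * w) := by
  have hP := differentiable_Psi_arg hq0 hq1 a b c d e
  revert w
  refine eq_of_eq_on_unit_ball hP ?_ fun w hw => ?_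
  · fun_prop
  have h1 := norm_mul_lt_one hq1 hw
  have h2 := norm_mul_lt_one hq1 h1
  have h3 := norm_mul_lt_one hq1 h2
  rw [show q * (q * w) = q ^ 2 * w by ring] at h2 h3
  rw [show q * (q ^ 2 * w) = q ^ 3 * w by ring] at h3
  -- On the unit disc `Psi` is also its first iterate, which by definition is the right-hand side.
  rw [Psi_eq_psiIter hq0 hq1 a b c d e (r := 1) (w := w) (by
    simpa using mul_lt_one_of_nonneg_of_lt_one_right hw.le (norm_nonneg q) hq1)]
  rw [Psi_eq_regSeries hq0 hq1 _ _ _ _ _ h1, Psi_eq_regSeries hq0 hq1 _ _ _ _ _ h2,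
    Psi_eq_regSeries hq0 hq1 _ _ _ _ _ h3]
  simp [psiIter, psiStep]

/-! ### Contiguous relations and closed evaluations -/

/-- Raising the first numerator parameter. -/
theorem Psi_mul_left (hq0 : q ≠ 0) (hq1 : ‖q‖ < 1) (a b c d e w : ℂ) :
    (1 - a) * Psi q (q * a) b c d e w
      = Psi q a b c d e w - a * (1 - w) * Psi q a b c d e (q * w) := by
  have hP := differentiable_Psi_arg hq0 hq1 a b c d e
  have hP' := differentiable_Psi_arg hq0 hq1 (q * a) b c d e
  revert w
  refine eq_of_eq_on_unit_ball ?_ ?_ fun w hw => ?_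
  · fun_prop
  · fun_prop
  have h1 := norm_mul_lt_one hq1 hw
  rw [Psi_eq_regSeries hq0 hq1 _ _ _ _ _ hw, Psi_eq_regSeries hq0 hq1 _ _ _ _ _ h1,
    Psi_eq_regSeries hq0 hq1 _ _ _ _ _ hw, qInf_eq hq1 w]
  have hc : ∀ k : ℕ, (1 - a) * regCoeff q (q * a) b c d e k
      = (1 - a * q ^ k) * regCoeff q a b c d e k := by
    intro k
    have h : (1 - a) * qPoch q (q * a) k = (1 - a * q ^ k) * qPoch q a k := by
      rw [mul_comm (1 - a * q ^ k), ← qPoch_succ_natCast, qPoch_natCast, qPoch_natCast,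
        Finset.prod_range_succ']
      rw [pow_zero, mul_one, mul_comm]
      congr 1
      exact Finset.prod_congr rfl fun j _ => by ring
    simp only [regCoeff]
    linear_combination (qPoch q b k * qPoch q c k * (qInf q (d * q ^ k) * qInf q (e * q ^ k))
      / qPoch q q k) * h
  have h := ((summable_reg hq1 a b c d e hw).hasSum.sub
    ((summable_reg hq1 a b c d e h1).hasSum.mul_left a)).unique
    (((summable_reg hq1 (q * a) b c d e hw).hasSum.mul_left (1 - a)).congr_fun fun k => by
      rw [mul_pow]
      linear_combination (-w ^ k) * hc k)
  simp only [regSeries]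
  linear_combination (-(1 - w) * qInf q (q * w)) * h

/-- Raising the first denominator parameter. -/
theorem Psi_eq_mul_denom (hq0 : q ≠ 0) (hq1 : ‖q‖ < 1) (a b c d e w : ℂ) :
    Psi q a b c d e w
      = Psi q a b c (q * d) e w - d * (1 - w) * Psi q a b c (q * d) e (q * w) := by
  have hP := differentiable_Psi_arg hq0 hq1 a b c d e
  have hP' := differentiable_Psi_arg hq0 hq1 a b c (q * d) e
  revert w
  refine eq_of_eq_on_unit_ball ?_ ?_ fun w hw => ?_
  · fun_prop
  · fun_prop
  have h1 := norm_mul_lt_one hq1 hw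
  rw [Psi_eq_regSeries hq0 hq1 _ _ _ _ _ hw, Psi_eq_regSeries hq0 hq1 _ _ _ _ _ h1,
    Psi_eq_regSeries hq0 hq1 _ _ _ _ _ hw, qInf_eq hq1 w]
  have hc : ∀ k : ℕ, regCoeff q a b c d e k
      = (1 - d * q ^ k) * regCoeff q a b c (q * d) e k := by
    intro k
    have h : qInf q (d * q ^ k) = (1 - d * q ^ k) * qInf q (q * d * q ^ k) := by
      rw [qInf_eq hq1, mul_assoc]
    simp only [regCoeff]
    rw [h]
    ring
  have h := ((summable_reg hq1 a b c (q * d) e hw).hasSum.sub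
    ((summable_reg hq1 a b c (q * d) e h1).hasSum.mul_left d)).unique
    ((summable_reg hq1 a b c d e hw).hasSum.congr_fun fun k => by
      rw [mul_pow]
      linear_combination (-w ^ k) * hc k)
  simp only [regSeries]
  linear_combination (-(1 - w) * qInf q (q * w)) * h

theorem Psi_congr (hq0 : q ≠ 0) (hq1 : ‖q‖ < 1) {a b c d e a' b' c' d' e' K : ℂ}
    (h : ∀ k : ℕ, regCoeff q a b c d e k = K * regCoeff q a' b' c' d' e' k) (w : ℂ) :
    Psi q a b c d e w = K * Psi q a' b' c' d' e' w := by
  have hP := differentiable_Psi_arg hq0 hq1 a b c d e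
  have hP' := differentiable_Psi_arg hq0 hq1 a' b' c' d' e'
  revert w
  refine eq_of_eq_on_unit_ball ?_ ?_ fun w hw => ?_
  · fun_prop
  · fun_prop
  rw [Psi_eq_regSeries hq0 hq1 _ _ _ _ _ hw, Psi_eq_regSeries hq0 hq1 _ _ _ _ _ hw]
  simp only [regSeries, h, mul_assoc, tsum_mul_left]
  ring

theorem Psi_swap_left (hq0 : q ≠ 0) (hq1 : ‖q‖ < 1) (a b c d e w : ℂ) :
    Psi q a b c d e w = Psi q b a c d e w := by
  simpa using Psi_congr hq0 hq1 (K := 1) (fun k => by simp only [regCoeff]; ring) w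

theorem Psi_swap_right (hq0 : q ≠ 0) (hq1 : ‖q‖ < 1) (a b c d e w : ℂ) :
    Psi q a b c d e w = Psi q a c b d e w := by
  simpa using Psi_congr hq0 hq1 (K := 1) (fun k => by simp only [regCoeff]; ring) w

theorem Psi_swap_denom (hq0 : q ≠ 0) (hq1 : ‖q‖ < 1) (a b c d e w : ℂ) :
    Psi q a b c d e w = Psi q a b c e d w := by
  simpa using Psi_congr hq0 hq1 (K := 1) (fun k => by simp only [regCoeff]; ring) w

theorem Psi_arg_zero (hq0 : q ≠ 0) (hq1 : ‖q‖ < 1) (a b c d e : ℂ) :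
    Psi q a b c d e 0 = qInf q d * qInf q e := by
  rw [Psi_eq_regSeries hq0 hq1 _ _ _ _ _ (by simp), qInf_zero_right, regSeries,
    tsum_eq_single 0 (fun k hk => by simp [hk])]
  simp [regCoeff_zero]

/-- The series stops after its first term. Equivalently, `Psi_mul_left` degenerates at `a = 1` to a
first-order equation in `w`. -/
theorem Psi_one_left (hq0 : q ≠ 0) (hq1 : ‖q‖ < 1) (b c d e w : ℂ) :
    Psi q 1 b c d e w = qInf q w * (qInf q d * qInf q e) := by
  have hP := differentiable_Psi_arg hq0 hq1 1 b c d e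
  have h := eq_qInf_mul_of_functional_one hq1 (f := Psi q 1 b c d e)
    hP.continuous.continuousAt 1 (fun x => by
      have := Psi_mul_left hq0 hq1 1 b c d e x
      linear_combination -this) w
  rwa [one_mul, Psi_arg_zero hq0 hq1] at h

/-- The `q`-binomial theorem. -/
theorem Psi_binomial (hq0 : q ≠ 0) (hq1 : ‖q‖ < 1) (a w : ℂ) :
    Psi q a 0 0 0 0 w = qInf q (a * w) := by
  have hP := differentiable_Psi_arg hq0 hq1 a 0 0 0 0
  have h := eq_qInf_mul_of_functional_one hq1 (f := Psi q a 0 0 0 0)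
    hP.continuous.continuousAt a (fun x => by
      have := Psi_functional hq0 hq1 a 0 0 0 0 x
      rw [this]; ring) w
  rwa [Psi_arg_zero hq0 hq1, qInf_zero_right, mul_one, mul_one] at h

/-- The value at the first pole of the `₃φ₂`. -/
theorem Psi_arg_one (hq0 : q ≠ 0) (hq1 : ‖q‖ < 1) (a b c d e : ℂ) :
    Psi q a b c d e 1 = qInf q a * qInf q b * qInf q c := by
  -- At `w = 1` the dilated terms of the contiguous relations carry the factor `1 - w = 0`. Each
  -- numerator parameter then splits off a factor `(a)_∞`, and each denominator parameter can be
  -- moved to `0`.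
  have hnum : ∀ a b c d e : ℂ, Psi q a b c d e 1 = qInf q a * Psi q 0 b c d e 1 := by
    intro a b c d e
    have hP : Differentiable ℂ fun x => Psi q x b c d e 1 := differentiable_Psi hq0 hq1
      differentiable_id (differentiable_const _) (differentiable_const _)
      (differentiable_const _) (differentiable_const _) (differentiable_const _)
    have h := eq_qInf_mul_of_functional_one hq1 (f := fun x => Psi q x b c d e 1)
      hP.continuous.continuousAt 1 (fun x => by
        have := Psi_mul_left hq0 hq1 x b c d e 1
        rw [one_mul, this]; ring) a
    rwa [one_mul] at h
  have hden : ∀ a b c d e : ℂ, Psi q a b c d e 1 = Psi q a b c 0 e 1 := by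
    intro a b c d e
    have hP : Differentiable ℂ fun x => Psi q a b c x e 1 := differentiable_Psi hq0 hq1
      (differentiable_const _) (differentiable_const _) (differentiable_const _)
      differentiable_id (differentiable_const _) (differentiable_const _)
    have h := eq_qInf_mul_of_functional_one hq1 (f := fun x => Psi q a b c x e 1)
      hP.continuous.continuousAt 0 (fun x => by
        have := Psi_eq_mul_denom hq0 hq1 a b c x e 1
        linear_combination this) d
    rwa [zero_mul, qInf_zero_right, one_mul] at h
  rw [hnum a, Psi_swap_left hq0 hq1, hnum b, Psi_swap_right hq0 hq1, Psi_swap_left hq0 hq1,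
    hnum c, hden, Psi_swap_denom hq0 hq1, hden, Psi_binomial hq0 hq1, zero_mul, qInf_zero_right]
  ring

theorem qPoch_mul_qInf (hq1 : ‖q‖ < 1) (x : ℂ) (k : ℕ) :
    qPoch q x k * qInf q (x * q ^ k) = qInf q x := by
  induction k with
  | zero => simp [qPoch]
  | succ k ih =>
    rw [← ih, qPoch_succ_natCast, qInf_eq hq1 (x * q ^ k), pow_succ']
    rw [show q * (x * q ^ k) = x * (q * q ^ k) by ring]
    ring

/-- The `q`-Gauss sum. -/
theorem Psi_gauss (hq0 : q ≠ 0) (hq1 : ‖q‖ < 1) (a : ℂ) {b c : ℂ} (hb : b ≠ 0) (hc : c ≠ 0)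
    (e : ℂ) :
    Psi q a b c a e (e / (b * c)) = qInf q a * (qInf q (e / b) * qInf q (e / c)) := by
  -- The common parameter cancels through `(a)_k (a q^k)_∞ = (a)_∞`.
  have h1 : Psi q a b c a e (e / (b * c)) = qInf q a * Psi q 0 b c 0 e (e / (b * c)) := by
    refine Psi_congr hq0 hq1 (fun k => ?_) _
    have h0 : qPoch q 0 k = 1 := by simp [qPoch_natCast]
    simp only [regCoeff, h0, zero_mul, qInf_zero_right, ← qPoch_mul_qInf hq1 a k]
    ring
  rw [h1]
  have hP : Differentiable ℂ fun x => Psi q 0 b c 0 x (x / (b * c)) := differentiable_Psi hq0 hq1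
    (differentiable_const _) (differentiable_const _) (differentiable_const _)
    (differentiable_const _) differentiable_id (by fun_prop)
  -- Parameter and argument are scaled together. At `w = x / (b c)` the coefficient of the second
  -- dilate is proportional to `w b c - x = 0`, so only a first-order equation in `x` remains.
  have h := eq_qInf_mul_of_functional hq1 (f := fun x => Psi q 0 b c 0 x (x / (b * c)))
    hP.continuous.continuousAt b⁻¹ c⁻¹ (fun x => by
      have e1 := Psi_eq_mul_denom hq0 hq1 0 b c x 0 (x / (b * c))
      have e2 := Psi_functional hq0 hq1 0 b c (q * x) 0 (x / (b * c))
      rw [Psi_swap_denom hq0 hq1 0 b c 0 x, Psi_swap_denom hq0 hq1 0 b c 0 (q * x), e1, e2,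
        show q * x / (b * c) = q * (x / (b * c)) by ring]
      field_simp
      ring) e
  simp only [zero_div, Psi_arg_zero hq0 hq1, qInf_zero_right, mul_one] at h
  rw [h]
  simp only [div_eq_inv_mul]

/-- The quotient is a continuation of the series, and continuations are unique on `phiDomain`; so
the arbitrary choice made in `phi` does not matter. -/
theorem phi_eq_Psi_div (hq0 : q ≠ 0) (hq1 : ‖q‖ < 1) (a b c : ℂ) {d e w : ℂ}
    (hd : ∀ k : ℕ, d * q ^ k ≠ 1) (he : ∀ k : ℕ, e * q ^ k ≠ 1) (hw : ∀ k : ℕ, w * q ^ k ≠ 1) :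
    phi q a b c d e w = Psi q a b c d e w / (qInf q w * (qInf q d * qInf q e)) := by
  have hd0 := qInf_ne_zero hq1 hd
  have he0 := qInf_ne_zero hq1 he
  have hcont : IsPhiContinuation q a b c d e
      fun w => Psi q a b c d e w / (qInf q w * (qInf q d * qInf q e)) := by
    refine ⟨?_, fun w hw => ?_⟩
    · intro w hw
      have hw0 := qInf_ne_zero hq1 hw
      have h1 := (differentiable_Psi_arg hq0 hq1 a b c d e) w
      have h2 := (differentiable_qInf hq1) w
      exact (h1.div (h2.mul_const _) (by simp [hw0, hd0, he0])).differentiableWithinAt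
    · have hw0 := qInf_ne_zero hq1 (mul_pow_ne_one_of_norm_lt hq1 hw)
      beta_reduce
      rw [Psi_eq_regSeries hq0 hq1 _ _ _ _ _ hw, mul_div_mul_left _ _ hw0, regSeries, phiSeries,
        ← tsum_div_const]
      refine tsum_congr fun k => ?_
      have hdk := qPoch_mul_qInf hq1 d k
      have hek := qPoch_mul_qInf hq1 e k
      rw [← hdk] at hd0
      rw [← hek] at he0
      have hd1 := left_ne_zero_of_mul hd0
      have hd2 := right_ne_zero_of_mul hd0
      have he1 := left_ne_zero_of_mul he0
      have he2 := right_ne_zero_of_mul he0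
      rw [← hdk, ← hek]
      simp only [regCoeff, phiCoeff]
      generalize qInf q (d * q ^ k) = δ at *
      generalize qInf q (e * q ^ k) = ε at *
      field_simp
  have hex : ∃ g, IsPhiContinuation q a b c d e g := ⟨_, hcont⟩
  rw [phi, dif_pos hex]
  exact hex.choose_spec.eqOn hq0 hq1 hcont hw

/-! ### Recurrences in the continuous variable `t = q^n` -/

theorem eq_zero_of_eq_zero_off_point {F : ℂ → ℂ} {p : ℂ} (hF : ContinuousAt F p)
    (h : ∀ᶠ s in 𝓝[≠] p, F s = 0) : F p = 0 :=
  tendsto_nhds_unique (hF.tendsto.mono_left nhdsWithin_le_nhds)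
    (tendsto_const_nhds.congr' (h.mono fun _ hs => hs.symm))

/-- The entire part of the solutions `X^{(2)}, …, X^{(5)}`, with `q^n` replaced by `t`. -/
def hahnU (q A B C D lp lm t : ℂ) : ℂ :=
  Psi q (A * t) (A * B * lp) (A * B * lm) (A * q / C) (A * q / D) (q / (B * t))

/-- The entire part of the solutions `X^{(1),±}`, with `q^n` replaced by `t`. -/
def hahnV (q A B C D l t : ℂ) : ℂ :=
  Psi q (B * C * l) (B * t) (C * t) (B * C * D * l * t) (A * B * C * l * t) (A * D * l)

/-- The coefficient `a_n` at `q^n = t`. -/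
def recA (q A B C D t : ℂ) : ℂ := (1 / A + 1 / B + 1 / C + 1 / D) * t - (1 + q) * t ^ 2 / q

theorem differentiableOn_hahnU (hq0 : q ≠ 0) (hq1 : ‖q‖ < 1) {B : ℂ} (hB : B ≠ 0)
    (A C D lp lm : ℂ) : DifferentiableOn ℂ (hahnU q A B C D lp lm) {0}ᶜ := by
  refine differentiableOn_Psi hq0 hq1 isOpen_compl_singleton (by fun_prop) (by fun_prop)
    (by fun_prop) (by fun_prop) (by fun_prop) ?_
  exact DifferentiableOn.div (by fun_prop) (by fun_prop) fun t ht => mul_ne_zero hB ht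

theorem differentiable_hahnV (hq0 : q ≠ 0) (hq1 : ‖q‖ < 1) (A B C D l : ℂ) :
    Differentiable ℂ (hahnV q A B C D l) :=
  differentiable_Psi hq0 hq1 (by fun_prop) (by fun_prop) (by fun_prop) (by fun_prop)
    (by fun_prop) (by fun_prop)

/-- All three values are reduced to `g0`, `g1`, `g2`, the dilates of one `Psi` with first parameter
`A s`. Raising that parameter produces the extra factor `1 - A s`, which `hahnU_recurrence` removes
by continuity. -/
theorem hahnU_recurrence_aux (hq0 : q ≠ 0) (hq1 : ‖q‖ < 1) {A B C D lp lm s : ℂ} (hA : A ≠ 0)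
    (hB : B ≠ 0) (hC : C ≠ 0) (hD : D ≠ 0) (hl : lp * lm = q / (A * B * C * D)) (hs : s ≠ 0) :
    (1 - A * s) * ((q * s / A) * (1 - A * (q * s)) * hahnU q A B C D lp lm (q * (q * s))
      + (lp + lm - recA q A B C D (q * s)) * hahnU q A B C D lp lm (q * s)
      + q / (B * C * D * s) * ((1 - B * s) * (1 - C * s) * (1 - D * s))
        * hahnU q A B C D lp lm s) = 0 := by
  set b := A * B * lp with hb
  set c := A * B * lm with hc
  set w := 1 / (B * q * s) with hw
  have e1 : q / (B * s) = q ^ 2 * w := by rw [hw]; field_simp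
  have e2 : q / (B * (q * s)) = q * w := by rw [hw]; field_simp
  have e3 : q / (B * (q * (q * s))) = w := by rw [hw]; field_simp
  simp only [hahnU]
  rw [e1, e2, e3, ← hb, ← hc]
  have h1 := Psi_mul_left hq0 hq1 (A * s) b c (A * q / C) (A * q / D) (q * w)
  have h2 := Psi_mul_left hq0 hq1 (q * (A * s)) b c (A * q / C) (A * q / D) w
  have h3 := Psi_mul_left hq0 hq1 (A * s) b c (A * q / C) (A * q / D) w
  have hf := Psi_functional hq0 hq1 (A * s) b c (A * q / C) (A * q / D) w
  -- This is where `λ₊λ₋ = q/(ABCD)` enters: the coefficient of the third dilate vanishes.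
  have hz : A * q / C / q * (A * q / D / q) - w * (A * s * b * c) = 0 := by
    rw [hw, hb, hc, show A * s * (A * B * lp) * (A * B * lm) = A ^ 3 * B ^ 2 * s * (lp * lm) by
      ring, hl]
    field_simp
    ring
  rw [hz, zero_mul, zero_mul, add_zero] at hf
  rw [show q * (q * w) = q ^ 2 * w by ring, show q * (A * s) = A * (q * s) by ring] at h1
  rw [show q * (A * s) = A * (q * s) by ring] at h3
  rw [show q * (q * (A * s)) = A * (q * (q * s)) by ring,
    show q * (A * s) = A * (q * s) by ring] at h2
  have hbc : b * c = A * B * q / (C * D) := by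
    rw [hb, hc, show A * B * lp * (A * B * lm) = A ^ 2 * B ^ 2 * (lp * lm) by ring, hl]
    field_simp
  have hlpm : lp + lm = (b + c) / (A * B) := by rw [hb, hc]; field_simp
  rw [hlpm]
  generalize Psi q (A * (q * (q * s))) b c (A * q / C) (A * q / D) w = U2 at *
  generalize Psi q (A * (q * s)) b c (A * q / C) (A * q / D) w = X at *
  generalize Psi q (A * (q * s)) b c (A * q / C) (A * q / D) (q * w) = U1 at *
  generalize Psi q (A * s) b c (A * q / C) (A * q / D) w = g0 at *
  generalize Psi q (A * s) b c (A * q / C) (A * q / D) (q * w) = g1 at *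
  generalize Psi q (A * s) b c (A * q / C) (A * q / D) (q ^ 2 * w) = g2 at *
  have key : (q * s / A) * (((1 + A * q / C / q + A * q / D / q) - w * (A * s + b + c)) * g1
      + (w * (A * s * b + A * s * c + b * c) - (A * q / C / q + A * q / D / q
        + A * q / C / q * (A * q / D / q))) * (1 - q * w) * g2)
      - (q * s / A) * (A * s * (1 - w) * g1)
      + ((b + c) / (A * B) - recA q A B C D (q * s) - (q * s / A) * (A * (q * s) * (1 - w)))
        * (g1 - A * s * (1 - q * w) * g2)
      + q / (B * C * D * s) * ((1 - B * s) * (1 - C * s) * (1 - D * s)) * (1 - A * s) * g2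
        = 0 := by
    rw [mul_add w, hbc, hw, recA]
    field_simp
    ring
  linear_combination key + (q * s / A) * (1 - A * s) * h2 + (q * s / A) * h3 + (q * s / A) * hf
    + ((b + c) / (A * B) - recA q A B C D (q * s) - (q * s / A) * (A * (q * s) * (1 - w))) * h1

theorem hahnU_recurrence (hq0 : q ≠ 0) (hq1 : ‖q‖ < 1) {A B C D lp lm s : ℂ} (hA : A ≠ 0)
    (hB : B ≠ 0) (hC : C ≠ 0) (hD : D ≠ 0) (hl : lp * lm = q / (A * B * C * D)) (hs : s ≠ 0) :
    (q * s / A) * (1 - A * (q * s)) * hahnU q A B C D lp lm (q * (q * s))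
      + (lp + lm - recA q A B C D (q * s)) * hahnU q A B C D lp lm (q * s)
      + q / (B * C * D * s) * ((1 - B * s) * (1 - C * s) * (1 - D * s))
        * hahnU q A B C D lp lm s = 0 := by
  have hU := (differentiableOn_hahnU hq0 hq1 hB A C D lp lm).continuousOn
  have hU' : ∀ x : ℂ, x ≠ 0 → ContinuousAt (hahnU q A B C D lp lm) x := fun x hx =>
    hU.continuousAt (isOpen_compl_singleton.mem_nhds hx)
  refine eq_zero_of_eq_zero_off_point (F := fun s =>
    (q * s / A) * (1 - A * (q * s)) * hahnU q A B C D lp lm (q * (q * s))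
      + (lp + lm - recA q A B C D (q * s)) * hahnU q A B C D lp lm (q * s)
      + q / (B * C * D * s) * ((1 - B * s) * (1 - C * s) * (1 - D * s))
        * hahnU q A B C D lp lm s) ?_ ?_
  · have h0 := hU' s hs
    have h1 : ContinuousAt (fun s => hahnU q A B C D lp lm (q * s)) s :=
      ContinuousAt.comp (f := fun s => q * s) (hU' _ (mul_ne_zero hq0 hs)) (by fun_prop)
    have h2 : ContinuousAt (fun s => hahnU q A B C D lp lm (q * (q * s))) s :=
      ContinuousAt.comp (f := fun s => q * (q * s))
        (hU' _ (mul_ne_zero hq0 (mul_ne_zero hq0 hs))) (by fun_prop)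
    have h3 : ContinuousAt (fun s => q / (B * C * D * s)) s :=
      ContinuousAt.div (by fun_prop) (by fun_prop) (by simp [hB, hC, hD, hs])
    simp only [recA]
    fun_prop
  · have h1 : ∀ᶠ x in 𝓝[≠] s, x ≠ 0 :=
      (continuousAt_id.eventually_ne hs).filter_mono nhdsWithin_le_nhds
    have h2 : ∀ᶠ x in 𝓝[≠] s, x ≠ 1 / A := by
      by_cases h : s = 1 / A
      · rw [← h]; exact eventually_mem_nhdsWithin
      · exact (continuousAt_id.eventually_ne h).filter_mono nhdsWithin_le_nhds
    filter_upwards [h1, h2] with x hx0 hx1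
    refine (mul_eq_zero.1 (hahnU_recurrence_aux hq0 hq1 hA hB hC hD hl hx0)).resolve_left ?_
    intro h
    exact hx1 (by field_simp; linear_combination -h)

/-- `(w)_j Ψ(a, b, c; d, e; q^j w)`, the `j`-th dilate of `Ψ`. -/
def psiDil (q w : ℂ) (j : ℕ) (a b c d e : ℂ) : ℂ :=
  (∏ i ∈ Finset.range j, (1 - w * q ^ i)) * Psi q a b c d e (q ^ j * w)

theorem psiDil_mul_left (hq0 : q ≠ 0) (hq1 : ‖q‖ < 1) (w : ℂ) (j : ℕ) (a b c d e : ℂ) :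
    (1 - b) * psiDil q w j a (q * b) c d e
      = psiDil q w j a b c d e - b * psiDil q w (j + 1) a b c d e := by
  have h := Psi_mul_left hq0 hq1 b a c d e (q ^ j * w)
  simp only [Psi_swap_left hq0 hq1 _ a] at h
  simp only [psiDil, Finset.prod_range_succ]
  rw [show q ^ (j + 1) * w = q * (q ^ j * w) by ring]
  linear_combination (∏ i ∈ Finset.range j, (1 - w * q ^ i)) * h

theorem psiDil_mul_right (hq0 : q ≠ 0) (hq1 : ‖q‖ < 1) (w : ℂ) (j : ℕ) (a b c d e : ℂ) :
    (1 - c) * psiDil q w j a b (q * c) d e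
      = psiDil q w j a b c d e - c * psiDil q w (j + 1) a b c d e := by
  have h := psiDil_mul_left hq0 hq1 w j a c b d e
  simp only [psiDil, Psi_swap_right hq0 hq1 _ _ b] at h ⊢
  exact h

theorem psiDil_eq_mul_denom (hq0 : q ≠ 0) (hq1 : ‖q‖ < 1) (w : ℂ) (j : ℕ) (a b c d e : ℂ) :
    psiDil q w j a b c d e
      = psiDil q w j a b c (q * d) e - d * psiDil q w (j + 1) a b c (q * d) e := by
  have h := Psi_eq_mul_denom hq0 hq1 a b c d e (q ^ j * w)
  simp only [psiDil, Finset.prod_range_succ]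
  rw [show q ^ (j + 1) * w = q * (q ^ j * w) by ring]
  linear_combination (∏ i ∈ Finset.range j, (1 - w * q ^ i)) * h

theorem psiDil_eq_mul_denom' (hq0 : q ≠ 0) (hq1 : ‖q‖ < 1) (w : ℂ) (j : ℕ) (a b c d e : ℂ) :
    psiDil q w j a b c d e
      = psiDil q w j a b c d (q * e) - e * psiDil q w (j + 1) a b c d (q * e) := by
  have h := psiDil_eq_mul_denom hq0 hq1 w j a b c e d
  simp only [psiDil, Psi_swap_denom hq0 hq1 _ _ _ _ d] at h ⊢
  exact h

theorem psiDil_functional (hq0 : q ≠ 0) (hq1 : ‖q‖ < 1) (w : ℂ) (j : ℕ) (a b c d e : ℂ) :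
    (1 - q ^ j * w) * psiDil q w j a b c d e
      = ((1 + d / q + e / q) - q ^ j * w * (a + b + c)) * psiDil q w (j + 1) a b c d e
      + (q ^ j * w * (a * b + a * c + b * c) - (d / q + e / q + d / q * (e / q)))
        * psiDil q w (j + 2) a b c d e
      + (d / q * (e / q) - q ^ j * w * (a * b * c)) * psiDil q w (j + 3) a b c d e := by
  have h := Psi_functional hq0 hq1 a b c d e (q ^ j * w)
  simp only [psiDil, Finset.prod_range_succ]
  rw [show q ^ (j + 1) * w = q * (q ^ j * w) by ring,
    show q ^ (j + 2) * w = q ^ 2 * (q ^ j * w) by ring,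
    show q ^ (j + 3) * w = q ^ 3 * (q ^ j * w) by ring]
  rw [h]
  ring

/-- Lowering both denominator parameters by `q²`. -/
theorem psiDil_lower (hq0 : q ≠ 0) (hq1 : ‖q‖ < 1) (w a b c d e : ℂ) :
    psiDil q w 0 a b c d e =
      psiDil q w 0 a b c (q * (q * d)) (q * (q * e))
      - (1 + q) * (d + e) * psiDil q w 1 a b c (q * (q * d)) (q * (q * e))
      + (q * d ^ 2 + q * e ^ 2 + (1 + q) ^ 2 * (d * e))
        * psiDil q w 2 a b c (q * (q * d)) (q * (q * e))
      - (1 + q) * q * (d * e) * (d + e) * psiDil q w 3 a b c (q * (q * d)) (q * (q * e))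
      + q ^ 2 * d ^ 2 * e ^ 2 * psiDil q w 4 a b c (q * (q * d)) (q * (q * e)) := by
  have hd : ∀ j, psiDil q w j a b c d e = psiDil q w j a b c (q * (q * d)) e
      - (1 + q) * d * psiDil q w (j + 1) a b c (q * (q * d)) e
      + q * d ^ 2 * psiDil q w (j + 2) a b c (q * (q * d)) e := fun j => by
    rw [psiDil_eq_mul_denom hq0 hq1 w j a b c d e, psiDil_eq_mul_denom hq0 hq1 w j a b c (q * d) e,
      psiDil_eq_mul_denom hq0 hq1 w (j + 1) a b c (q * d) e]
    ring
  have he : ∀ j x, psiDil q w j a b c x e = psiDil q w j a b c x (q * (q * e))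
      - (1 + q) * e * psiDil q w (j + 1) a b c x (q * (q * e))
      + q * e ^ 2 * psiDil q w (j + 2) a b c x (q * (q * e)) := fun j x => by
    rw [psiDil_eq_mul_denom' hq0 hq1 w j a b c x e,
      psiDil_eq_mul_denom' hq0 hq1 w j a b c x (q * e),
      psiDil_eq_mul_denom' hq0 hq1 w (j + 1) a b c x (q * e)]
    ring
  rw [hd 0, he 0, he 1, he 2]
  ring

/-- Raising two numerator and lowering two denominator parameters by `q`. -/
theorem psiDil_raise_lower (hq0 : q ≠ 0) (hq1 : ‖q‖ < 1) (w a b c d e : ℂ) :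
    (1 - b) * (1 - c) * psiDil q w 0 a (q * b) (q * c) d e =
      psiDil q w 0 a b c (q * d) (q * e)
      - (b + c + d + e) * psiDil q w 1 a b c (q * d) (q * e)
      + (b * c + d * e + (b + c) * (d + e)) * psiDil q w 2 a b c (q * d) (q * e)
      - (b * c * (d + e) + d * e * (b + c)) * psiDil q w 3 a b c (q * d) (q * e)
      + b * c * d * e * psiDil q w 4 a b c (q * d) (q * e) := by
  have hb := fun j => psiDil_mul_left hq0 hq1 w j a b (q * c) (q * d) (q * e)
  have hc := fun j => psiDil_mul_right hq0 hq1 w j a b c (q * d) (q * e)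
  have hbc : ∀ j, (1 - b) * (1 - c) * psiDil q w j a (q * b) (q * c) (q * d) (q * e)
      = psiDil q w j a b c (q * d) (q * e) - (b + c) * psiDil q w (j + 1) a b c (q * d) (q * e)
        + b * c * psiDil q w (j + 2) a b c (q * d) (q * e) := fun j => by
    linear_combination (1 - c) * hb j + hc j - b * hc (j + 1)
  have hde : psiDil q w 0 a (q * b) (q * c) d e
      = psiDil q w 0 a (q * b) (q * c) (q * d) (q * e)
        - (d + e) * psiDil q w 1 a (q * b) (q * c) (q * d) (q * e)
        + d * e * psiDil q w 2 a (q * b) (q * c) (q * d) (q * e) := by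
    rw [psiDil_eq_mul_denom hq0 hq1 w 0 _ _ _ d e, psiDil_eq_mul_denom' hq0 hq1 w 0 _ _ _ _ e,
      psiDil_eq_mul_denom' hq0 hq1 w (0 + 1) _ _ _ _ e]
    ring
  linear_combination (1 - b) * (1 - c) * hde + hbc 0 - (d + e) * hbc 1 + d * e * hbc 2

/-- Raising two numerator parameters by `q²`. -/
theorem psiDil_raise (hq0 : q ≠ 0) (hq1 : ‖q‖ < 1) (w a b c d e : ℂ) :
    (1 - b) * (1 - q * b) * ((1 - c) * (1 - q * c)) * psiDil q w 0 a (q * (q * b)) (q * (q * c)) d e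
      = psiDil q w 0 a b c d e
      - (1 + q) * (b + c) * psiDil q w 1 a b c d e
      + (q * b ^ 2 + q * c ^ 2 + (1 + q) ^ 2 * (b * c)) * psiDil q w 2 a b c d e
      - (1 + q) * q * (b * c) * (b + c) * psiDil q w 3 a b c d e
      + q ^ 2 * b ^ 2 * c ^ 2 * psiDil q w 4 a b c d e := by
  have hb : ∀ j x, (1 - b) * (1 - q * b) * psiDil q w j a (q * (q * b)) x d e
      = psiDil q w j a b x d e - (1 + q) * b * psiDil q w (j + 1) a b x d e
        + q * b ^ 2 * psiDil q w (j + 2) a b x d e := fun j x => by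
    have h1 := fun j => psiDil_mul_left hq0 hq1 w j a b x d e
    have h2 := psiDil_mul_left hq0 hq1 w j a (q * b) x d e
    linear_combination (1 - b) * h2 + h1 j - q * b * h1 (j + 1)
  have hc : ∀ j, (1 - c) * (1 - q * c) * psiDil q w j a b (q * (q * c)) d e
      = psiDil q w j a b c d e - (1 + q) * c * psiDil q w (j + 1) a b c d e
        + q * c ^ 2 * psiDil q w (j + 2) a b c d e := fun j => by
    have h1 := fun j => psiDil_mul_right hq0 hq1 w j a b c d e
    have h2 := psiDil_mul_right hq0 hq1 w j a b (q * c) d e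
    linear_combination (1 - c) * h2 + h1 j - q * c * h1 (j + 1)
  linear_combination (1 - c) * (1 - q * c) * hb 0 (q * (q * c)) + hc 0 - (1 + q) * b * hc 1
    + q * b ^ 2 * hc 2

/-- Moving from `s` to `q² s` shifts two numerator and two denominator parameters. The common
reference point therefore keeps the numerators of `s` and the denominators of `q² s`, and each value
becomes a combination of the five dilates `F0`, …, `F4`. Raising the numerators costs the factor `(1
- B s)(1 - C s)`. -/
theorem hahnV_recurrence_aux (hq0 : q ≠ 0) (hq1 : ‖q‖ < 1) {A B C D l m s : ℂ} (hA : A ≠ 0)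
    (hB : B ≠ 0) (hC : C ≠ 0) (hD : D ≠ 0) (hl : l * m = q / (A * B * C * D)) :
    (1 - B * s) * (1 - C * s) *
      (l * ((1 - A * (q * s)) * (1 - B * (q * s)) * (1 - C * (q * s)) * (1 - D * (q * s)))
          * hahnV q A B C D l (q * (q * s))
        - (l + m - recA q A B C D (q * s)) * hahnV q A B C D l (q * s)
        + m * hahnV q A B C D l s) = 0 := by
  have hl0 : l ≠ 0 := by
    rintro rfl
    rw [zero_mul, eq_comm, div_eq_zero_iff] at hl
    simp [hq0, hA, hB, hC, hD] at hl
  have hm : m = q / (A * B * C * D * l) := by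
    field_simp
    field_simp at hl
    linear_combination hl
  set a := B * C * l with ha
  set w := A * D * l with hw
  set d := B * C * D * l * s with hd
  set e := A * B * C * l * s with he
  have hV : ∀ x : ℂ, hahnV q A B C D l x
      = psiDil q w 0 a (B * x) (C * x) (B * C * D * l * x) (A * B * C * l * x) := fun x => by
    simp [hahnV, psiDil, a, w]
  have h0 := psiDil_lower hq0 hq1 w a (B * s) (C * s) d e
  have h1 := psiDil_raise_lower hq0 hq1 w a (B * s) (C * s) (q * d) (q * e)
  have h2 := psiDil_raise hq0 hq1 w a (B * s) (C * s) (q * (q * d)) (q * (q * e))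
  have f0 := psiDil_functional hq0 hq1 w 0 a (B * s) (C * s) (q * (q * d)) (q * (q * e))
  have f1 := psiDil_functional hq0 hq1 w 1 a (B * s) (C * s) (q * (q * d)) (q * (q * e))
  have f2 := psiDil_functional hq0 hq1 w 2 a (B * s) (C * s) (q * (q * d)) (q * (q * e))
  -- The argument satisfies `w · a · Bs · Cs = d e`, so the last functional equation does not bring
  -- in a sixth dilate.
  have hF5 : q * (q * d) / q * (q * (q * e) / q) - q ^ 2 * w * (a * (B * s) * (C * s)) = 0 := by
    rw [hd, he, hw, ha]
    field_simp
    ring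
  rw [hF5, zero_mul, add_zero] at f2
  simp only [zero_add, Nat.reduceAdd, pow_zero, one_mul, pow_one] at f0 f1 f2
  have y1 : ∀ x : ℂ, x * (q * s) = q * (x * s) := fun x => by ring
  have y2 : ∀ x : ℂ, x * (q * (q * s)) = q * (q * (x * s)) := fun x => by ring
  rw [hV, hV, hV]
  simp only [y1, y2]
  rw [← hd, ← he]
  generalize psiDil q w 0 a (q * (q * (B * s))) (q * (q * (C * s))) (q * (q * d)) (q * (q * e))
    = V2 at *
  generalize psiDil q w 0 a (q * (B * s)) (q * (C * s)) (q * d) (q * e) = V1 at *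
  generalize psiDil q w 0 a (B * s) (C * s) d e = V0 at *
  generalize psiDil q w 0 a (B * s) (C * s) (q * (q * d)) (q * (q * e)) = F0 at *
  generalize psiDil q w 1 a (B * s) (C * s) (q * (q * d)) (q * (q * e)) = F1 at *
  generalize psiDil q w 2 a (B * s) (C * s) (q * (q * d)) (q * (q * e)) = F2 at *
  generalize psiDil q w 3 a (B * s) (C * s) (q * (q * d)) (q * (q * e)) = F3 at *
  generalize psiDil q w 4 a (B * s) (C * s) (q * (q * d)) (q * (q * e)) = F4 at *
  -- The multipliers `μ₀`, `μ₁`, `μ₂` of the three functional equations are those for which the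
  -- coefficients of `F0`, …, `F4` all cancel: five conditions on three unknowns.
  obtain ⟨μ₀, hμ₀⟩ : ∃ μ, μ = (q * s) * (1 / A + 1 / D - (1 / B + 1 / C) / (A * D * l))
    + (q * s) ^ 2 * (-1 + 1 / (q * A * D * l)) := ⟨_, rfl⟩
  obtain ⟨μ₁, hμ₁⟩ : ∃ μ, μ = s * (B * C * l) * (q * s * (-1 + 1 / (A * B * C * D * l ^ 2))
    + (q * s) ^ 2 * (1 / (C * l) + 1 / (B * l) - (1 / A + 1 / D) / (q * l))) := ⟨_, rfl⟩
  obtain ⟨μ₂, hμ₂⟩ : ∃ μ, μ = s ^ 2 * (B * C * l) ^ 2 *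
    ((q * s) ^ 2 * (1 / (q * l) - 1 / (B * C * l ^ 2))) := ⟨_, rfl⟩
  linear_combination (norm := skip) (l * ((1 - q * (A * s)) * (1 - q * (D * s)))) * h2
    - (l + m - recA q A B C D (q * s)) * h1 + m * (1 - B * s) * (1 - C * s) * h0
    + μ₀ * f0 + μ₁ * f1 + μ₂ * f2
  rw [hm, hμ₀, hμ₁, hμ₂, recA, hw, ha, hd, he]
  field_simp
  ring

theorem hahnV_recurrence (hq0 : q ≠ 0) (hq1 : ‖q‖ < 1) {A B C D l m s : ℂ} (hA : A ≠ 0)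
    (hB : B ≠ 0) (hC : C ≠ 0) (hD : D ≠ 0) (hl : l * m = q / (A * B * C * D)) (hs : s ≠ 0) :
    l * ((1 - A * (q * s)) * (1 - B * (q * s)) * (1 - C * (q * s)) * (1 - D * (q * s)))
          * hahnV q A B C D l (q * (q * s))
        - (l + m - recA q A B C D (q * s)) * hahnV q A B C D l (q * s)
        + m * hahnV q A B C D l s = 0 := by
  have hV := (differentiable_hahnV hq0 hq1 A B C D l).continuous
  refine eq_zero_of_eq_zero_off_point (F := fun s =>
    l * ((1 - A * (q * s)) * (1 - B * (q * s)) * (1 - C * (q * s)) * (1 - D * (q * s)))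
          * hahnV q A B C D l (q * (q * s))
        - (l + m - recA q A B C D (q * s)) * hahnV q A B C D l (q * s)
        + m * hahnV q A B C D l s) ?_ ?_
  · simp only [recA]
    fun_prop
  · have h1 : ∀ y : ℂ, ∀ᶠ x in 𝓝[≠] s, x ≠ 1 / y := fun y => by
      by_cases h : s = 1 / y
      · rw [← h]; exact eventually_mem_nhdsWithin
      · exact (continuousAt_id.eventually_ne h).filter_mono nhdsWithin_le_nhds
    have h2 : ∀ᶠ x in 𝓝[≠] s, x ≠ 0 :=
      (continuousAt_id.eventually_ne hs).filter_mono nhdsWithin_le_nhds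
    filter_upwards [h1 B, h1 C, h2] with x hxB hxC hx0
    refine (mul_eq_zero.1 (hahnV_recurrence_aux hq0 hq1 hA hB hC hD hl)).resolve_left ?_
    refine mul_ne_zero (fun h => hxB ?_) (fun h => hxC ?_) <;> field_simp <;> linear_combination -h

/-! ### From functions of `t` back to the sequences -/

theorem qPoch_mul_qInf_zpow (hq0 : q ≠ 0) (hq1 : ‖q‖ < 1) {x : ℂ} {n₀ : ℤ}
    (hx : ∀ m : ℤ, n₀ ≤ m → x * q ^ m ≠ 1) (n : ℤ) (hn : n₀ ≤ n) :
    qPoch q x n * qInf q (x * q ^ n) = qInf q x := by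
  rcases n with k | m
  · exact qPoch_mul_qInf hq1 x k
  · have h := qPoch_mul_qInf hq1 (x * q ^ (Int.negSucc m)) (m + 1)
    have e1 : x * q ^ (Int.negSucc m) * q ^ (m + 1) = x := by
      rw [zpow_negSucc, mul_assoc, inv_mul_cancel₀ (pow_ne_zero _ hq0), mul_one]
    rw [e1, qPoch_natCast, ← Finset.prod_range_reflect] at h
    have e2 : ∏ j ∈ Finset.range (m + 1), (1 - x * q ^ (Int.negSucc m) * q ^ (m + 1 - 1 - j))
        = ∏ j ∈ Finset.range (m + 1), (1 - x * (q ^ (j + 1))⁻¹) := by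
      refine Finset.prod_congr rfl fun j hj => ?_
      have hj' : j ≤ m := Nat.lt_succ_iff.1 (Finset.mem_range.1 hj)
      have : q ^ (m + 1) = q ^ (m - j) * q ^ (j + 1) := by
        rw [← pow_add]; congr 1; omega
      rw [zpow_negSucc, this, Nat.add_sub_cancel]
      field_simp
    rw [e2] at h
    have e3 : ∏ j ∈ Finset.range (m + 1), (1 - x * (q ^ (j + 1))⁻¹) ≠ 0 := by
      refine Finset.prod_ne_zero_iff.2 fun j hj => sub_ne_zero.2 (Ne.symm ?_)
      have hj' : j ≤ m := Nat.lt_succ_iff.1 (Finset.mem_range.1 hj)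
      have := hx (Int.negSucc j) (hn.trans (by omega))
      rwa [zpow_negSucc] at this
    rw [← h]
    change (∏ j ∈ Finset.range (m + 1), (1 - x * (q ^ (j + 1))⁻¹))⁻¹ * _ = _
    rw [← mul_assoc, inv_mul_cancel₀ e3, one_mul]

theorem mul_zpow_mul_pow_ne_one (hq0 : q ≠ 0) {x : ℂ} {n₀ : ℤ}
    (hx : ∀ m : ℤ, n₀ ≤ m → x * q ^ m ≠ 1) {n : ℤ} (hn : n₀ ≤ n) (k : ℕ) :
    x * q ^ n * q ^ k ≠ 1 := by
  have := hx (n + k) (by omega)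
  rwa [zpow_add₀ hq0, zpow_natCast, ← mul_assoc] at this

theorem qInf_zpow_ne_zero (hq0 : q ≠ 0) (hq1 : ‖q‖ < 1) {x : ℂ} {n₀ : ℤ}
    (hx : ∀ m : ℤ, n₀ ≤ m → x * q ^ m ≠ 1) {n : ℤ} (hn : n₀ ≤ n) : qInf q (x * q ^ n) ≠ 0 :=
  qInf_ne_zero hq1 (mul_zpow_mul_pow_ne_one hq0 hx hn)

theorem qInf_ne_zero_of_zpow (hq0 : q ≠ 0) (hq1 : ‖q‖ < 1) {x : ℂ} {n₀ : ℤ} (hn₀ : n₀ ≤ 0)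
    (hx : ∀ m : ℤ, n₀ ≤ m → x * q ^ m ≠ 1) : qInf q x ≠ 0 := by
  simpa using qInf_zpow_ne_zero hq0 hq1 hx hn₀

theorem qPoch_eq_div (hq0 : q ≠ 0) (hq1 : ‖q‖ < 1) {x : ℂ} {n₀ : ℤ}
    (hx : ∀ m : ℤ, n₀ ≤ m → x * q ^ m ≠ 1) {n : ℤ} (hn : n₀ ≤ n) :
    qPoch q x n = qInf q x / qInf q (x * q ^ n) :=
  eq_div_of_mul_eq (qInf_zpow_ne_zero hq0 hq1 hx hn) (qPoch_mul_qInf_zpow hq0 hq1 hx n hn)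

/-- The `n`-dependent denominators in the prefactor cancel against the normalisation of `Psi`.
Outside the constant, only `l ^ n`, the value of `hahnV` and the four numerator products still
depend on `n`. -/
theorem X1_eq (hq0 : q ≠ 0) (hq1 : ‖q‖ < 1) {A B C D l : ℂ} {n₀ : ℤ} (hn₀ : n₀ ≤ 0)
    (hA : ∀ m : ℤ, n₀ ≤ m → A * q ^ m ≠ 1) (hB : ∀ m : ℤ, n₀ ≤ m → B * q ^ m ≠ 1)
    (hC : ∀ m : ℤ, n₀ ≤ m → C * q ^ m ≠ 1) (hD : ∀ m : ℤ, n₀ ≤ m → D * q ^ m ≠ 1)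
    (hX : X1Defined q A B C D l n₀) {n : ℤ} (hn : n₀ ≤ n) :
    X1 q A B C D l n = qInf q A * qInf q B * qInf q C * qInf q D
      / (qInf q (B * C * D * l) * qInf q (A * B * C * l) * qInf q (A * D * l))
      * (l ^ n * hahnV q A B C D l (q ^ n) / (qInf q (A * q ^ n) * qInf q (B * q ^ n)
        * qInf q (C * q ^ n) * qInf q (D * q ^ n))) := by
  obtain ⟨h1, h2, h3⟩ := hX
  rw [X1, phi_eq_Psi_div hq0 hq1 _ _ _ (mul_zpow_mul_pow_ne_one hq0 h1 hn)
    (mul_zpow_mul_pow_ne_one hq0 h2 hn) h3, qPoch_eq_div hq0 hq1 hA hn,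
    qPoch_eq_div hq0 hq1 hB hn, qPoch_eq_div hq0 hq1 hC hn, qPoch_eq_div hq0 hq1 hD hn,
    qPoch_eq_div hq0 hq1 h1 hn, qPoch_eq_div hq0 hq1 h2 hn, hahnV]
  have a1 := qInf_zpow_ne_zero hq0 hq1 hA hn
  have a2 := qInf_zpow_ne_zero hq0 hq1 hB hn
  have a3 := qInf_zpow_ne_zero hq0 hq1 hC hn
  have a4 := qInf_zpow_ne_zero hq0 hq1 hD hn
  have a5 := qInf_zpow_ne_zero hq0 hq1 h1 hn
  have a6 := qInf_zpow_ne_zero hq0 hq1 h2 hn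
  have a7 := qInf_ne_zero_of_zpow hq0 hq1 hn₀ h1
  have a8 := qInf_ne_zero_of_zpow hq0 hq1 hn₀ h2
  have a9 := qInf_ne_zero hq1 h3
  generalize qInf q (A * q ^ n) = x1 at *
  generalize qInf q (B * q ^ n) = x2 at *
  generalize qInf q (C * q ^ n) = x3 at *
  generalize qInf q (D * q ^ n) = x4 at *
  generalize qInf q (B * C * D * l * q ^ n) = x5 at *
  generalize qInf q (A * B * C * l * q ^ n) = x6 at *
  generalize qInf q (B * C * D * l) = x7 at *
  generalize qInf q (A * B * C * l) = x8 at *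
  generalize qInf q (A * D * l) = x9 at *
  generalize Psi q (B * C * l) (B * q ^ n) (C * q ^ n) (B * C * D * l * q ^ n)
    (A * B * C * l * q ^ n) (A * D * l) = P
  field_simp

theorem q_div_mul_zpow (hq0 : q ≠ 0) (B : ℂ) (n : ℤ) : q ^ (1 - n) / B = q / (B * q ^ n) := by
  rw [zpow_sub₀ hq0, zpow_one]
  field_simp

theorem X2_eq (hq0 : q ≠ 0) (hq1 : ‖q‖ < 1) {A B C D lp lm : ℂ} {n₀ : ℤ}
    (hA : ∀ m : ℤ, n₀ ≤ m → A * q ^ m ≠ 1) (hB : ∀ m : ℤ, n₀ ≤ m → B * q ^ m ≠ 1)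
    (hX : XkDefined q A C D B n₀) {n : ℤ} (hn : n₀ ≤ n) :
    X2 q A B C D lp lm n = qInf q A * qInf q B / (qInf q (A * q / C) * qInf q (A * q / D))
      * (hahnU q A B C D lp lm (q ^ n) / ((A * B) ^ n * (qInf q (A * q ^ n) * qInf q (B * q ^ n)
        * qInf q (q / (B * q ^ n))))) := by
  obtain ⟨h1, h2, h3⟩ := hX
  have h3' := h3 n hn
  rw [q_div_mul_zpow hq0] at h3'
  rw [X2, q_div_mul_zpow hq0, phi_eq_Psi_div hq0 hq1 _ _ _ h1 h2 h3', qPoch_eq_div hq0 hq1 hA hn,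
    qPoch_eq_div hq0 hq1 hB hn, hahnU]
  simp only [div_eq_mul_inv, mul_inv]
  ring

theorem coeffA_succ (hq0 : q ≠ 0) (A B C D : ℂ) (n : ℤ) :
    coeffA q A B C D n = recA q A B C D (q * q ^ (n - 1)) := by
  rw [coeffA, recA, mul_comm 2 n, zpow_sub₀ hq0, zpow_mul, zpow_sub₀ hq0]
  norm_cast
  field_simp

theorem IsSolution.const_mul {A B C D z : ℂ} {n₀ : ℤ} {X Y : ℤ → ℂ}
    (hX : IsSolution q A B C D z n₀ X) (c : ℂ) (h : ∀ n, n₀ ≤ n → Y n = c * X n) :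
    IsSolution q A B C D z n₀ Y := by
  intro n hn
  rw [h _ (by omega), h _ (by omega), h _ (by omega)]
  linear_combination c * hX n hn

theorem ne_zero_of_mul_eq_div {l m : ℂ} {A B C D : ℂ} (hq0 : q ≠ 0) (hA : A ≠ 0) (hB : B ≠ 0)
    (hC : C ≠ 0) (hD : D ≠ 0) (hl : l * m = q / (A * B * C * D)) : l ≠ 0 := by
  rintro rfl
  rw [zero_mul, eq_comm, div_eq_zero_iff] at hl
  simp [hq0, hA, hB, hC, hD] at hl

theorem isSolution_X1 (hq0 : q ≠ 0) (hq1 : ‖q‖ < 1) {A B C D l m : ℂ} {n₀ : ℤ} (hn₀ : n₀ ≤ 0)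
    (hA0 : A ≠ 0) (hB0 : B ≠ 0) (hC0 : C ≠ 0) (hD0 : D ≠ 0)
    (hA : ∀ m : ℤ, n₀ ≤ m → A * q ^ m ≠ 1) (hB : ∀ m : ℤ, n₀ ≤ m → B * q ^ m ≠ 1)
    (hC : ∀ m : ℤ, n₀ ≤ m → C * q ^ m ≠ 1) (hD : ∀ m : ℤ, n₀ ≤ m → D * q ^ m ≠ 1)
    (hl : l * m = q / (A * B * C * D)) (hX : X1Defined q A B C D l n₀) :
    IsSolution q A B C D (l + m) n₀ (X1 q A B C D l) := by
  refine IsSolution.const_mul (X := fun n => l ^ n * hahnV q A B C D l (q ^ n)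
    / (qInf q (A * q ^ n) * qInf q (B * q ^ n) * qInf q (C * q ^ n) * qInf q (D * q ^ n))) ?_ _
    fun n hn => X1_eq hq0 hq1 hn₀ hA hB hC hD hX hn
  intro n hn
  have hl0 := ne_zero_of_mul_eq_div hq0 hA0 hB0 hC0 hD0 hl
  obtain ⟨s, hs⟩ : ∃ s, s = q ^ (n - 1) := ⟨_, rfl⟩
  have hs0 : s ≠ 0 := hs ▸ zpow_ne_zero _ hq0
  have e1 : q ^ n = q * s := by rw [hs, ← zpow_one_add₀ hq0]; congr 1; ring
  have e2 : q ^ (n + 1) = q * (q * s) := by rw [← e1, ← zpow_one_add₀ hq0, add_comm]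
  obtain ⟨L, hL⟩ : ∃ L, L = l ^ (n - 1) := ⟨_, rfl⟩
  have f1 : l ^ n = l * L := by rw [hL, ← zpow_one_add₀ hl0]; congr 1; ring
  have f2 : l ^ (n + 1) = l * (l * L) := by rw [← f1, ← zpow_one_add₀ hl0, add_comm]
  have hrec := hahnV_recurrence hq0 hq1 hA0 hB0 hC0 hD0 hl hs0
  have hstep : ∀ x : ℂ, (∀ m : ℤ, n₀ ≤ m → x * q ^ m ≠ 1) →
      (1 - x * s ≠ 0 ∧ 1 - x * (q * s) ≠ 0 ∧ qInf q (x * (q * (q * s))) ≠ 0) ∧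
      qInf q (x * (q * s)) = (1 - x * (q * s)) * qInf q (x * (q * (q * s))) ∧
      qInf q (x * s) = (1 - x * s) * ((1 - x * (q * s)) * qInf q (x * (q * (q * s)))) := by
    intro x hx
    refine ⟨⟨sub_ne_zero.2 (Ne.symm ?_), sub_ne_zero.2 (Ne.symm ?_), ?_⟩, ?_, ?_⟩
    · rw [hs]; exact hx _ (by omega)
    · rw [← e1]; exact hx _ (by omega)
    · rw [← e2]; exact qInf_zpow_ne_zero hq0 hq1 hx (by omega)
    · rw [qInf_eq hq1, mul_left_comm q x]
    · rw [qInf_eq hq1, mul_left_comm q x, qInf_eq hq1 (x * (q * s)), mul_left_comm q x]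
  obtain ⟨⟨a1, a2, a3⟩, a4, a5⟩ := hstep A hA
  obtain ⟨⟨b1, b2, b3⟩, b4, b5⟩ := hstep B hB
  obtain ⟨⟨c1, c2, c3⟩, c4, c5⟩ := hstep C hC
  obtain ⟨⟨d1, d2, d3⟩, d4, d5⟩ := hstep D hD
  rw [coeffA_succ hq0, coeffBsq, ← hl, ← hs]
  simp only [e1, e2, f1, f2, ← hs, ← hL, a4, a5, b4, b5, c4, c5, d4, d5]
  generalize hahnV q A B C D l (q * (q * s)) = V2 at *
  generalize hahnV q A B C D l (q * s) = V1 at *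
  generalize hahnV q A B C D l s = V0 at *
  generalize recA q A B C D (q * s) = R at *
  generalize qInf q (A * (q * (q * s))) = x1 at *
  generalize qInf q (B * (q * (q * s))) = x2 at *
  generalize qInf q (C * (q * (q * s))) = x3 at *
  generalize qInf q (D * (q * (q * s))) = x4 at *
  generalize hα : 1 - A * (q * s) = α at *
  generalize hβ : 1 - B * (q * s) = β at *
  generalize hγ : 1 - C * (q * s) = γ at *
  generalize hδ : 1 - D * (q * s) = δ at *
  generalize 1 - A * s = α' at *
  generalize 1 - B * s = β' at *
  generalize 1 - C * s = γ' at *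
  generalize 1 - D * s = δ' at *
  have : l * (l * L) * V2 / (x1 * x2 * x3 * x4) - (l + m - R) * (l * L * V1
      / (α * x1 * (β * x2) * (γ * x3) * (δ * x4))) + l * m * α' * β' * γ' * δ' * (L * V0
      / (α' * (α * x1) * (β' * (β * x2)) * (γ' * (γ * x3)) * (δ' * (δ * x4))))
      = l * L / (α * x1 * (β * x2) * (γ * x3) * (δ * x4)) * (l * (α * β * γ * δ) * V2
        - (l + m - R) * V1 + m * V0) := by
    field_simp
  rw [this, hrec, mul_zero]

theorem isSolution_X2 (hq0 : q ≠ 0) (hq1 : ‖q‖ < 1) {A B C D l m : ℂ} {n₀ : ℤ}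
    (hA0 : A ≠ 0) (hB0 : B ≠ 0) (hC0 : C ≠ 0) (hD0 : D ≠ 0)
    (hA : ∀ m : ℤ, n₀ ≤ m → A * q ^ m ≠ 1) (hB : ∀ m : ℤ, n₀ ≤ m → B * q ^ m ≠ 1)
    (hl : l * m = q / (A * B * C * D)) (hX : XkDefined q A C D B n₀) :
    IsSolution q A B C D (l + m) n₀ (X2 q A B C D l m) := by
  refine IsSolution.const_mul (X := fun n => hahnU q A B C D l m (q ^ n) / ((A * B) ^ n *
    (qInf q (A * q ^ n) * qInf q (B * q ^ n) * qInf q (q / (B * q ^ n))))) ?_ _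
    fun n hn => X2_eq hq0 hq1 hA hB hX hn
  intro n hn
  have hAB0 : A * B ≠ 0 := mul_ne_zero hA0 hB0
  obtain ⟨s, hs⟩ : ∃ s, s = q ^ (n - 1) := ⟨_, rfl⟩
  have hs0 : s ≠ 0 := hs ▸ zpow_ne_zero _ hq0
  have e1 : q ^ n = q * s := by rw [hs, ← zpow_one_add₀ hq0]; congr 1; ring
  have e2 : q ^ (n + 1) = q * (q * s) := by rw [← e1, ← zpow_one_add₀ hq0, add_comm]
  obtain ⟨L, hL⟩ : ∃ L, L = (A * B) ^ (n - 1) := ⟨_, rfl⟩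
  have f1 : (A * B) ^ n = A * B * L := by rw [hL, ← zpow_one_add₀ hAB0]; congr 1; ring
  have f2 : (A * B) ^ (n + 1) = A * B * (A * B * L) := by
    rw [← f1, ← zpow_one_add₀ hAB0, add_comm]
  have hrec := hahnU_recurrence hq0 hq1 hA0 hB0 hC0 hD0 hl hs0
  have hstep : ∀ x : ℂ, (∀ m : ℤ, n₀ ≤ m → x * q ^ m ≠ 1) →
      (1 - x * s ≠ 0 ∧ 1 - x * (q * s) ≠ 0 ∧ qInf q (x * (q * (q * s))) ≠ 0) ∧
      qInf q (x * (q * s)) = (1 - x * (q * s)) * qInf q (x * (q * (q * s))) ∧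
      qInf q (x * s) = (1 - x * s) * ((1 - x * (q * s)) * qInf q (x * (q * (q * s)))) := by
    intro x hx
    refine ⟨⟨sub_ne_zero.2 (Ne.symm ?_), sub_ne_zero.2 (Ne.symm ?_), ?_⟩, ?_, ?_⟩
    · rw [hs]; exact hx _ (by omega)
    · rw [← e1]; exact hx _ (by omega)
    · rw [← e2]; exact qInf_zpow_ne_zero hq0 hq1 hx (by omega)
    · rw [qInf_eq hq1, mul_left_comm q x]
    · rw [qInf_eq hq1, mul_left_comm q x, qInf_eq hq1 (x * (q * s)), mul_left_comm q x]
  obtain ⟨⟨a1, a2, a3⟩, a4, a5⟩ := hstep A hA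
  obtain ⟨⟨b1, b2, b3⟩, b4, b5⟩ := hstep B hB
  have t0 : qInf q (q / (B * s)) ≠ 0 := by
    have := hX.2.2 (n - 1) (by omega)
    rw [q_div_mul_zpow hq0, ← hs] at this
    exact qInf_ne_zero hq1 this
  -- The normalisation contains the theta product `(B t)_∞ (q/(B t))_∞`; shifting its second factor
  -- supplies the powers of `s` that distinguish the recurrence of `hahnU` from (R).
  have t1 : qInf q (q / (B * (q * s))) = -((1 - B * s) / (B * s)) * qInf q (q / (B * s)) := by
    rw [qInf_eq hq1, show q * (q / (B * (q * s))) = q / (B * s) by field_simp]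
    congr 1
    field_simp
    ring
  have t2 : qInf q (q / (B * (q * (q * s))))
      = -((1 - B * (q * s)) / (B * (q * s)))
        * (-((1 - B * s) / (B * s)) * qInf q (q / (B * s))) := by
    rw [← t1, qInf_eq hq1, show q * (q / (B * (q * (q * s)))) = q / (B * (q * s)) by field_simp]
    congr 1
    field_simp
    ring
  rw [coeffA_succ hq0, coeffBsq, ← hs]
  simp only [e1, e2, f1, f2, ← hs, ← hL, a4, a5, b4, b5, t1, t2]
  generalize hahnU q A B C D l m (q * (q * s)) = U2 at *
  generalize hahnU q A B C D l m (q * s) = U1 at *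
  generalize hahnU q A B C D l m s = U0 at *
  generalize recA q A B C D (q * s) = R at *
  generalize qInf q (A * (q * (q * s))) = x1 at *
  generalize qInf q (B * (q * (q * s))) = x2 at *
  generalize qInf q (q / (B * s)) = y at *
  generalize 1 - A * (q * s) = α at *
  generalize 1 - B * (q * s) = β at *
  generalize 1 - A * s = α' at *
  generalize 1 - B * s = β' at *
  generalize 1 - C * s = γ' at *
  generalize 1 - D * s = δ' at *
  have key := congrArg (fun x => x * (B * s / (A * B * L * (α * x1) * (β * x2) * β' * y))) hrec
  simp only [zero_mul] at key
  rw [← key]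
  field_simp
  ring

/-! ### Quasi-periodic functions on a punctured disc -/

/-- Multiplication by `q` maps the circle of radius `R` to that of radius `‖q‖ R` and rotates it by
`q.arg`; periodicity absorbs the rotation. -/
theorem circleIntegral_norm_mul (q : ℂ) (R : ℝ) (g : ℂ → ℂ) :
    (∮ t in C(0, ‖q‖ * R), g t) = q * ∮ t in C(0, R), g (q * t) := by
  have hmap : ∀ θ : ℝ, circleMap 0 (‖q‖ * R) (θ + q.arg) = q * circleMap 0 R θ := by
    intro θ
    have := Complex.norm_mul_exp_arg_mul_I q
    simp only [circleMap, zero_add]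
    push_cast
    rw [add_mul, Complex.exp_add]
    linear_combination (R * Complex.exp (θ * Complex.I)) * this
  set G : ℝ → ℂ := fun θ => deriv (circleMap 0 (‖q‖ * R)) θ • g (circleMap 0 (‖q‖ * R) θ) with hG
  have hper : Function.Periodic G (2 * Real.pi) := by
    intro θ
    simp only [hG, deriv_circleMap, periodic_circleMap 0 (‖q‖ * R) θ]
  have h1 := hper.intervalIntegral_add_eq 0 (0 + q.arg)
  have h2 : ∫ θ in (0 : ℝ)..(2 * Real.pi), G (θ + q.arg)
      = ∫ θ in (0 + q.arg)..(0 + q.arg + 2 * Real.pi), G θ := by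
    rw [intervalIntegral.integral_comp_add_right]
    congr 1
    ring
  rw [zero_add (2 * Real.pi)] at h1
  rw [circleIntegral, circleIntegral, h1, ← h2, ← intervalIntegral.integral_const_mul]
  refine intervalIntegral.integral_congr fun θ _ => ?_
  simp only [hG, deriv_circleMap, hmap, smul_eq_mul]
  ring

/-- A continuous function on a circle all of whose Fourier coefficients vanish is zero. -/
theorem eq_zero_of_circleIntegral_zpow_eq_zero {R : ℝ} (hR : 0 < R) {g : ℂ → ℂ}
    (hg : ContinuousOn g (Metric.sphere 0 R))
    (h : ∀ m : ℤ, (∮ t in C(0, R), g t * t ^ m) = 0) {t : ℂ} (ht : ‖t‖ = R) : g t = 0 := by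
  have : Fact (0 < 2 * Real.pi) := ⟨Real.two_pi_pos⟩
  have hmem : ∀ x : AddCircle (2 * Real.pi), (R : ℂ) * (AddCircle.toCircle x : ℂ)
      ∈ Metric.sphere (0 : ℂ) R := fun x => by
    rw [mem_sphere_zero_iff_norm, norm_mul, Circle.norm_coe, Complex.norm_real,
      Real.norm_of_nonneg hR.le, mul_one]
  let F : C(AddCircle (2 * Real.pi), ℂ) :=
    ⟨fun x => g ((R : ℂ) * (AddCircle.toCircle x : ℂ)), by
      refine hg.comp_continuous ?_ hmem
      exact continuous_const.mul (continuous_subtype_val.comp AddCircle.continuous_toCircle)⟩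
  have hcirc : ∀ θ : ℝ, (R : ℂ) * (AddCircle.toCircle (θ : AddCircle (2 * Real.pi)) : ℂ)
      = circleMap 0 R θ := by
    intro θ
    rw [AddCircle.toCircle_apply_mk]
    simp [circleMap]
  have hR0 : (R : ℂ) ≠ 0 := by exact_mod_cast hR.ne'
  -- The `n`-th Fourier coefficient is the contour integral with exponent `-n - 1`, up to a nonzero
  -- factor. The Fourier series is then trivially summable, hence represents `F`.
  have hcoef : ∀ n : ℤ, fourierCoeff F n = 0 := by
    intro n
    rw [fourierCoeff_eq_intervalIntegral F n 0, zero_add]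
    have h1 := h (-n - 1)
    rw [circleIntegral] at h1
    have h2 : ∀ θ : ℝ, deriv (circleMap 0 R) θ • (g (circleMap 0 R θ)
        * circleMap 0 R θ ^ (-n - 1))
        = (Complex.I * (R : ℂ) ^ (-n)) * (fourier (-n) (θ : AddCircle (2 * Real.pi)) • F θ) := by
      intro θ
      have hc : circleMap 0 R θ ≠ 0 := circleMap_ne_center hR.ne'
      have hF : F (θ : AddCircle (2 * Real.pi)) = g (circleMap 0 R θ) := by
        rw [← hcirc]; rfl
      have hf : (R : ℂ) ^ (-n) * fourier (-n) (θ : AddCircle (2 * Real.pi))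
          = circleMap 0 R θ ^ (-n) := by
        rw [← hcirc, mul_zpow, fourier_apply, AddCircle.toCircle_zsmul]
        simp
      rw [hF, deriv_circleMap, smul_eq_mul, smul_eq_mul, zpow_sub₀ hc, zpow_one, ← hf]
      field_simp
    simp only [h2] at h1
    rw [intervalIntegral.integral_const_mul] at h1
    have h3 := (mul_eq_zero.1 h1).resolve_left
      (mul_ne_zero Complex.I_ne_zero (zpow_ne_zero _ hR0))
    rw [h3, smul_zero]
  have hsum : Summable (fourierCoeff F) := by
    rw [funext hcoef]; exact summable_zero
  have hx : ((R : ℂ) * (AddCircle.toCircle ((t.arg : ℝ) : AddCircle (2 * Real.pi)) : ℂ)) = t := by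
    rw [hcirc, circleMap, zero_add, ← ht, Complex.norm_mul_exp_arg_mul_I]
  have h4 := has_pointwise_sum_fourier_series_of_summable hsum
    ((t.arg : ℝ) : AddCircle (2 * Real.pi))
  simp only [hcoef, zero_smul] at h4
  have h5 := h4.unique hasSum_zero
  rw [← hx]
  exact h5

theorem isOpen_punctured (ρ : ℝ) : IsOpen {t : ℂ | t ≠ 0 ∧ ‖t‖ < ρ} :=
  isOpen_ne.inter (isOpen_lt continuous_norm continuous_const)

/-- A quasi-periodic holomorphic function on a punctured disc vanishes as soon as its constant
Laurent coefficient does. -/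
theorem eq_zero_of_quasiperiodic_of_integral (hq0 : q ≠ 0) (hq1 : ‖q‖ < 1) {f : ℂ → ℂ} {ρ : ℝ}
    {s : ℂ} (hs : s ≠ 0) (hf : DifferentiableOn ℂ f {t | t ≠ 0 ∧ ‖t‖ < ρ})
    (hfun : ∀ t, t ≠ 0 → ‖t‖ < ρ → f (q * t) * t = -s * f t) {R₀ : ℝ} (hR₀ : 0 < R₀)
    (hR₀ρ : R₀ < ρ) (h0 : (∮ t in C(0, R₀), f t * t ^ (-1 : ℤ)) = 0) {t : ℂ} (ht0 : t ≠ 0)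
    (ht : ‖t‖ < ρ) : f t = 0 := by
  have hfd : ∀ x : ℂ, x ≠ 0 → ‖x‖ < ρ → DifferentiableAt ℂ f x := fun x h1 h2 =>
    hf.differentiableAt ((isOpen_punctured ρ).mem_nhds ⟨h1, h2⟩)
  have hrad : ∀ (m : ℤ) {r R : ℝ}, 0 < r → r ≤ R → R < ρ →
      (∮ t in C(0, R), f t * t ^ m) = ∮ t in C(0, r), f t * t ^ m := by
    intro m r R hr hrR hRρ
    have hd : ∀ x : ℂ, x ≠ 0 → ‖x‖ < ρ → DifferentiableAt ℂ (fun t => f t * t ^ m) x :=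
      fun x h1 h2 => (hfd x h1 h2).mul (differentiableAt_zpow.2 (Or.inl h1))
    refine Complex.circleIntegral_eq_of_differentiable_on_annulus_off_countable hr hrR
      Set.countable_empty ?_ ?_
    · intro x hx
      simp only [Set.mem_sdiff, mem_closedBall_zero_iff, mem_ball_zero_iff, not_lt] at hx
      exact (hd x (norm_pos_iff.1 (hr.trans_le hx.2))
        (hx.1.trans_lt hRρ)).continuousAt.continuousWithinAt
    · intro x hx
      simp only [Set.mem_sdiff, mem_closedBall_zero_iff, mem_ball_zero_iff, not_le,
        Set.mem_empty_iff_false, not_false_eq_true, and_true] at hx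
      exact hd x (norm_pos_iff.1 (hr.trans hx.2)) (hx.1.trans hRρ)
  have hrad' : ∀ (m : ℤ) {R : ℝ}, 0 < R → R < ρ →
      (∮ t in C(0, R), f t * t ^ m) = ∮ t in C(0, R₀), f t * t ^ m := by
    intro m R hR hRρ
    rcases le_total R R₀ with h | h
    · exact (hrad m hR h hR₀ρ).symm
    · exact hrad m hR₀ h hRρ
  have hqn : 0 < ‖q‖ := norm_pos_iff.2 hq0
  -- The integral does not depend on the radius, so it can be moved to `‖q‖ R₀` and pulled back by
  -- `t ↦ q t`. Neighbouring Laurent coefficients differ by a nonzero factor, so one vanishing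
  -- coefficient kills them all.
  have hstep : ∀ m : ℤ, (∮ t in C(0, R₀), f t * t ^ m)
      = -s * q ^ (m + 1) * ∮ t in C(0, R₀), f t * t ^ (m - 1) := by
    intro m
    have h1 := hrad' m (mul_pos hqn hR₀) ((mul_le_of_le_one_left hR₀.le hq1.le).trans_lt hR₀ρ)
    rw [← h1, circleIntegral_norm_mul, ← circleIntegral.integral_const_mul,
      ← circleIntegral.integral_const_mul]
    refine circleIntegral.integral_congr hR₀.le fun x hx => ?_
    have hxn : ‖x‖ = R₀ := by simpa using hx
    have hx0 : x ≠ 0 := norm_pos_iff.1 (hxn ▸ hR₀)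
    have h2 := hfun x hx0 (hxn ▸ hR₀ρ)
    simp only [mul_zpow, zpow_add_one₀ hq0, zpow_sub_one₀ hx0]
    field_simp
    linear_combination h2
  have hall : ∀ m : ℤ, (∮ t in C(0, R₀), f t * t ^ m) = 0 := by
    intro m
    induction m using Int.inductionOn' (b := -1) with
    | zero => exact h0
    | succ k _ ih => rw [hstep, add_sub_cancel_right, ih, mul_zero]
    | pred k _ ih =>
      rw [hstep] at ih
      exact (mul_eq_zero.1 ih).resolve_left (mul_ne_zero (neg_ne_zero.2 hs) (zpow_ne_zero _ hq0))
  have htp : 0 < ‖t‖ := norm_pos_iff.2 ht0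
  refine eq_zero_of_circleIntegral_zpow_eq_zero htp (fun x hx => ?_)
    (fun m => (hrad' m htp ht).trans (hall m)) rfl
  have hxn : ‖x‖ = ‖t‖ := by simpa using hx
  exact (hfd x (norm_pos_iff.1 (hxn ▸ htp)) (hxn ▸ ht)).continuousAt.continuousWithinAt

/-- The theta function with zeros at `s q^k`. -/
def qTheta (q s t : ℂ) : ℂ := qInf q (t / s) * qInf q (q * s / t)

theorem qTheta_mul (hq0 : q ≠ 0) (hq1 : ‖q‖ < 1) {s t : ℂ} (hs : s ≠ 0) (ht : t ≠ 0) :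
    qTheta q s (q * t) * t = -s * qTheta q s t := by
  have e1 : q * s / (q * t) = s / t := by field_simp
  rw [qTheta, qTheta, e1, qInf_eq hq1 (s / t), qInf_eq hq1 (t / s), mul_div_assoc, mul_div_assoc]
  field_simp
  ring

theorem differentiableOn_qTheta (hq1 : ‖q‖ < 1) (s : ℂ) :
    DifferentiableOn ℂ (qTheta q s) {0}ᶜ := by
  have h1 : DifferentiableOn ℂ (fun t => q * s / t) {0}ᶜ :=
    DifferentiableOn.div (by fun_prop) (by fun_prop) fun t ht => ht
  exact ((differentiable_qInf hq1).comp_differentiableOn (by fun_prop)).mul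
    ((differentiable_qInf hq1).comp_differentiableOn h1)

theorem qTheta_ne_zero (hq0 : q ≠ 0) (hq1 : ‖q‖ < 1) {s t : ℂ} (hs : s ≠ 0) (ht : t ≠ 0)
    (h : ∀ k : ℤ, t ≠ s * q ^ k) : qTheta q s t ≠ 0 := by
  refine mul_ne_zero (qInf_ne_zero hq1 fun k hk => h (-k) ?_)
    (qInf_ne_zero hq1 fun k hk => h (k + 1) ?_)
  · have hk0 := pow_ne_zero k hq0
    rw [zpow_neg, zpow_natCast]
    field_simp at hk ⊢
    exact hk
  · rw [zpow_add_one₀ hq0, zpow_natCast]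
    field_simp at hk
    linear_combination -hk

/-- A holomorphic function on a punctured disc with the quasi-periodicity of a theta function, and
with a zero which is not a zero of that theta function, vanishes. -/
theorem eq_zero_of_quasiperiodic (hq0 : q ≠ 0) (hq1 : ‖q‖ < 1) {f : ℂ → ℂ} {ρ : ℝ}
    {s t₀ : ℂ} (hs : s ≠ 0) (hf : DifferentiableOn ℂ f {t | t ≠ 0 ∧ ‖t‖ < ρ})
    (hfun : ∀ t, t ≠ 0 → ‖t‖ < ρ → f (q * t) * t = -s * f t) (ht₀ : t₀ ≠ 0) (ht₀ρ : ‖t₀‖ < ρ)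
    (h0 : f t₀ = 0) (hne : ∀ k : ℤ, t₀ ≠ s * q ^ k) {t : ℂ} (ht0 : t ≠ 0) (ht : ‖t‖ < ρ) :
    f t = 0 := by
  have hR : 0 < ‖t₀‖ := norm_pos_iff.2 ht₀
  have hθ : DifferentiableOn ℂ (qTheta q s) {t | t ≠ 0 ∧ ‖t‖ < ρ} :=
    (differentiableOn_qTheta hq1 s).mono fun x hx => hx.1
  have hint : ∀ g : ℂ → ℂ, DifferentiableOn ℂ g {t | t ≠ 0 ∧ ‖t‖ < ρ} →
      CircleIntegrable (fun t => g t * t ^ (-1 : ℤ)) 0 ‖t₀‖ := by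
    intro g hg
    refine ContinuousOn.circleIntegrable hR.le fun x hx => ?_
    have hxn : ‖x‖ = ‖t₀‖ := by simpa using hx
    have hx0 : x ≠ 0 := norm_pos_iff.1 (hxn ▸ hR)
    exact ((hg.differentiableAt ((isOpen_punctured ρ).mem_nhds ⟨hx0, hxn ▸ ht₀ρ⟩)).mul
      (differentiableAt_zpow.2 (Or.inl hx0))).continuousAt.continuousWithinAt
  set cf := ∮ t in C(0, ‖t₀‖), f t * t ^ (-1 : ℤ) with hcf
  set cθ := ∮ t in C(0, ‖t₀‖), qTheta q s t * t ^ (-1 : ℤ) with hcθ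
  -- The combination is chosen to have zero constant Laurent coefficient, hence it vanishes. At `t₀`
  -- this forces `cf = 0`, since the theta function is nonzero there.
  have h1 : cθ * f t₀ - cf * qTheta q s t₀ = 0 := by
    refine eq_zero_of_quasiperiodic_of_integral hq0 hq1
      (f := fun t => cθ * f t - cf * qTheta q s t) hs
      ((hf.const_mul cθ).sub (hθ.const_mul cf)) (fun t h1 h2 => ?_) hR ht₀ρ ?_ ht₀ ht₀ρ
    · linear_combination cθ * hfun t h1 h2 - cf * qTheta_mul hq0 hq1 hs h1
    · have : ∀ t : ℂ, (cθ * f t - cf * qTheta q s t) * t ^ (-1 : ℤ)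
          = cθ * f t * t ^ (-1 : ℤ) - cf * qTheta q s t * t ^ (-1 : ℤ) := fun t => by ring
      simp only [this]
      rw [circleIntegral.integral_sub (hint _ (hf.const_mul cθ)) (hint _ (hθ.const_mul cf))]
      simp only [mul_assoc]
      rw [circleIntegral.integral_const_mul, circleIntegral.integral_const_mul, ← hcf, ← hcθ]
      ring
  rw [h0, mul_zero, zero_sub, neg_eq_zero] at h1
  have h2 : cf = 0 := (mul_eq_zero.1 h1).resolve_right (qTheta_ne_zero hq0 hq1 hs ht₀ hne)
  exact eq_zero_of_quasiperiodic_of_integral hq0 hq1 hs hf hfun hR ht₀ρ h2 ht0 ht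

/-! ### Wronskians as functions of `t` -/

/-- The recurrence satisfied by `hahnU q P Q R S`. -/
def USol (q z P Q R S : ℂ) (U : ℂ → ℂ) : Prop :=
  ∀ s : ℂ, s ≠ 0 → (q * s / P) * (1 - P * (q * s)) * U (q * (q * s))
    + (z - recA q P Q R S (q * s)) * U (q * s)
    + q / (Q * R * S * s) * ((1 - Q * s) * (1 - R * s) * (1 - S * s)) * U s = 0

/-- The recurrence satisfied by `hahnV q A B C D l`, where `l * m = q / (A * B * C * D)`. -/
def VSol (q l m A B C D : ℂ) (V : ℂ → ℂ) : Prop :=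
  ∀ s : ℂ, s ≠ 0 →
    l * ((1 - A * (q * s)) * (1 - B * (q * s)) * (1 - C * (q * s)) * (1 - D * (q * s)))
        * V (q * (q * s)) - (l + m - recA q A B C D (q * s)) * V (q * s) + m * V s = 0

theorem USol.perm {z P Q R S Q' R' S' : ℂ} {U : ℂ → ℂ} (h : USol q z P Q R S U)
    (ha : ∀ t, recA q P Q' R' S' t = recA q P Q R S t)
    (hp : ∀ s : ℂ, (1 - Q' * s) * (1 - R' * s) * (1 - S' * s)
      = (1 - Q * s) * (1 - R * s) * (1 - S * s)) (hm : Q' * R' * S' = Q * R * S) :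
    USol q z P Q' R' S' U := by
  intro s hs
  rw [ha, hp, hm]
  exact h s hs

theorem VSol.perm {l m A B C D A' B' C' D' : ℂ} {V : ℂ → ℂ} (h : VSol q l m A B C D V)
    (ha : ∀ t, recA q A' B' C' D' t = recA q A B C D t)
    (hp : ∀ s : ℂ, (1 - A' * s) * (1 - B' * s) * (1 - C' * s) * (1 - D' * s)
      = (1 - A * s) * (1 - B * s) * (1 - C * s) * (1 - D * s)) :
    VSol q l m A' B' C' D' V := by
  intro s hs
  rw [ha, hp]
  exact h s hs

/-- If the Wronskian of `U` and `V` vanishes at `1`, it vanishes identically. -/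
theorem wronskian_UV_eq_zero (hq0 : q ≠ 0) (hq1 : ‖q‖ < 1) {l m P Q R S : ℂ} (hP : P ≠ 0)
    (hl : l * m = q / (P * Q * R * S)) (hm : m ≠ 0) {U V : ℂ → ℂ}
    (hU : DifferentiableOn ℂ U {0}ᶜ) (hV : Differentiable ℂ V)
    (hUs : USol q (l + m) P Q R S U) (hVs : VSol q l m P Q R S V)
    (hPn : NotPow q P) (hPm : NotPow q (P * m))
    (h1 : l * ((1 - Q * 1) * (1 - R * 1) * (1 - S * 1)) * (U 1 * V (q * 1))
      + 1 / P * (U (q * 1) * V 1) = 0) {t : ℂ} (ht : t ≠ 0) :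
    l * ((1 - Q * t) * (1 - R * t) * (1 - S * t)) * (U t * V (q * t))
      + t / P * (U (q * t) * V t) = 0 := by
  obtain ⟨ω, hω⟩ : ∃ ω : ℂ → ℂ, ω = fun t =>
    l * ((1 - Q * t) * (1 - R * t) * (1 - S * t)) * (U t * V (q * t))
      + t / P * (U (q * t) * V t) := ⟨_, rfl⟩
  -- Eliminating the middle terms of the two recurrences gives this first-order equation. It carries
  -- the zero from `1` to all `q ^ n`, because `P` is not a power of `q`.
  have hrel : ∀ s : ℂ, s ≠ 0 → m * P * ω s = -(s * (1 - P * (q * s)) * ω (q * s)) := by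
    intro s hs
    have e1 := hUs s hs
    have e2 := hVs s hs
    have e3 : q / (Q * R * S * s) = P * (l * m) / s := by
      rw [hl]; field_simp
    rw [e3] at e1
    simp only [hω]
    have e4 : s * (P * (l * m) / s) = P * (l * m) := by field_simp
    have e5 : P * (s / P) = s := by field_simp
    linear_combination (s * V (q * s)) * e1 + (s * U (q * s)) * e2
      - ((1 - Q * s) * (1 - R * s) * (1 - S * s)) * U s * V (q * s) * e4
      + m * U (q * s) * V s * e5
  have hωd : DifferentiableOn ℂ ω {0}ᶜ := by
    have h2 : DifferentiableOn ℂ (fun t => U (q * t)) {0}ᶜ :=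
      hU.comp (by fun_prop) fun x hx => mul_ne_zero hq0 hx
    have h3 : DifferentiableOn ℂ (fun t => V (q * t)) {0}ᶜ :=
      (hV.comp (by fun_prop)).differentiableOn
    have h4 : DifferentiableOn ℂ
        (fun t => l * ((1 - Q * t) * (1 - R * t) * (1 - S * t))) {0}ᶜ := by fun_prop
    have h5 : DifferentiableOn ℂ (fun t => t / P) {0}ᶜ := by fun_prop
    rw [hω]
    exact (h4.mul (hU.mul h3)).add (h5.mul (h2.mul hV.differentiableOn))
  have hω1 : ∀ n : ℕ, ω (q ^ n) = 0 := by
    intro n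
    induction n with
    | zero => simpa [hω] using h1
    | succ n ih =>
      have := hrel (q ^ n) (pow_ne_zero _ hq0)
      rw [ih, mul_zero, eq_comm, neg_eq_zero, ← pow_succ'] at this
      refine (mul_eq_zero.1 this).resolve_left (mul_ne_zero (pow_ne_zero _ hq0) ?_)
      refine sub_ne_zero.2 fun h => hPn (-(n + 1 : ℕ)) ?_
      rw [zpow_neg, zpow_natCast]
      exact eq_inv_of_mul_eq_one_left h.symm
  -- For `‖t‖ < ρ` the product `(P q t)_∞` has no zero. Dividing `ω` by it removes the factor `1 - P
  -- q t` and leaves the quasi-periodicity `f (q t) t = -(P m) f t`. The theta zeros `P m q^k` avoid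
  -- the powers of `q`.
  obtain ⟨ρ, hρ⟩ : ∃ ρ : ℝ, ρ = ‖P * q‖⁻¹ := ⟨_, rfl⟩
  have hPq : 0 < ‖P * q‖ := norm_pos_iff.2 (mul_ne_zero hP hq0)
  have hρ0 : 0 < ρ := hρ ▸ inv_pos.2 hPq
  have hne : ∀ x : ℂ, ‖x‖ < ρ → qInf q (P * q * x) ≠ 0 := by
    intro x hx
    refine qInf_ne_zero hq1 (mul_pow_ne_one_of_norm_lt hq1 ?_)
    rw [norm_mul]
    calc ‖P * q‖ * ‖x‖ < ‖P * q‖ * ρ := by gcongr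
      _ = 1 := by rw [hρ, mul_inv_cancel₀ hPq.ne']
  have hsmall : ∀ x : ℂ, ∃ N : ℕ, ‖q ^ N * x‖ < ρ := by
    intro x
    have := (tendsto_pow_mul_nhds_zero hq1 x).norm
    rw [norm_zero] at this
    exact (this.eventually (gt_mem_nhds hρ0)).exists
  have hdisc : ∀ x : ℂ, x ≠ 0 → ‖x‖ < ρ → ω x = 0 := by
    intro x hx0 hx
    obtain ⟨N, hN⟩ := hsmall 1
    have hfd : DifferentiableOn ℂ (fun t => ω t / qInf q (P * q * t)) {t | t ≠ 0 ∧ ‖t‖ < ρ} := by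
      refine (hωd.mono fun x hx => hx.1).div ?_ fun x hx => hne x hx.2
      exact (differentiable_qInf hq1).comp_differentiableOn (by fun_prop)
    have := eq_zero_of_quasiperiodic hq0 hq1 (f := fun t => ω t / qInf q (P * q * t))
      (ρ := ρ) (s := P * m) (t₀ := q ^ N) (mul_ne_zero hP hm) hfd (fun t ht0 ht => ?_)
      (pow_ne_zero _ hq0) (by simpa using hN) (by simp [hω1]) (fun k hk => ?_) hx0 hx
    · exact (div_eq_zero_iff.1 this).resolve_right (hne x hx)
    · have e1 := hrel t ht0
      have e2 := hne t ht
      rw [qInf_eq hq1] at e2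
      have e3 : P * q * (q * t) = q * (P * q * t) := by ring
      rw [e3, qInf_eq hq1 (P * q * t)]
      have e4 := left_ne_zero_of_mul e2
      have e5 := right_ne_zero_of_mul e2
      rw [div_mul_eq_mul_div, mul_div_assoc', div_eq_div_iff e5 (mul_ne_zero e4 e5)]
      linear_combination (qInf q (q * (P * q * t))) * e1
    · refine hPm (N - k) ?_
      rw [zpow_sub₀ hq0, zpow_natCast, hk]
      exact (mul_div_cancel_right₀ _ (zpow_ne_zero _ hq0)).symm
  -- Since `m P ≠ 0`, vanishing spreads outwards from the disc to every nonzero point.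
  have hdown : ∀ n : ℕ, ∀ x : ℂ, x ≠ 0 → ω (q ^ n * x) = 0 → ω x = 0 := by
    intro n
    induction n with
    | zero => intro x _ h; simpa using h
    | succ n ih =>
      intro x hx h
      refine ih x hx ?_
      have h2 := hrel (q ^ n * x) (mul_ne_zero (pow_ne_zero _ hq0) hx)
      rw [show q * (q ^ n * x) = q ^ (n + 1) * x by ring, h, mul_zero, neg_zero] at h2
      exact (mul_eq_zero.1 h2).resolve_left (mul_ne_zero hm hP)
  obtain ⟨N, hN⟩ := hsmall t
  have := hdown N t ht (hdisc _ (mul_ne_zero (pow_ne_zero _ hq0) ht) hN)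
  simpa only [hω] using this

/-- If the Wronskian of two solutions of type `U` vanishes at `1`, it vanishes identically. -/
theorem wronskian_UU_eq_zero (hq0 : q ≠ 0) (hq1 : ‖q‖ < 1) {z P P' R S : ℂ} (hP : P ≠ 0)
    (hP' : P' ≠ 0) (hR : R ≠ 0) (hS : S ≠ 0) {U U' : ℂ → ℂ}
    (hU : DifferentiableOn ℂ U {0}ᶜ) (hU' : DifferentiableOn ℂ U' {0}ᶜ)
    (hUs : USol q z P P' R S U) (hUs' : USol q z P' P R S U')
    (hRn : NotPow q R) (hSn : NotPow q S)
    (h1 : (1 - P * 1) / P * (U (q * 1) * U' 1) - (1 - P' * 1) / P' * (U 1 * U' (q * 1)) = 0)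
    {t : ℂ} (ht : t ≠ 0) :
    (1 - P * t) / P * (U (q * t) * U' t) - (1 - P' * t) / P' * (U t * U' (q * t)) = 0 := by
  obtain ⟨ω, hω⟩ : ∃ ω : ℂ → ℂ, ω = fun t =>
    (1 - P * t) / P * (U (q * t) * U' t) - (1 - P' * t) / P' * (U t * U' (q * t)) := ⟨_, rfl⟩
  -- Here the zeros are propagated to the points `q^{-n}`, which accumulate at infinity. The
  -- quasi-periodic argument is therefore run in the variable `1/t`.
  have hrel : ∀ s : ℂ, s ≠ 0 → R * S * s ^ 2 * ω (q * s) = (1 - R * s) * (1 - S * s) * ω s := by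
    intro s hs
    have e1 := hUs s hs
    have e2 := hUs' s hs
    have ha : recA q P' P R S (q * s) = recA q P P' R S (q * s) := by rw [recA, recA]; ring
    rw [ha] at e2
    simp only [hω]
    have f1 : (R * S * s / q) * (q / (P' * R * S * s)) = 1 / P' := by field_simp
    have f2 : (R * S * s / q) * (q / (P * R * S * s)) = 1 / P := by field_simp
    have f3 : (R * S * s / q) * (q * s / P) = R * S * s ^ 2 / P := by field_simp
    have f4 : (R * S * s / q) * (q * s / P') = R * S * s ^ 2 / P' := by field_simp
    linear_combination (R * S * s / q * U' (q * s)) * e1 - (R * S * s / q * U (q * s)) * e2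
      - (1 - P' * s) * (1 - R * s) * (1 - S * s) * U s * U' (q * s) * f1
      + (1 - P * s) * (1 - R * s) * (1 - S * s) * U' s * U (q * s) * f2
      - (1 - P * (q * s)) * U (q * (q * s)) * U' (q * s) * f3
      + (1 - P' * (q * s)) * U' (q * (q * s)) * U (q * s) * f4
  have hωd : DifferentiableOn ℂ ω {0}ᶜ := by
    have h2 : DifferentiableOn ℂ (fun t => U (q * t)) {0}ᶜ :=
      hU.comp (by fun_prop) fun x hx => mul_ne_zero hq0 hx
    have h3 : DifferentiableOn ℂ (fun t => U' (q * t)) {0}ᶜ :=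
      hU'.comp (by fun_prop) fun x hx => mul_ne_zero hq0 hx
    have h4 : DifferentiableOn ℂ (fun t => (1 - P * t) / P) {0}ᶜ := by fun_prop
    have h5 : DifferentiableOn ℂ (fun t => (1 - P' * t) / P') {0}ᶜ := by fun_prop
    rw [hω]
    exact (h4.mul (h2.mul hU')).sub (h5.mul (hU.mul h3))
  have hnp : ∀ x : ℂ, NotPow q x → ∀ n : ℕ, 1 - x * (q ^ n)⁻¹ ≠ 0 := by
    intro x hx n
    refine sub_ne_zero.2 fun h => hx n ?_
    rw [zpow_natCast]
    have := pow_ne_zero n hq0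
    field_simp at h
    exact h.symm
  have hω1 : ∀ n : ℕ, ω (q ^ n)⁻¹ = 0 := by
    intro n
    induction n with
    | zero => simpa [hω] using h1
    | succ n ih =>
      have h2 := hrel (q ^ (n + 1))⁻¹ (inv_ne_zero (pow_ne_zero _ hq0))
      have h3 : q * (q ^ (n + 1))⁻¹ = (q ^ n)⁻¹ := by
        rw [pow_succ']; field_simp
      rw [h3, ih, mul_zero, eq_comm] at h2
      exact (mul_eq_zero.1 h2).resolve_left (mul_ne_zero (hnp R hRn _) (hnp S hSn _))
  obtain ⟨ρ, hρ⟩ : ∃ ρ : ℝ, ρ = ‖q / R‖⁻¹ := ⟨_, rfl⟩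
  have hqR : 0 < ‖q / R‖ := norm_pos_iff.2 (div_ne_zero hq0 hR)
  have hρ0 : 0 < ρ := hρ ▸ inv_pos.2 hqR
  have hne : ∀ x : ℂ, ‖x‖ < ρ → qInf q (q / R * x) ≠ 0 := by
    intro x hx
    refine qInf_ne_zero hq1 (mul_pow_ne_one_of_norm_lt hq1 ?_)
    rw [norm_mul]
    calc ‖q / R‖ * ‖x‖ < ‖q / R‖ * ρ := by gcongr
      _ = 1 := by rw [hρ, mul_inv_cancel₀ hqR.ne']
  have hsmall : ∀ x : ℂ, ∃ N : ℕ, ‖q ^ N * x‖ < ρ := by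
    intro x
    have := (tendsto_pow_mul_nhds_zero hq1 x).norm
    rw [norm_zero] at this
    exact (this.eventually (gt_mem_nhds hρ0)).exists
  have hdisc : ∀ x : ℂ, x ≠ 0 → ‖x‖ < ρ → ω x⁻¹ = 0 := by
    have hinv : DifferentiableOn ℂ (fun t : ℂ => t⁻¹) {t : ℂ | t ≠ 0 ∧ ‖t‖ < ρ} := fun x hx =>
      (differentiableAt_inv hx.1).differentiableWithinAt
    -- The products absorb `1 - S/(q t)` and `1 - R/(q t)`. One is put in the numerator and one in
    -- the denominator so that a single power of `t` is left, with theta zeros at `(S/q) q^k`.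
    have hfd : DifferentiableOn ℂ (fun t => qInf q (S * t⁻¹) * ω t⁻¹ / qInf q (q / R * t))
        {t | t ≠ 0 ∧ ‖t‖ < ρ} := by
      refine DifferentiableOn.div (DifferentiableOn.mul ?_ ?_) ?_ fun x hx => hne x hx.2
      · exact (differentiable_qInf hq1).comp_differentiableOn (by fun_prop)
      · exact hωd.comp hinv fun x hx => inv_ne_zero hx.1
      · exact (differentiable_qInf hq1).comp_differentiableOn (by fun_prop)
    have hfun : ∀ t, t ≠ 0 → ‖t‖ < ρ →
        qInf q (S * (q * t)⁻¹) * ω (q * t)⁻¹ / qInf q (q / R * (q * t)) * t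
          = -(S / q) * (qInf q (S * t⁻¹) * ω t⁻¹ / qInf q (q / R * t)) := by
      intro t ht0 ht
      have hqt := mul_ne_zero hq0 ht0
      have e1 := hrel (q * t)⁻¹ (inv_ne_zero hqt)
      rw [show q * (q * t)⁻¹ = t⁻¹ by field_simp] at e1
      have e2 := hne t ht
      rw [qInf_eq hq1] at e2
      have e4 := left_ne_zero_of_mul e2
      have e5 := right_ne_zero_of_mul e2
      rw [show q / R * (q * t) = q * (q / R * t) by ring, qInf_eq hq1 (q / R * t),
        qInf_eq hq1 (S * (q * t)⁻¹), show q * (S * (q * t)⁻¹) = S * t⁻¹ by field_simp]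
      have e6 : (1 - S * (q * t)⁻¹) * ω (q * t)⁻¹ * t
          = -(S / q) * ω t⁻¹ / (1 - q / R * t) := by
        rw [eq_div_iff e4]
        have e7 : 1 - q / R * t = -(q * t / R) * (1 - R * (q * t)⁻¹) := by
          field_simp
          ring
        rw [e7]
        have : -(S / q) * ω t⁻¹ = -(q * t ^ 2 / R) * (R * S * ((q * t)⁻¹) ^ 2 * ω t⁻¹) := by
          field_simp
        rw [this, e1]
        ring
      calc _ = qInf q (S * t⁻¹) / qInf q (q * (q / R * t))
            * ((1 - S * (q * t)⁻¹) * ω (q * t)⁻¹ * t) := by ring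
        _ = _ := by rw [e6]; field_simp
    have hzero : ∀ x : ℂ, x ≠ 0 → ‖x‖ < ρ →
        qInf q (S * x⁻¹) * ω x⁻¹ / qInf q (q / R * x) = 0 := by
      intro x hx0 hx
      obtain ⟨N, hN⟩ := hsmall 1
      refine eq_zero_of_quasiperiodic hq0 hq1
        (f := fun t => qInf q (S * t⁻¹) * ω t⁻¹ / qInf q (q / R * t))
        (ρ := ρ) (s := S / q) (t₀ := q ^ N) (div_ne_zero hS hq0) hfd hfun
        (pow_ne_zero _ hq0) (by simpa using hN) (by simp [hω1]) (fun k hk => ?_) hx0 hx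
      refine hSn (N + 1 - k) ?_
      rw [zpow_sub₀ hq0, zpow_add_one₀ hq0, zpow_natCast, hk]
      have := zpow_ne_zero k hq0
      field_simp
    intro x hx0 hx
    have h2 := (div_eq_zero_iff.1 (hzero x hx0 hx)).resolve_right (hne x hx)
    -- The multiplier `(S/x)_∞` may itself vanish, in which case nothing is learnt about `ω` at that
    -- point. Its zeros are isolated, since it is analytic off `0` and nonzero at `2 S`, so
    -- continuity of `ω` covers them.
    by_cases hS0 : qInf q (S * x⁻¹) = 0
    · have hc : ContinuousAt ω x⁻¹ :=
        hωd.continuousOn.continuousAt (isOpen_compl_singleton.mem_nhds (inv_ne_zero hx0))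
      have hc' : ContinuousAt (fun y : ℂ => ω y⁻¹) x :=
        ContinuousAt.comp (f := fun y : ℂ => y⁻¹) hc (continuousAt_inv₀ hx0)
      refine eq_zero_of_eq_zero_off_point (F := fun y : ℂ => ω y⁻¹) hc' ?_
      have hS1 : ∀ᶠ y in 𝓝[≠] x, qInf q (S * y⁻¹) ≠ 0 := by
        have han : AnalyticOnNhd ℂ (fun y : ℂ => qInf q (S * y⁻¹)) {0}ᶜ := by
          refine DifferentiableOn.analyticOnNhd ?_ isOpen_compl_singleton
          refine (differentiable_qInf hq1).comp_differentiableOn ?_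
          exact (differentiableOn_inv.mono fun y hy => hy).const_mul S
        rcases (han x hx0).eventually_eq_zero_or_eventually_ne_zero with h | h
        · exfalso
          have hpre : IsPreconnected ({0}ᶜ : Set ℂ) :=
            (isConnected_compl_singleton_of_one_lt_rank
              (by rw [Complex.rank_real_complex]; exact Nat.one_lt_ofNat) 0).isPreconnected
          have h3 := han.eqOn_zero_of_preconnected_of_eventuallyEq_zero hpre hx0 h
          have h4 := h3 (x := 2 * S) (by simp [hS])
          simp only [Pi.zero_apply] at h4
          refine qInf_ne_zero hq1 (mul_pow_ne_one_of_norm_lt hq1 ?_) h4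
          rw [mul_inv, mul_comm (2 : ℂ)⁻¹, ← mul_assoc, mul_inv_cancel₀ hS]
          norm_num
        · exact h
      have hev : ∀ᶠ y in 𝓝[≠] x, y ≠ 0 ∧ ‖y‖ < ρ :=
        ((isOpen_punctured ρ).eventually_mem ⟨hx0, hx⟩).filter_mono nhdsWithin_le_nhds
      filter_upwards [hS1, hev] with y hy1 hy2
      have h3 := (div_eq_zero_iff.1 (hzero y hy2.1 hy2.2)).resolve_right (hne y hy2.2)
      exact (mul_eq_zero.1 h3).resolve_left hy1
    · exact (mul_eq_zero.1 h2).resolve_left hS0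
  -- Vanishing now travels inwards, since `R S s² ≠ 0`.
  have hup : ∀ n : ℕ, ∀ x : ℂ, x ≠ 0 → ω ((q ^ n)⁻¹ * x) = 0 → ω x = 0 := by
    intro n
    induction n with
    | zero => intro x _ h; simpa using h
    | succ n ih =>
      intro x hx h
      refine ih x hx ?_
      have hn := pow_ne_zero (n + 1) hq0
      have hx' : (q ^ (n + 1))⁻¹ * x ≠ 0 := mul_ne_zero (inv_ne_zero hn) hx
      have h2 := hrel _ hx'
      rw [show q * ((q ^ (n + 1))⁻¹ * x) = (q ^ n)⁻¹ * x by rw [pow_succ']; field_simp, h,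
        mul_zero] at h2
      exact (mul_eq_zero.1 h2).resolve_left
        (mul_ne_zero (mul_ne_zero hR hS) (pow_ne_zero _ hx'))
  obtain ⟨N, hN⟩ := hsmall t⁻¹
  have h3 := hdisc _ (mul_ne_zero (pow_ne_zero _ hq0) (inv_ne_zero ht)) hN
  rw [mul_inv, inv_inv] at h3
  have := hup N t ht h3
  simpa only [hω] using this

/-! ### General position and its symmetries -/

theorem NotPow.mul_zpow_ne_one {x : ℂ} (h : NotPow q x) (k : ℤ) : x * q ^ k ≠ 1 := by
  intro h1
  refine h (-k) ?_
  rw [zpow_neg]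
  exact eq_inv_of_mul_eq_one_left h1

theorem NotPow.ne_one {x : ℂ} (h : NotPow q x) : x ≠ 1 := by simpa using h 0

theorem NotPow.qInf_ne_zero {x : ℂ} (h : NotPow q x) (hq1 : ‖q‖ < 1) :
    qInf q x ≠ 0 :=
  QHahn.qInf_ne_zero hq1 fun k => by simpa using h.mul_zpow_ne_one k

theorem NotPow.of_eq_mul {x y : ℂ} (h : NotPow q y) (hq0 : q ≠ 0) (k : ℤ) (e : x = y * q ^ k) :
    NotPow q x := by
  intro j hj
  refine h (j - k) ?_
  rw [zpow_sub₀ hq0, ← hj, e, mul_div_cancel_right₀ _ (zpow_ne_zero _ hq0)]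

theorem NotPow.of_mul_eq {x y : ℂ} (h : NotPow q y) (hq0 : q ≠ 0) (k : ℤ) (e : x * y = q ^ k) :
    NotPow q x := by
  intro j hj
  refine h (k - j) ?_
  rw [zpow_sub₀ hq0, ← hj, ← e, mul_div_cancel_left₀]
  rw [hj]
  exact zpow_ne_zero _ hq0

theorem NotPow.mul_self {x : ℂ} (h : NotPow q x) (hq0 : q ≠ 0) : NotPow q (q * x) :=
  h.of_eq_mul hq0 1 (by rw [zpow_one, mul_comm])

theorem NotPow.div_symm {x y : ℂ} (h : NotPow q (x / y)) (hx : x ≠ 0) (hy : y ≠ 0)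
    (hq0 : q ≠ 0) : NotPow q (y / x) :=
  h.of_mul_eq hq0 0 (by rw [zpow_zero]; field_simp)

/-- The parameters are nonzero, in general position, and `λ₊ λ₋ = q / (ABCD)`. -/
structure Generic (q A B C D lp lm : ℂ) : Prop where
  hA : A ≠ 0
  hB : B ≠ 0
  hC : C ≠ 0
  hD : D ≠ 0
  hl : lp * lm = q / (A * B * C * D)
  gp : GeneralPosition q A B C D lp lm

section

variable {A B C D lp lm : ℂ}

/-- The three adjacent transpositions generate all permutations of the parameters. Together with
`Generic.swap_root` they reduce each use of general position to one of a few conditions on the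
leading entries. -/
theorem Generic.swap_one (h : Generic q A B C D lp lm) (hq0 : q ≠ 0) :
    Generic q B A C D lp lm := by
  obtain ⟨hA, hB, hC, hD, hl, h⟩ := h
  refine ⟨hB, hA, hC, hD, by rw [hl, mul_comm A B], ?_⟩
  simp only [GeneralPosition, List.mem_cons, List.not_mem_nil, forall_eq_or_imp, or_false,
    forall_eq] at h ⊢
  rw [mul_comm B A]
  have := fun h : NotPow q (A / B) => h.div_symm hA hB hq0
  tauto

theorem Generic.swap_two (h : Generic q A B C D lp lm) (hq0 : q ≠ 0) :
    Generic q A C B D lp lm := by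
  obtain ⟨hA, hB, hC, hD, hl, h⟩ := h
  refine ⟨hA, hC, hB, hD, by rw [hl, mul_right_comm A B C], ?_⟩
  simp only [GeneralPosition, List.mem_cons, List.not_mem_nil, forall_eq_or_imp, or_false,
    forall_eq] at h ⊢
  rw [mul_comm C B]
  have := fun h : NotPow q (B / C) => h.div_symm hB hC hq0
  tauto

theorem Generic.swap_three (h : Generic q A B C D lp lm) (hq0 : q ≠ 0) :
    Generic q A B D C lp lm := by
  obtain ⟨hA, hB, hC, hD, hl, h⟩ := h
  refine ⟨hA, hB, hD, hC, by rw [hl, mul_right_comm _ C D], ?_⟩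
  simp only [GeneralPosition, List.mem_cons, List.not_mem_nil, forall_eq_or_imp, or_false,
    forall_eq] at h ⊢
  rw [mul_comm D C]
  have := fun h : NotPow q (C / D) => h.div_symm hC hD hq0
  tauto

theorem Generic.lp_ne_zero (h : Generic q A B C D lp lm) (hq0 : q ≠ 0) : lp ≠ 0 :=
  ne_zero_of_mul_eq_div hq0 h.hA h.hB h.hC h.hD h.hl

theorem Generic.lm_ne_zero (h : Generic q A B C D lp lm) (hq0 : q ≠ 0) : lm ≠ 0 :=
  ne_zero_of_mul_eq_div hq0 h.hA h.hB h.hC h.hD ((mul_comm _ _).trans h.hl)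

theorem Generic.swap_root (h : Generic q A B C D lp lm) (hq0 : q ≠ 0) :
    Generic q A B C D lm lp := by
  have h1 := h.lp_ne_zero hq0
  have h2 := h.lm_ne_zero hq0
  obtain ⟨hA, hB, hC, hD, hl, h⟩ := h
  refine ⟨hA, hB, hC, hD, by rw [mul_comm, hl], ?_⟩
  simp only [GeneralPosition, List.mem_cons, List.not_mem_nil, forall_eq_or_imp, or_false,
    forall_eq] at h ⊢
  have := fun h : NotPow q (lp / lm) => h.div_symm h1 h2 hq0
  tauto

theorem Generic.notPow_left (h : Generic q A B C D lp lm) : NotPow q A :=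
  h.gp.1 _ (by simp)

theorem Generic.notPow_div (h : Generic q A B C D lp lm) : NotPow q (A / B) :=
  h.gp.1 _ (by simp)

theorem Generic.notPow_div_root (h : Generic q A B C D lp lm) : NotPow q (lp / lm) :=
  h.gp.1 _ (by simp)

theorem Generic.notPow_mul_root (h : Generic q A B C D lp lm) : NotPow q (A * lp) :=
  h.gp.2 _ (by simp) _ (by simp)

theorem Generic.notPow_mul_mul_root (h : Generic q A B C D lp lm) : NotPow q (A * B * lp) :=
  h.gp.2 _ (by simp) _ (by simp)

/-! ### Special values of the two kinds of solutions -/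

theorem hahnU_swap (hq0 : q ≠ 0) (hq1 : ‖q‖ < 1) (A B C D lp lm : ℂ) :
    hahnU q A B C D lp lm = hahnU q A B D C lp lm := by
  funext t
  exact Psi_swap_denom hq0 hq1 _ _ _ _ _ _

/-- At `t = 1/A` the first numerator parameter is `1`, so the series terminates at once. -/
theorem Generic.hahnU_inv_ne_zero (h : Generic q A B C D lp lm) (hq0 : q ≠ 0) (hq1 : ‖q‖ < 1) :
    hahnU q A B C D lp lm A⁻¹ ≠ 0 := by
  have hA := h.hA
  have hB := h.hB
  have h1 := h.notPow_div.mul_self hq0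
  have h2 := (h.swap_two hq0).notPow_div.mul_self hq0
  have h3 := ((h.swap_three hq0).swap_two hq0).notPow_div.mul_self hq0
  rw [hahnU, mul_inv_cancel₀ hA, Psi_one_left hq0 hq1,
    show q / (B * A⁻¹) = q * (A / B) by field_simp, mul_comm A q, mul_div_assoc, mul_div_assoc]
  exact mul_ne_zero (h1.qInf_ne_zero hq1)
    (mul_ne_zero (h2.qInf_ne_zero hq1) (h3.qInf_ne_zero hq1))

/-- At `t = q/B` the argument is `1`, where `Psi` is the product of its numerator factors. -/
theorem Generic.hahnU_two_ne_zero (h : Generic q A B C D lp lm) (hq0 : q ≠ 0) (hq1 : ‖q‖ < 1) :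
    hahnU q A B C D lp lm (q * B⁻¹) ≠ 0 := by
  have hB := h.hB
  have h1 := h.notPow_div.mul_self hq0
  have h2 := h.notPow_mul_mul_root
  have h3 := (h.swap_root hq0).notPow_mul_mul_root
  rw [hahnU, show q / (B * (q * B⁻¹)) = 1 by field_simp, Psi_arg_one hq0 hq1,
    show A * (q * B⁻¹) = q * (A / B) by field_simp]
  exact mul_ne_zero (mul_ne_zero (h1.qInf_ne_zero hq1) (h2.qInf_ne_zero hq1))
    (h3.qInf_ne_zero hq1)

/-- At `t = q/C` the parameter `A t` cancels the denominator `A q/C`, and the relation for `λ₊λ₋`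
makes the remaining argument that of the `q`-Gauss sum. -/
theorem Generic.hahnU_three_ne_zero (h : Generic q A B C D lp lm) (hq0 : q ≠ 0) (hq1 : ‖q‖ < 1) :
    hahnU q A B C D lp lm (q * C⁻¹) ≠ 0 := by
  have hA := h.hA
  have hB := h.hB
  have hC := h.hC
  have hD := h.hD
  have hlp := h.lp_ne_zero hq0
  have hlm := h.lm_ne_zero hq0
  have h1 := (h.swap_two hq0).notPow_div.mul_self hq0
  have g := (((h.swap_one hq0).swap_three hq0).swap_two hq0)
  have h2 : NotPow q (A * q / D / (A * B * lp)) :=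
    g.notPow_mul_mul_root.of_mul_eq hq0 1 (by rw [zpow_one]; field_simp)
  have h3 : NotPow q (A * q / D / (A * B * lm)) :=
    (g.swap_root hq0).notPow_mul_mul_root.of_mul_eq hq0 1 (by rw [zpow_one]; field_simp)
  have hw : q / (B * (q * C⁻¹)) = A * q / D / (A * B * lp * (A * B * lm)) := by
    rw [show A * B * lp * (A * B * lm) = A * B * (A * B) * (lp * lm) by ring, h.hl]
    field_simp
  rw [hahnU, hw, show A * (q * C⁻¹) = A * q / C by field_simp,
    Psi_gauss hq0 hq1 _ (mul_ne_zero (mul_ne_zero hA hB) hlp)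
      (mul_ne_zero (mul_ne_zero hA hB) hlm), mul_comm A q, mul_div_assoc]
  rw [mul_comm A q] at h2 h3
  exact mul_ne_zero (h1.qInf_ne_zero hq1)
    (mul_ne_zero (by simpa only [mul_div_assoc] using h2.qInf_ne_zero hq1)
      (by simpa only [mul_div_assoc] using h3.qInf_ne_zero hq1))

theorem Generic.hahnU_four_ne_zero (h : Generic q A B C D lp lm) (hq0 : q ≠ 0) (hq1 : ‖q‖ < 1) :
    hahnU q A B C D lp lm (q * D⁻¹) ≠ 0 := by
  rw [hahnU_swap hq0 hq1]
  exact (h.swap_three hq0).hahnU_three_ne_zero hq0 hq1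

/-- At `t = 1/A` a denominator parameter equals `B C λ₊`, and the `q`-Gauss sum applies. -/
theorem Generic.hahnV_one_ne_zero (h : Generic q A B C D lp lm) (hq0 : q ≠ 0) (hq1 : ‖q‖ < 1) :
    hahnV q A B C D lp A⁻¹ ≠ 0 := by
  have hA := h.hA
  have hB := h.hB
  have hC := h.hC
  have h1 := ((h.swap_one hq0).swap_two hq0).notPow_mul_mul_root
  have h2 := (((h.swap_one hq0).swap_two hq0).swap_three hq0)
  have h3 := ((h2.swap_one hq0).swap_two hq0).notPow_mul_mul_root
  have h4 := (h2.swap_two hq0).notPow_mul_mul_root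
  have hw : A * D * lp = B * C * D * lp * A⁻¹ / (B * A⁻¹ * (C * A⁻¹)) := by field_simp
  rw [hahnV, Psi_swap_denom hq0 hq1, hw, show A * B * C * lp * A⁻¹ = B * C * lp by field_simp,
    Psi_gauss hq0 hq1 _ (mul_ne_zero hB (inv_ne_zero hA)) (mul_ne_zero hC (inv_ne_zero hA)),
    show B * C * D * lp * A⁻¹ / (B * A⁻¹) = C * D * lp by field_simp,
    show B * C * D * lp * A⁻¹ / (C * A⁻¹) = B * D * lp by field_simp]
  exact mul_ne_zero (h1.qInf_ne_zero hq1)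
    (mul_ne_zero (h3.qInf_ne_zero hq1) (h4.qInf_ne_zero hq1))

/-- At `t = 1/B` the parameter `B t` is `1` and the series terminates. -/
theorem Generic.hahnV_two_ne_zero (h : Generic q A B C D lp lm) (hq0 : q ≠ 0) (hq1 : ‖q‖ < 1) :
    hahnV q A B C D lp B⁻¹ ≠ 0 := by
  have hB := h.hB
  have h1 := ((h.swap_three hq0).swap_two hq0).notPow_mul_mul_root
  have h2 := ((((h.swap_two hq0).swap_one hq0).swap_three hq0).swap_two hq0).notPow_mul_mul_root
  have h3 := (h.swap_two hq0).notPow_mul_mul_root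
  rw [hahnV, mul_inv_cancel₀ hB, Psi_swap_left hq0 hq1, Psi_one_left hq0 hq1,
    show B * C * D * lp * B⁻¹ = C * D * lp by field_simp,
    show A * B * C * lp * B⁻¹ = A * C * lp by field_simp]
  exact mul_ne_zero (h1.qInf_ne_zero hq1)
    (mul_ne_zero (h2.qInf_ne_zero hq1) (h3.qInf_ne_zero hq1))

end

/-- At `t = 0` only the `q`-binomial series remains. This is the limit `n → ∞` of the solution, so
it fixes the leading asymptotic constant. -/
theorem hahnV_zero (hq0 : q ≠ 0) (hq1 : ‖q‖ < 1) {A B C D l m : ℂ} (hA : A ≠ 0) (hB : B ≠ 0)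
    (hC : C ≠ 0) (hD : D ≠ 0) (hl : l * m = q / (A * B * C * D)) :
    hahnV q A B C D l 0 = qInf q (q * (l / m)) := by
  have hm : m ≠ 0 := ne_zero_of_mul_eq_div hq0 hA hB hC hD ((mul_comm _ _).trans hl)
  have : B * C * l * (A * D * l) = q * (l / m) := by
    rw [eq_div_iff (by simp [hA, hB, hC, hD])] at hl
    rw [← hl]
    field_simp
  simp only [hahnV, mul_zero]
  rw [Psi_binomial hq0 hq1, this]

theorem uSol_hahnU (hq0 : q ≠ 0) (hq1 : ‖q‖ < 1) {A B C D lp lm : ℂ} (hA : A ≠ 0) (hB : B ≠ 0)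
    (hC : C ≠ 0) (hD : D ≠ 0) (hl : lp * lm = q / (A * B * C * D)) :
    USol q (lp + lm) A B C D (hahnU q A B C D lp lm) := fun _ hs =>
  hahnU_recurrence hq0 hq1 hA hB hC hD hl hs

theorem vSol_hahnV (hq0 : q ≠ 0) (hq1 : ‖q‖ < 1) {A B C D l m : ℂ} (hA : A ≠ 0) (hB : B ≠ 0)
    (hC : C ≠ 0) (hD : D ≠ 0) (hl : l * m = q / (A * B * C * D)) :
    VSol q l m A B C D (hahnV q A B C D l) := fun _ hs =>
  hahnV_recurrence hq0 hq1 hA hB hC hD hl hs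

/-! ### Casoratians -/

theorem indepSeq_of_casoratian_ne_zero {n₀ : ℤ} (hn₀ : n₀ ≤ 0) {X Y : ℤ → ℂ}
    (h : X 0 * Y 1 - X 1 * Y 0 ≠ 0) : IndepSeq n₀ X Y := by
  rw [IndepSeq, LinearIndependent.pair_iff]
  intro s t hst
  have h0 : s * X 0 + t * Y 0 = 0 := congrFun hst ⟨0, hn₀⟩
  have h1 : s * X 1 + t * Y 1 = 0 := congrFun hst ⟨1, hn₀.trans zero_le_one⟩
  constructor
  · refine (mul_eq_zero.1 ?_).resolve_right h
    linear_combination Y 1 * h0 - Y 0 * h1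
  · refine (mul_eq_zero.1 ?_).resolve_right h
    linear_combination X 0 * h1 - X 1 * h0

theorem IndepSeq.symm {n₀ : ℤ} {X Y : ℤ → ℂ} (h : IndepSeq n₀ X Y) : IndepSeq n₀ Y X :=
  LinearIndependent.pair_symm_iff.1 h

/-- `X 0` and `X 1` are those of a solution that is built from `U` as `X^{(2)}` from `hahnU`. -/
def StartsWithU (q P : ℂ) (U : ℂ → ℂ) (X : ℤ → ℂ) : Prop :=
  ∃ k : ℂ, k ≠ 0 ∧ X 0 = k * U 1 ∧ X 1 = -(k * ((1 - P) / P) * U q)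

/-- `X 0` and `X 1` are those of a solution that is built from `V` as `X^{(1)}` from `hahnV`. -/
def StartsWithV (q A B C D l : ℂ) (V : ℂ → ℂ) (X : ℤ → ℂ) : Prop :=
  ∃ k : ℂ, k ≠ 0 ∧ X 0 = k * V 1 ∧
    X 1 = k * (l * ((1 - A) * (1 - B) * (1 - C) * (1 - D))) * V q

theorem StartsWithV.perm {A B C D A' B' C' D' l : ℂ} {V : ℂ → ℂ} {X : ℤ → ℂ}
    (h : StartsWithV q A B C D l V X) (e : (1 - A') * (1 - B') * (1 - C') * (1 - D')
      = (1 - A) * (1 - B) * (1 - C) * (1 - D)) : StartsWithV q A' B' C' D' l V X := by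
  rw [StartsWithV, e]
  exact h

/-- A vanishing Casoratian would make the Wronskian identically zero. At `t = 1/Q` the factor `1 - Q
t` kills one term, and the other is a nonzero multiple of `U (q/Q) V (1/Q)`. -/
theorem indepSeq_UV (hq0 : q ≠ 0) (hq1 : ‖q‖ < 1) {n₀ : ℤ} (hn₀ : n₀ ≤ 0) {P Q R S l m : ℂ}
    (g : Generic q P Q R S l m) {U V : ℂ → ℂ} {X Y : ℤ → ℂ} (hX : StartsWithU q P U X)
    (hY : StartsWithV q P Q R S l V Y) (hU : DifferentiableOn ℂ U {0}ᶜ) (hV : Differentiable ℂ V)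
    (hUs : USol q (l + m) P Q R S U) (hVs : VSol q l m P Q R S V) (hU0 : U (q * Q⁻¹) ≠ 0)
    (hV0 : V Q⁻¹ ≠ 0) : IndepSeq n₀ X Y := by
  obtain ⟨k, hk, hX0, hX1⟩ := hX
  obtain ⟨k', hk', hY0, hY1⟩ := hY
  have hP1 : 1 - P ≠ 0 := sub_ne_zero.2 g.notPow_left.ne_one.symm
  refine indepSeq_of_casoratian_ne_zero hn₀ fun h => ?_
  have h1 : l * ((1 - Q * 1) * (1 - R * 1) * (1 - S * 1)) * (U 1 * V (q * 1))
      + 1 / P * (U (q * 1) * V 1) = 0 := by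
    rw [hX0, hX1, hY0, hY1] at h
    refine (mul_eq_zero.1 (?_ : k * k' * (1 - P) * _ = 0)).resolve_left
      (mul_ne_zero (mul_ne_zero hk hk') hP1)
    simp only [mul_one]
    rw [← h]
    ring
  have h2 := wronskian_UV_eq_zero hq0 hq1 g.hA g.hl (g.lm_ne_zero hq0) hU hV hUs hVs
    g.notPow_left (g.swap_root hq0).notPow_mul_root h1 (inv_ne_zero g.hB)
  rw [mul_inv_cancel₀ g.hB, sub_self, zero_mul, zero_mul, mul_zero, zero_mul, zero_add] at h2
  exact mul_ne_zero (div_ne_zero (inv_ne_zero g.hB) g.hA) (mul_ne_zero hU0 hV0) h2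

/-- The test point is `t = 1/P`, where `1 - P t` kills the first term and `P ≠ P'` keeps the second.
-/
theorem indepSeq_UU (hq0 : q ≠ 0) (hq1 : ‖q‖ < 1) {n₀ : ℤ} (hn₀ : n₀ ≤ 0) {P P' R S lp lm : ℂ}
    (g : Generic q P P' R S lp lm) {U U' : ℂ → ℂ} {X Y : ℤ → ℂ} (hX : StartsWithU q P U X)
    (hY : StartsWithU q P' U' Y) (hU : DifferentiableOn ℂ U {0}ᶜ)
    (hU' : DifferentiableOn ℂ U' {0}ᶜ) (hUs : USol q (lp + lm) P P' R S U)
    (hUs' : USol q (lp + lm) P' P R S U') (hU0 : U P⁻¹ ≠ 0) (hU0' : U' (q * P⁻¹) ≠ 0) :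
    IndepSeq n₀ X Y := by
  obtain ⟨k, hk, hX0, hX1⟩ := hX
  obtain ⟨k', hk', hY0, hY1⟩ := hY
  refine indepSeq_of_casoratian_ne_zero hn₀ fun h => ?_
  have h1 : (1 - P * 1) / P * (U (q * 1) * U' 1) - (1 - P' * 1) / P' * (U 1 * U' (q * 1)) = 0 := by
    rw [hX0, hX1, hY0, hY1] at h
    refine (mul_eq_zero.1 (?_ : k * k' * _ = 0)).resolve_left (mul_ne_zero hk hk')
    simp only [mul_one]
    rw [← h]
    ring
  have h2 := wronskian_UU_eq_zero hq0 hq1 g.hA g.hB g.hC g.hD hU hU' hUs hUs'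
    ((g.swap_two hq0).swap_one hq0).notPow_left
    (((g.swap_three hq0).swap_two hq0).swap_one hq0).notPow_left h1 (inv_ne_zero g.hA)
  rw [mul_inv_cancel₀ g.hA, sub_self, zero_div, zero_mul, zero_sub, neg_eq_zero] at h2
  refine mul_ne_zero (div_ne_zero (sub_ne_zero.2 ?_) g.hB) (mul_ne_zero hU0 hU0') h2
  exact (g.swap_one hq0).notPow_div.ne_one.symm

/-- No theta function is needed: the Wronskian is continuous at `0`, so vanishing along `q ^ n → 0`
gives zero there, against the value `(m - l) (q l/m)_∞ (q m/l)_∞ ≠ 0`. -/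
theorem indepSeq_VV (hq0 : q ≠ 0) (hq1 : ‖q‖ < 1) {n₀ : ℤ} (hn₀ : n₀ ≤ 0) {A B C D l m : ℂ}
    (g : Generic q A B C D l m) {X Y : ℤ → ℂ}
    (hX : StartsWithV q A B C D l (hahnV q A B C D l) X)
    (hY : StartsWithV q A B C D m (hahnV q A B C D m) Y) : IndepSeq n₀ X Y := by
  obtain ⟨k, hk, hX0, hX1⟩ := hX
  obtain ⟨k', hk', hY0, hY1⟩ := hY
  have hnp : ∀ x : ℂ, NotPow q x → ∀ n : ℕ, 1 - x * q ^ n ≠ 0 := fun x hx n =>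
    sub_ne_zero.2 (by simpa using (hx.mul_zpow_ne_one n).symm)
  have nA := hnp A g.notPow_left
  have nB := hnp B (g.swap_one hq0).notPow_left
  have nC := hnp C ((g.swap_two hq0).swap_one hq0).notPow_left
  have nD := hnp D (((g.swap_three hq0).swap_two hq0).swap_one hq0).notPow_left
  have hl' : m * l = q / (A * B * C * D) := (mul_comm _ _).trans g.hl
  have hV := differentiable_hahnV hq0 hq1 A B C D l
  have hV' := differentiable_hahnV hq0 hq1 A B C D m
  have e0 := hahnV_zero hq0 hq1 g.hA g.hB g.hC g.hD g.hl
  have e0' := hahnV_zero hq0 hq1 g.hA g.hB g.hC g.hD hl'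
  have hs := vSol_hahnV hq0 hq1 g.hA g.hB g.hC g.hD g.hl
  have hs' := vSol_hahnV hq0 hq1 g.hA g.hB g.hC g.hD hl'
  generalize hahnV q A B C D l = V at *
  generalize hahnV q A B C D m = V' at *
  refine indepSeq_of_casoratian_ne_zero hn₀ fun h => ?_
  obtain ⟨ω, hω⟩ : ∃ ω : ℂ → ℂ, ω = fun t => m * (V t * V' (q * t)) - l * (V (q * t) * V' t) :=
    ⟨_, rfl⟩
  have hω0 : ∀ n : ℕ, ω (q ^ n) = 0 := by
    intro n
    induction n with
    | zero =>
      rw [hX0, hX1, hY0, hY1] at h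
      have hp := mul_ne_zero (mul_ne_zero (mul_ne_zero (nA 0) (nB 0)) (nC 0)) (nD 0)
      simp only [pow_zero, mul_one] at hp
      refine (mul_eq_zero.1
        (?_ : k * k' * ((1 - A) * (1 - B) * (1 - C) * (1 - D)) * _ = 0)).resolve_left
        (mul_ne_zero (mul_ne_zero hk hk') hp)
      simp only [hω, pow_zero, mul_one]
      rw [← h]
      ring
    | succ n ih =>
      have h1 := hs (q ^ n) (pow_ne_zero _ hq0)
      have h2 := hs' (q ^ n) (pow_ne_zero _ hq0)
      have hp := mul_ne_zero (mul_ne_zero (mul_ne_zero (nA (n + 1)) (nB (n + 1))) (nC (n + 1)))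
        (nD (n + 1))
      simp only [hω, pow_succ'] at ih hp ⊢
      refine (mul_eq_zero.1 (?_ : ((1 - A * (q * q ^ n)) * (1 - B * (q * q ^ n)) *
        (1 - C * (q * q ^ n)) * (1 - D * (q * q ^ n))) * _ = 0)).resolve_left hp
      linear_combination ih - V' (q * q ^ n) * h1 + V (q * q ^ n) * h2
  have hc : Continuous ω := by
    have := hV.continuous
    have := hV'.continuous
    rw [hω]
    fun_prop
  have h0 : ω 0 = 0 := by
    have ht := (hc.tendsto 0).comp (tendsto_pow_atTop_nhds_zero_of_norm_lt_one hq1)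
    refine tendsto_nhds_unique ht ?_
    simp only [Function.comp_def, hω0]
    exact tendsto_const_nhds
  simp only [hω, mul_zero, e0, e0'] at h0
  have h1 : (m - l) * (qInf q (q * (l / m)) * qInf q (q * (m / l))) = 0 := by
    rw [← h0]
    ring
  have hne : l / m ≠ 1 := g.notPow_div_root.ne_one
  refine mul_ne_zero (sub_ne_zero.2 ?_) (mul_ne_zero
    ((g.notPow_div_root.mul_self hq0).qInf_ne_zero hq1)
    (((g.swap_root hq0).notPow_div_root.mul_self hq0).qInf_ne_zero hq1)) h1
  rintro rfl
  exact hne (div_self (g.lm_ne_zero hq0))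

/-! ### Reduction of the last four functions to one, and part (i) -/

theorem X3_eq_X2 (q A B C D lp lm : ℂ) : X3 q A B C D lp lm = X2 q B A C D lp lm := by
  funext n
  rw [X3, X2, mul_comm B A, mul_comm (qPoch q B n)]

theorem X4_eq_X2 (q A B C D lp lm : ℂ) : X4 q A B C D lp lm = X2 q C B A D lp lm := by
  funext n
  rw [X4, X2, mul_comm C B, mul_comm (qPoch q C n)]

theorem X5_eq_X2 (q A B C D lp lm : ℂ) : X5 q A B C D lp lm = X2 q D B C A lp lm := by
  funext n
  rw [X5, X2, mul_comm D B, mul_comm (qPoch q D n)]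

theorem IsSolution.perm {A B C D A' B' C' D' z : ℂ} {n₀ : ℤ} {X : ℤ → ℂ}
    (h : IsSolution q A' B' C' D' z n₀ X)
    (ha : ∀ n, coeffA q A B C D n = coeffA q A' B' C' D' n)
    (hb : ∀ n, coeffBsq q A B C D n = coeffBsq q A' B' C' D' n) :
    IsSolution q A B C D z n₀ X := by
  intro n hn
  rw [ha, hb]
  exact h n hn

theorem lamP_add_lamM (z r : ℂ) : lamP z r + lamM z r = z := by
  rw [lamP, lamM]
  ring

theorem lamP_mul_lamM {z r w : ℂ} (hr : r ^ 2 = z ^ 2 - 4 * q / w) :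
    lamP z r * lamM z r = q / w := by
  rw [lamP, lamM]
  linear_combination -hr / 4

theorem isSolution_family (hq0 : q ≠ 0) (hq1 : ‖q‖ < 1) {A B C D z r : ℂ} {n₀ : ℤ} (hn₀ : n₀ ≤ 0)
    (hA0 : A ≠ 0) (hB0 : B ≠ 0) (hC0 : C ≠ 0) (hD0 : D ≠ 0)
    (hA : ∀ m : ℤ, n₀ ≤ m → A * q ^ m ≠ 1) (hB : ∀ m : ℤ, n₀ ≤ m → B * q ^ m ≠ 1)
    (hC : ∀ m : ℤ, n₀ ≤ m → C * q ^ m ≠ 1) (hD : ∀ m : ℤ, n₀ ≤ m → D * q ^ m ≠ 1)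
    (hr : r ^ 2 = z ^ 2 - 4 * q / (A * B * C * D)) (i : Fin 6)
    (hi : familyDefined q A B C D (lamP z r) (lamM z r) n₀ i) :
    IsSolution q A B C D z n₀ (family q A B C D (lamP z r) (lamM z r) i) := by
  have hl := lamP_mul_lamM hr
  have hz := lamP_add_lamM z r
  fin_cases i
  · have := isSolution_X1 hq0 hq1 hn₀ hA0 hB0 hC0 hD0 hA hB hC hD hl hi
    rwa [hz] at this
  · have := isSolution_X1 hq0 hq1 hn₀ hA0 hB0 hC0 hD0 hA hB hC hD ((mul_comm _ _).trans hl) hi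
    rwa [add_comm, hz] at this
  · have := isSolution_X2 hq0 hq1 hA0 hB0 hC0 hD0 hA hB hl hi
    rwa [hz] at this
  · have := isSolution_X2 hq0 hq1 hB0 hA0 hC0 hD0 hB hA (hl.trans (by ring)) hi
    rw [hz, ← X3_eq_X2] at this
    exact this.perm (fun n => by rw [coeffA, coeffA]; ring)
      fun n => by rw [coeffBsq, coeffBsq]; ring
  · have := isSolution_X2 hq0 hq1 hC0 hB0 hA0 hD0 hC hB (hl.trans (by ring)) hi
    rw [hz, ← X4_eq_X2] at this
    exact this.perm (fun n => by rw [coeffA, coeffA]; ring)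
      fun n => by rw [coeffBsq, coeffBsq]; ring
  · have := isSolution_X2 hq0 hq1 hD0 hB0 hC0 hA0 hD hB (hl.trans (by ring)) hi
    rw [hz, ← X5_eq_X2] at this
    exact this.perm (fun n => by rw [coeffA, coeffA]; ring)
      fun n => by rw [coeffBsq, coeffBsq]; ring

/-! ### The six functions in general position, and part (ii) -/

section

variable {A B C D lp lm : ℂ}

/-- Triple products are not among the listed conditions. They are covered because `BCDλ₊ · Aλ₋ = q`,
and likewise with `A` and `D` exchanged. -/
theorem Generic.X1Defined (h : Generic q A B C D lp lm) (hq0 : q ≠ 0) (n₀ : ℤ) :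
    QHahn.X1Defined q A B C D lp n₀ := by
  have hA := h.hA
  have hB := h.hB
  have hC := h.hC
  have hD := h.hD
  have hl := h.hl
  rw [eq_div_iff (by simp [hA, hB, hC, hD])] at hl
  refine ⟨fun m _ => ?_, fun m _ => ?_, fun k => ?_⟩
  · refine NotPow.mul_zpow_ne_one ?_ m
    refine (h.swap_root hq0).notPow_mul_root.of_mul_eq hq0 1 ?_
    rw [zpow_one]
    linear_combination hl
  · refine NotPow.mul_zpow_ne_one ?_ m
    refine ((((h.swap_root hq0).swap_three hq0).swap_two hq0).swap_one
      hq0).notPow_mul_root.of_mul_eq hq0 1 ?_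
    rw [zpow_one]
    linear_combination hl
  · rw [← zpow_natCast]
    exact ((h.swap_three hq0).swap_two hq0).notPow_mul_mul_root.mul_zpow_ne_one k

theorem Generic.XkDefined (h : Generic q A B C D lp lm) (hq0 : q ≠ 0) (n₀ : ℤ) :
    QHahn.XkDefined q A C D B n₀ := by
  have hB := h.hB
  have h1 := (h.swap_two hq0).notPow_div.mul_self hq0
  have h2 := ((h.swap_three hq0).swap_two hq0).notPow_div.mul_self hq0
  have h3 := (h.swap_one hq0).notPow_left
  refine ⟨fun k => ?_, fun k => ?_, fun n _ k => ?_⟩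
  · rw [← zpow_natCast, mul_comm A, mul_div_assoc]
    exact h1.mul_zpow_ne_one k
  · rw [← zpow_natCast, mul_comm A, mul_div_assoc]
    exact h2.mul_zpow_ne_one k
  · rw [← zpow_natCast]
    exact (h3.of_mul_eq hq0 (1 - n) (div_mul_cancel₀ _ hB)).mul_zpow_ne_one k

theorem Generic.startsWithU (h : Generic q A B C D lp lm) (hq0 : q ≠ 0) (hq1 : ‖q‖ < 1) :
    StartsWithU q A (hahnU q A B C D lp lm) (X2 q A B C D lp lm) := by
  have hA := h.hA
  have hB := h.hB
  have n1 := h.notPow_left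
  have n2 := (h.swap_one hq0).notPow_left
  have n3 := (n2.of_mul_eq hq0 0 (by rw [zpow_zero, inv_mul_cancel₀ hB])).mul_self hq0
  have hx := fun n (hn : 0 ≤ n) => X2_eq (lp := lp) (lm := lm) hq0 hq1
    (fun m _ => n1.mul_zpow_ne_one m)
    (fun m _ => n2.mul_zpow_ne_one m) (h.XkDefined hq0 0) hn
  have a1 := (n1.mul_self hq0).qInf_ne_zero hq1
  have a2 := (n2.mul_self hq0).qInf_ne_zero hq1
  have a3 := n3.qInf_ne_zero hq1
  have a4 := ((h.swap_two hq0).notPow_div.mul_self hq0).qInf_ne_zero hq1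
  have a5 := (((h.swap_three hq0).swap_two hq0).notPow_div.mul_self hq0).qInf_ne_zero hq1
  have b2 : 1 - B ≠ 0 := sub_ne_zero.2 n2.ne_one.symm
  rw [← mul_div_assoc, mul_comm q A] at a4 a5
  refine ⟨(qInf q (A * q / C) * qInf q (A * q / D) * qInf q (q * B⁻¹))⁻¹,
    inv_ne_zero (mul_ne_zero (mul_ne_zero a4 a5) a3), ?_, ?_⟩
  · have e1 := n1.qInf_ne_zero hq1
    have e2 := n2.qInf_ne_zero hq1
    rw [hx 0 le_rfl, zpow_zero, zpow_zero, mul_one, mul_one, div_eq_mul_inv q B]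
    field_simp
  · have e1 : qInf q (q / (B * q)) = (1 - B⁻¹) * qInf q (q * B⁻¹) := by
      rw [show q / (B * q) = B⁻¹ by field_simp, qInf_eq hq1]
    have e2 : 1 - B⁻¹ = -((1 - B) / B) := by
      field_simp
      ring
    rw [hx 1 zero_le_one, zpow_one, zpow_one, e1, e2, qInf_eq hq1 A, qInf_eq hq1 B, mul_comm q A,
      mul_comm q B]
    rw [mul_comm q] at a1 a2
    generalize qInf q (A * q) = x1 at *
    generalize qInf q (B * q) = x2 at *
    generalize qInf q (q * B⁻¹) = x3 at *
    generalize qInf q (A * q / C) = x4 at *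
    generalize qInf q (A * q / D) = x5 at *
    field_simp

theorem Generic.startsWithV (h : Generic q A B C D lp lm) (hq0 : q ≠ 0) (hq1 : ‖q‖ < 1) :
    StartsWithV q A B C D lp (hahnV q A B C D lp) (X1 q A B C D lp) := by
  have n1 := h.notPow_left
  have n2 := (h.swap_one hq0).notPow_left
  have n3 := ((h.swap_two hq0).swap_one hq0).notPow_left
  have n4 := (((h.swap_three hq0).swap_two hq0).swap_one hq0).notPow_left
  have hd := h.X1Defined hq0 0
  have hx := fun n (hn : 0 ≤ n) => X1_eq hq0 hq1 le_rfl (fun m _ => n1.mul_zpow_ne_one m)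
    (fun m _ => n2.mul_zpow_ne_one m) (fun m _ => n3.mul_zpow_ne_one m)
    (fun m _ => n4.mul_zpow_ne_one m) hd hn
  have c1 := qInf_ne_zero_of_zpow hq0 hq1 le_rfl hd.1
  have c2 := qInf_ne_zero_of_zpow hq0 hq1 le_rfl hd.2.1
  have c3 := qInf_ne_zero hq1 hd.2.2
  refine ⟨(qInf q (B * C * D * lp) * qInf q (A * B * C * lp) * qInf q (A * D * lp))⁻¹,
    inv_ne_zero (mul_ne_zero (mul_ne_zero c1 c2) c3), ?_, ?_⟩
  · have a1 := n1.qInf_ne_zero hq1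
    have a2 := n2.qInf_ne_zero hq1
    have a3 := n3.qInf_ne_zero hq1
    have a4 := n4.qInf_ne_zero hq1
    rw [hx 0 le_rfl]
    simp only [zpow_zero, mul_one, one_mul]
    field_simp
  · have a1 := (n1.mul_self hq0).qInf_ne_zero hq1
    have a2 := (n2.mul_self hq0).qInf_ne_zero hq1
    have a3 := (n3.mul_self hq0).qInf_ne_zero hq1
    have a4 := (n4.mul_self hq0).qInf_ne_zero hq1
    rw [hx 1 zero_le_one, zpow_one, zpow_one, qInf_eq hq1 A, qInf_eq hq1 B, qInf_eq hq1 C,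
      qInf_eq hq1 D, mul_comm q A, mul_comm q B, mul_comm q C, mul_comm q D]
    rw [mul_comm q] at a1 a2 a3 a4
    generalize qInf q (A * q) = x1 at *
    generalize qInf q (B * q) = x2 at *
    generalize qInf q (C * q) = x3 at *
    generalize qInf q (D * q) = x4 at *
    field_simp

theorem recA_congr {A' B' C' D' : ℂ} (h : 1 / A' + 1 / B' + 1 / C' + 1 / D'
    = 1 / A + 1 / B + 1 / C + 1 / D) (t : ℂ) : recA q A' B' C' D' t = recA q A B C D t := by
  rw [recA, h, recA]

theorem Generic.indep_X1_X1 (h : Generic q A B C D lp lm) (hq0 : q ≠ 0) (hq1 : ‖q‖ < 1) {n₀ : ℤ}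
    (hn₀ : n₀ ≤ 0) : IndepSeq n₀ (X1 q A B C D lp) (X1 q A B C D lm) :=
  indepSeq_VV hq0 hq1 hn₀ h (h.startsWithV hq0 hq1) ((h.swap_root hq0).startsWithV hq0 hq1)

/-- The second parameter `Q` is restricted to `A` or `B` because `hahnV`, which is not symmetric in
the four parameters, has been evaluated at `1/A` and `1/B` only. -/
theorem Generic.indep_X2_X1 (h : Generic q A B C D lp lm) (hq0 : q ≠ 0) (hq1 : ‖q‖ < 1) {n₀ : ℤ}
    (hn₀ : n₀ ≤ 0) {P Q R S : ℂ} (g : Generic q P Q R S lp lm)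
    (ha : 1 / P + 1 / Q + 1 / R + 1 / S = 1 / A + 1 / B + 1 / C + 1 / D)
    (hp : ∀ s : ℂ, (1 - P * s) * (1 - Q * s) * (1 - R * s) * (1 - S * s)
      = (1 - A * s) * (1 - B * s) * (1 - C * s) * (1 - D * s)) (hQ : Q = A ∨ Q = B) :
    IndepSeq n₀ (X2 q P Q R S lp lm) (X1 q A B C D lp) := by
  refine indepSeq_UV hq0 hq1 hn₀ g (g.startsWithU hq0 hq1)
    ((h.startsWithV hq0 hq1).perm (by simpa using hp 1))
    (differentiableOn_hahnU hq0 hq1 g.hB _ _ _ _ _) (differentiable_hahnV hq0 hq1 _ _ _ _ _)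
    (uSol_hahnU hq0 hq1 g.hA g.hB g.hC g.hD g.hl)
    ((vSol_hahnV hq0 hq1 h.hA h.hB h.hC h.hD h.hl).perm (recA_congr ha) hp)
    (g.hahnU_two_ne_zero hq0 hq1) ?_
  rcases hQ with rfl | rfl
  · exact h.hahnV_one_ne_zero hq0 hq1
  · exact h.hahnV_two_ne_zero hq0 hq1

/-- Each function has its own order of parameters; the common order `P, P', T, W` serves the
Wronskian. The last hypothesis says which closed evaluation gives the second function at `q/P`. -/
theorem Generic.indep_X2_X2 {P Q R S P' Q' R' S' T W : ℂ} (hq0 : q ≠ 0) (hq1 : ‖q‖ < 1) {n₀ : ℤ}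
    (hn₀ : n₀ ≤ 0) (h : Generic q P P' T W lp lm) (g : Generic q P Q R S lp lm)
    (g' : Generic q P' Q' R' S' lp lm)
    (ha : 1 / P + 1 / P' + 1 / T + 1 / W = 1 / P + 1 / Q + 1 / R + 1 / S)
    (hp : ∀ s : ℂ, (1 - P' * s) * (1 - T * s) * (1 - W * s)
      = (1 - Q * s) * (1 - R * s) * (1 - S * s)) (hm : P' * T * W = Q * R * S)
    (ha' : 1 / P' + 1 / P + 1 / T + 1 / W = 1 / P' + 1 / Q' + 1 / R' + 1 / S')
    (hp' : ∀ s : ℂ, (1 - P * s) * (1 - T * s) * (1 - W * s)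
      = (1 - Q' * s) * (1 - R' * s) * (1 - S' * s)) (hm' : P * T * W = Q' * R' * S')
    (hP : P = Q' ∨ P = R' ∨ P = S') :
    IndepSeq n₀ (X2 q P Q R S lp lm) (X2 q P' Q' R' S' lp lm) := by
  refine indepSeq_UU hq0 hq1 hn₀ h (g.startsWithU hq0 hq1) (g'.startsWithU hq0 hq1)
    (differentiableOn_hahnU hq0 hq1 g.hB _ _ _ _ _) (differentiableOn_hahnU hq0 hq1 g'.hB _ _ _ _ _)
    ((uSol_hahnU hq0 hq1 g.hA g.hB g.hC g.hD g.hl).perm (recA_congr ha) hp hm)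
    ((uSol_hahnU hq0 hq1 g'.hA g'.hB g'.hC g'.hD g'.hl).perm (recA_congr ha') hp' hm')
    (g.hahnU_inv_ne_zero hq0 hq1) ?_
  rcases hP with rfl | rfl | rfl
  · exact g'.hahnU_two_ne_zero hq0 hq1
  · exact g'.hahnU_three_ne_zero hq0 hq1
  · exact g'.hahnU_four_ne_zero hq0 hq1

theorem phi_swap_right (q a b c d e : ℂ) : phi q a b c d e = phi q a c b d e := by
  have h : phiCoeff q a b c d e = phiCoeff q a c b d e := by
    funext k
    rw [phiCoeff, phiCoeff, mul_right_comm (qPoch q a k)]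
  have h2 : IsPhiContinuation q a b c d e = IsPhiContinuation q a c b d e := by
    funext g
    simp only [IsPhiContinuation, phiSeries, h]
  funext w
  rw [phi, h2, phi]

theorem X2_swap_root (q A B C D lp lm : ℂ) : X2 q A B C D lp lm = X2 q A B C D lm lp := by
  funext n
  rw [X2, phi_swap_right, X2]

theorem Generic.familyDefined (h : Generic q A B C D lp lm) (hq0 : q ≠ 0) (n₀ : ℤ) (i : Fin 6) :
    QHahn.familyDefined q A B C D lp lm n₀ i := by
  have h1 := h.swap_one hq0
  have h2 := (h1.swap_two hq0).swap_one hq0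
  have h3 := ((((h.swap_three hq0).swap_two hq0).swap_one hq0).swap_two hq0).swap_three hq0
  fin_cases i
  · exact h.X1Defined hq0 n₀
  · exact (h.swap_root hq0).X1Defined hq0 n₀
  · exact h.XkDefined hq0 n₀
  · exact h1.XkDefined hq0 n₀
  · exact h2.XkDefined hq0 n₀
  · exact h3.XkDefined hq0 n₀

theorem Generic.pairwise_indepSeq (h : Generic q A B C D lp lm) (hq0 : q ≠ 0) (hq1 : ‖q‖ < 1)
    {n₀ : ℤ} (hn₀ : n₀ ≤ 0) :
    Pairwise fun i j : Fin 6 =>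
      IndepSeq n₀ (family q A B C D lp lm i) (family q A B C D lp lm j) := by
  have g := h.swap_root hq0
  have h3 : Generic q B A C D lp lm := h.swap_one hq0
  have h4 : Generic q C B A D lp lm := (h3.swap_two hq0).swap_one hq0
  have h5 : Generic q D B C A lp lm :=
    ((((h.swap_three hq0).swap_two hq0).swap_one hq0).swap_two hq0).swap_three hq0
  have k3 := h3.swap_root hq0
  have k4 := h4.swap_root hq0
  have k5 := h5.swap_root hq0
  have e01 := h.indep_X1_X1 hq0 hq1 hn₀
  have e02 := h.indep_X2_X1 hq0 hq1 hn₀ h (by ring) (fun s => by ring) (Or.inr rfl)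
  have e03 := h.indep_X2_X1 hq0 hq1 hn₀ h3 (by ring) (fun s => by ring) (Or.inl rfl)
  have e04 := h.indep_X2_X1 hq0 hq1 hn₀ h4 (by ring) (fun s => by ring) (Or.inr rfl)
  have e05 := h.indep_X2_X1 hq0 hq1 hn₀ h5 (by ring) (fun s => by ring) (Or.inr rfl)
  have e12 := g.indep_X2_X1 hq0 hq1 hn₀ g (by ring) (fun s => by ring) (Or.inr rfl)
  have e13 := g.indep_X2_X1 hq0 hq1 hn₀ k3 (by ring) (fun s => by ring) (Or.inl rfl)
  have e14 := g.indep_X2_X1 hq0 hq1 hn₀ k4 (by ring) (fun s => by ring) (Or.inr rfl)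
  have e15 := g.indep_X2_X1 hq0 hq1 hn₀ k5 (by ring) (fun s => by ring) (Or.inr rfl)
  have e23 := Generic.indep_X2_X2 hq0 hq1 hn₀ h h h3 (by ring) (fun s => by ring) (by ring)
    (by ring) (fun s => by ring) (by ring) (by simp)
  have e24 := Generic.indep_X2_X2 hq0 hq1 hn₀ (h.swap_two hq0) h h4 (by ring) (fun s => by ring)
    (by ring) (by ring) (fun s => by ring) (by ring) (by simp)
  have e25 := Generic.indep_X2_X2 hq0 hq1 hn₀ ((h.swap_three hq0).swap_two hq0) h h5 (by ring)
    (fun s => by ring) (by ring) (by ring) (fun s => by ring) (by ring) (by simp)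
  have e34 := Generic.indep_X2_X2 hq0 hq1 hn₀ (h3.swap_two hq0) h3 h4 (by ring) (fun s => by ring)
    (by ring) (by ring) (fun s => by ring) (by ring) (by simp)
  have e35 := Generic.indep_X2_X2 hq0 hq1 hn₀ ((h3.swap_three hq0).swap_two hq0) h3 h5 (by ring)
    (fun s => by ring) (by ring) (by ring) (fun s => by ring) (by ring) (by simp)
  have e45 := Generic.indep_X2_X2 hq0 hq1 hn₀ ((h4.swap_three hq0).swap_two hq0) h4 h5 (by ring)
    (fun s => by ring) (by ring) (by ring) (fun s => by ring) (by ring) (by simp)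
  -- The comparisons with `X^{(1),-}` were obtained with the roots exchanged; the other four
  -- functions are symmetric in the roots.
  rw [X2_swap_root] at e12 e13 e14 e15
  rw [family, X3_eq_X2, X4_eq_X2, X5_eq_X2]
  generalize X1 q A B C D lp = Y0 at *
  generalize X1 q A B C D lm = Y1 at *
  generalize X2 q A B C D lp lm = Y2 at *
  generalize X2 q B A C D lp lm = Y3 at *
  generalize X2 q C B A D lp lm = Y4 at *
  generalize X2 q D B C A lp lm = Y5 at *
  have key : ∀ i j : Fin 6, i < j →
      IndepSeq n₀ (![Y0, Y1, Y2, Y3, Y4, Y5] i) (![Y0, Y1, Y2, Y3, Y4, Y5] j) := by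
    intro i j hij
    fin_cases i <;> fin_cases j <;> try exact absurd hij (by decide)
    exacts [e01, e02.symm, e03.symm, e04.symm, e05.symm, e12.symm, e13.symm, e14.symm, e15.symm,
      e23, e24, e25, e34, e35, e45]
  intro i j hij
  rcases lt_or_gt_of_ne hij with hlt | hlt
  · exact key i j hlt
  · exact (key j i hlt).symm

end

/-! ### Asymptotics and minimal solutions -/

/-- The limit is the fixed point of `e ↦ ρ e + h`; the distance to it contracts by `‖ρ‖` up to a
vanishing error. -/
theorem tendsto_of_eventually_affine {ρ h : ℂ} (hρ : ‖ρ‖ < 1) {e g : ℕ → ℂ}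
    (he : ∀ᶠ n in atTop, e (n + 1) = ρ * e n + g n) (hg : Tendsto g atTop (𝓝 h)) :
    Tendsto e atTop (𝓝 (h / (1 - ρ))) := by
  have hρ1 : 1 - ρ ≠ 0 := by
    intro h0
    rw [← sub_eq_zero.1 h0, norm_one] at hρ
    exact lt_irrefl _ hρ
  obtain ⟨L, hL⟩ : ∃ L, L = h / (1 - ρ) := ⟨_, rfl⟩
  have hL' : h = L - ρ * L := by
    rw [hL]
    field_simp
  rw [← hL, Metric.tendsto_atTop']
  intro ε hε
  have hδ : 0 < (1 - ‖ρ‖) * (ε / 2) := mul_pos (sub_pos.2 hρ) (half_pos hε)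
  obtain ⟨N, hN⟩ := eventually_atTop.1 (he.and ((Metric.tendsto_nhds.1 hg) _ hδ))
  have hb : ∀ k : ℕ, ‖e (N + k) - L‖ ≤ ‖ρ‖ ^ k * ‖e N - L‖ + ε / 2 := by
    intro k
    induction k with
    | zero => simpa using (half_pos hε).le
    | succ k ih =>
      obtain ⟨h1, h2⟩ := hN (N + k) (by omega)
      rw [dist_eq_norm] at h2
      have h3 : e (N + (k + 1)) - L = ρ * (e (N + k) - L) + (g (N + k) - h) := by
        rw [← add_assoc, h1, hL']
        ring
      rw [h3]
      calc _ ≤ ‖ρ‖ * ‖e (N + k) - L‖ + ‖g (N + k) - h‖ := by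
            rw [← norm_mul]
            exact norm_add_le _ _
        _ ≤ ‖ρ‖ * (‖ρ‖ ^ k * ‖e N - L‖ + ε / 2) + (1 - ‖ρ‖) * (ε / 2) := by gcongr
        _ = _ := by ring
  have ht : Tendsto (fun k : ℕ => ‖ρ‖ ^ k * ‖e N - L‖) atTop (𝓝 (0 * ‖e N - L‖)) :=
    (tendsto_pow_atTop_nhds_zero_of_lt_one (norm_nonneg _) hρ).mul_const _
  rw [zero_mul] at ht
  obtain ⟨M, hM⟩ := eventually_atTop.1 (ht.eventually (gt_mem_nhds (half_pos hε)))
  refine ⟨N + M, fun n hn => ?_⟩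
  obtain ⟨k, rfl⟩ : ∃ k, n = N + k := ⟨n - N, by omega⟩
  rw [dist_eq_norm]
  calc _ ≤ _ := hb k
    _ < ε / 2 + ε / 2 := by
      gcongr
      exact hM k (by omega)
    _ = ε := add_halves ε

/-- A sequence that decays like `l ^ n` is dominated by any sequence for which the Casoratian of
the two behaves like `(l * m) ^ n`. -/
theorem tendsto_div_of_casoratian {l m c w : ℂ} (hl : l ≠ 0) (hm : m ≠ 0) (hρ : ‖l / m‖ < 1)
    {x y : ℕ → ℂ} (hx : Tendsto (fun n => x n / l ^ n) atTop (𝓝 c)) (hc : c ≠ 0)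
    (hW : Tendsto (fun n => (x n * y (n + 1) - x (n + 1) * y n) / (l * m) ^ n) atTop (𝓝 w))
    (hw : w ≠ 0) : (∀ᶠ n in atTop, y n ≠ 0) ∧ Tendsto (fun n => x n / y n) atTop (𝓝 0) := by
  obtain ⟨C, hC⟩ : ∃ C : ℕ → ℂ, C = fun n => x n / l ^ n := ⟨_, rfl⟩
  obtain ⟨g, hg⟩ : ∃ g : ℕ → ℂ, g = fun n => y n / m ^ n := ⟨_, rfl⟩
  have hxC : ∀ n, x n = l ^ n * C n := fun n => by
    rw [hC]
    field_simp
  have hyg : ∀ n, y n = m ^ n * g n := fun n => by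
    rw [hg]
    field_simp
  have hWC : ∀ n, (x n * y (n + 1) - x (n + 1) * y n) / (l * m) ^ n
      = m * C n * g (n + 1) - l * C (n + 1) * g n := fun n => by
    rw [hxC, hxC, hyg, hyg, mul_pow]
    field_simp
    ring
  simp only [hWC] at hW
  rw [← hC] at hx
  have hx' : Tendsto (fun n => C (n + 1)) atTop (𝓝 c) := hx.comp (tendsto_add_atTop_nat 1)
  have hC0 := hx.eventually_ne hc
  have hC1 := hx'.eventually_ne hc
  -- Dividing the Casoratian by `m C_n C_{n+1}` turns it into an affine recurrence for `g / C` with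
  -- ratio `l / m`; its limit is nonzero, so `y n` has exact order `m ^ n`.
  have hlim := tendsto_of_eventually_affine hρ (e := fun n => g n / C n)
    (g := fun n => (m * C n * g (n + 1) - l * C (n + 1) * g n) / (m * (C n * C (n + 1))))
    (h := w / (m * (c * c))) (by
      filter_upwards [hC0, hC1] with n h0 h1
      field_simp
      ring) (hW.div ((hx.mul hx').const_mul m) (mul_ne_zero hm (mul_ne_zero hc hc)))
  have hL : w / (m * (c * c)) / (1 - l / m) ≠ 0 := by
    refine div_ne_zero (div_ne_zero hw (mul_ne_zero hm (mul_ne_zero hc hc))) fun h0 => ?_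
    rw [← sub_eq_zero.1 h0, norm_one] at hρ
    exact lt_irrefl _ hρ
  constructor
  · filter_upwards [hlim.eventually_ne hL] with n hn
    rw [hyg]
    exact mul_ne_zero (pow_ne_zero _ hm) (div_ne_zero_iff.1 hn).1
  · have h1 := (tendsto_pow_atTop_nhds_zero_of_norm_lt_one hρ).mul (hlim.inv₀ hL)
    rw [zero_mul] at h1
    refine h1.congr' ?_
    filter_upwards with n
    rw [hxC, hyg, div_pow, inv_div]
    field_simp

section

variable {A B C D z : ℂ} {n₀ : ℤ} {X Y : ℤ → ℂ}

theorem IsSolution.eq_zero (hX : IsSolution q A B C D z n₀ X) (h0 : X n₀ = 0)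
    (h1 : X (n₀ + 1) = 0) {n : ℤ} (hn : n₀ ≤ n) : X n = 0 := by
  have key : ∀ k : ℕ, X (n₀ + k) = 0 ∧ X (n₀ + k + 1) = 0 := by
    intro k
    induction k with
    | zero => simpa using ⟨h0, h1⟩
    | succ k ih =>
      have h2 := hX (n₀ + k + 1) (by omega)
      rw [ih.2, add_sub_cancel_right, ih.1] at h2
      push_cast
      rw [← add_assoc]
      exact ⟨ih.2, by simpa using h2⟩
  have := (key (n - n₀).toNat).1
  rwa [Int.toNat_of_nonneg (by omega), add_sub_cancel] at this

theorem IsSolution.linear_comb (hX : IsSolution q A B C D z n₀ X)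
    (hY : IsSolution q A B C D z n₀ Y) (s t : ℂ) :
    IsSolution q A B C D z n₀ fun n => s * X n + t * Y n := by
  intro n hn
  linear_combination s * hX n hn + t * hY n hn

/-- Solutions are determined by their values at `n₀` and `n₀ + 1`, so a zero initial determinant
would give a linear dependence on the whole range. -/
theorem IsSolution.casoratian_ne_zero (hX : IsSolution q A B C D z n₀ X)
    (hY : IsSolution q A B C D z n₀ Y) (h : IndepSeq n₀ X Y) :
    X n₀ * Y (n₀ + 1) - X (n₀ + 1) * Y n₀ ≠ 0 := by
  intro hW
  rw [IndepSeq, LinearIndependent.pair_iff] at h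
  have key : ∀ s t : ℂ, s * X n₀ + t * Y n₀ = 0 → s * X (n₀ + 1) + t * Y (n₀ + 1) = 0 →
      s = 0 ∧ t = 0 := fun s t h0 h1 =>
    h s t (funext fun n => (hX.linear_comb hY s t).eq_zero h0 h1 n.2)
  obtain ⟨hY0, hX0⟩ := key (Y n₀) (-X n₀) (by ring) (by linear_combination -hW)
  obtain ⟨hY1, hX1⟩ := key (Y (n₀ + 1)) (-X (n₀ + 1)) (by linear_combination hW) (by ring)
  rw [neg_eq_zero] at hX0 hX1
  exact one_ne_zero (key 1 0 (by rw [hX0]; ring) (by rw [hX1]; ring)).1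

theorem IsSolution.casoratian_succ (hX : IsSolution q A B C D z n₀ X)
    (hY : IsSolution q A B C D z n₀ Y) {n : ℤ} (hn : n₀ ≤ n) :
    X (n + 1) * Y (n + 1 + 1) - X (n + 1 + 1) * Y (n + 1)
      = coeffBsq q A B C D (n + 1) * (X n * Y (n + 1) - X (n + 1) * Y n) := by
  have h1 := hX (n + 1) (by omega)
  have h2 := hY (n + 1) (by omega)
  rw [add_sub_cancel_right] at h1 h2
  linear_combination X (n + 1) * h2 - Y (n + 1) * h1

theorem coeffBsq_ne_zero (hq0 : q ≠ 0) (hA0 : A ≠ 0) (hB0 : B ≠ 0) (hC0 : C ≠ 0) (hD0 : D ≠ 0)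
    (hA : ∀ m : ℤ, n₀ ≤ m → A * q ^ m ≠ 1) (hB : ∀ m : ℤ, n₀ ≤ m → B * q ^ m ≠ 1)
    (hC : ∀ m : ℤ, n₀ ≤ m → C * q ^ m ≠ 1) (hD : ∀ m : ℤ, n₀ ≤ m → D * q ^ m ≠ 1) {n : ℤ}
    (hn : n₀ ≤ n) : coeffBsq q A B C D (n + 1) ≠ 0 := by
  rw [coeffBsq, add_sub_cancel_right]
  have h := fun x (hx : ∀ m : ℤ, n₀ ≤ m → x * q ^ m ≠ 1) => sub_ne_zero.2 (hx n hn).symm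
  exact mul_ne_zero (mul_ne_zero (mul_ne_zero (mul_ne_zero (div_ne_zero hq0 (mul_ne_zero
    (mul_ne_zero (mul_ne_zero hA0 hB0) hC0) hD0)) (h A hA)) (h B hB)) (h C hC)) (h D hD)

theorem tendsto_qInf_mul_pow (hq1 : ‖q‖ < 1) (x : ℂ) :
    Tendsto (fun n : ℕ => qInf q (x * q ^ n)) atTop (𝓝 1) := by
  have h := (tendsto_pow_mul_nhds_zero hq1 x)
  simp only [mul_comm _ x] at h
  simpa [Function.comp_def, qInf_zero_right] using
    ((differentiable_qInf hq1).continuous.tendsto 0).comp h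

theorem IsSolution.exists_tendsto_casoratian (hq0 : q ≠ 0) (hq1 : ‖q‖ < 1) (hn₀ : n₀ ≤ 0)
    (hA0 : A ≠ 0) (hB0 : B ≠ 0) (hC0 : C ≠ 0) (hD0 : D ≠ 0)
    (hA : ∀ m : ℤ, n₀ ≤ m → A * q ^ m ≠ 1) (hB : ∀ m : ℤ, n₀ ≤ m → B * q ^ m ≠ 1)
    (hC : ∀ m : ℤ, n₀ ≤ m → C * q ^ m ≠ 1) (hD : ∀ m : ℤ, n₀ ≤ m → D * q ^ m ≠ 1)
    (hX : IsSolution q A B C D z n₀ X) (hY : IsSolution q A B C D z n₀ Y)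
    (h : IndepSeq n₀ X Y) : ∃ w : ℂ, w ≠ 0 ∧
      Tendsto (fun n : ℕ => (X n * Y ((n + 1 : ℕ) : ℤ) - X ((n + 1 : ℕ) : ℤ) * Y n)
        / (q / (A * B * C * D)) ^ n) atTop (𝓝 w) := by
  obtain ⟨W, hW⟩ : ∃ W : ℤ → ℂ, W = fun n => X n * Y (n + 1) - X (n + 1) * Y n := ⟨_, rfl⟩
  have hstep : ∀ n, n₀ ≤ n → W (n + 1) = coeffBsq q A B C D (n + 1) * W n := fun n hn => by
    rw [hW]
    exact hX.casoratian_succ hY hn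
  have hne : ∀ k : ℕ, W (n₀ + k) ≠ 0 := by
    intro k
    induction k with
    | zero =>
      rw [hW]
      simpa using hX.casoratian_ne_zero hY h
    | succ k ih =>
      push_cast
      rw [← add_assoc, hstep _ (by omega)]
      exact mul_ne_zero (coeffBsq_ne_zero hq0 hA0 hB0 hC0 hD0 hA hB hC hD (by omega)) ih
  have hW0 : W 0 ≠ 0 := by
    have := hne (-n₀).toNat
    rwa [Int.toNat_of_nonneg (by omega), add_neg_cancel] at this
  have hκ : q / (A * B * C * D) ≠ 0 := div_ne_zero hq0 (by simp [hA0, hB0, hC0, hD0])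
  -- The product of the `b_k²` telescopes to a geometric factor times infinite products, and these
  -- tend to `1`.
  have hprod : ∀ n : ℕ, W n * (qInf q (A * q ^ n) * qInf q (B * q ^ n) * qInf q (C * q ^ n)
      * qInf q (D * q ^ n)) = (q / (A * B * C * D)) ^ n
        * (W 0 * (qInf q A * qInf q B * qInf q C * qInf q D)) := by
    intro n
    induction n with
    | zero => simp
    | succ n ih =>
      have e : ∀ x : ℂ, qInf q (x * q ^ n) = (1 - x * q ^ n) * qInf q (x * q ^ (n + 1)) := by
        intro x
        rw [qInf_eq hq1]
        congr 2
        ring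
      rw [e A, e B, e C, e D] at ih
      push_cast
      rw [hstep n (by omega), coeffBsq, add_sub_cancel_right, zpow_natCast, pow_succ' (q / _)]
      linear_combination (q / (A * B * C * D)) * ih
  refine ⟨W 0 * (qInf q A * qInf q B * qInf q C * qInf q D), mul_ne_zero hW0 (mul_ne_zero
    (mul_ne_zero (mul_ne_zero (qInf_ne_zero_of_zpow hq0 hq1 hn₀ hA)
    (qInf_ne_zero_of_zpow hq0 hq1 hn₀ hB)) (qInf_ne_zero_of_zpow hq0 hq1 hn₀ hC))
    (qInf_ne_zero_of_zpow hq0 hq1 hn₀ hD)), ?_⟩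
  have ht := (((tendsto_qInf_mul_pow hq1 A).mul (tendsto_qInf_mul_pow hq1 B)).mul
    (tendsto_qInf_mul_pow hq1 C)).mul (tendsto_qInf_mul_pow hq1 D)
  simp only [mul_one] at ht
  have ht2 := (ht.inv₀ one_ne_zero).const_mul (W 0 * (qInf q A * qInf q B * qInf q C * qInf q D))
  rw [inv_one, mul_one] at ht2
  refine ht2.congr' ?_
  filter_upwards [ht.eventually_ne one_ne_zero] with n hn
  rw [← div_eq_mul_inv, div_eq_div_iff hn (pow_ne_zero _ hκ)]
  have hWn : X n * Y ((n + 1 : ℕ) : ℤ) - X ((n + 1 : ℕ) : ℤ) * Y n = W n := by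
    rw [hW]
    push_cast
    rfl
  rw [hWn]
  linear_combination -hprod n

theorem isMinimal_of_tendsto (hq0 : q ≠ 0) (hq1 : ‖q‖ < 1) (hn₀ : n₀ ≤ 0)
    (hA0 : A ≠ 0) (hB0 : B ≠ 0) (hC0 : C ≠ 0) (hD0 : D ≠ 0)
    (hA : ∀ m : ℤ, n₀ ≤ m → A * q ^ m ≠ 1) (hB : ∀ m : ℤ, n₀ ≤ m → B * q ^ m ≠ 1)
    (hC : ∀ m : ℤ, n₀ ≤ m → C * q ^ m ≠ 1) (hD : ∀ m : ℤ, n₀ ≤ m → D * q ^ m ≠ 1)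
    {l m c : ℂ} (hlm : l * m = q / (A * B * C * D)) (hρ : ‖l / m‖ < 1)
    (hX : IsSolution q A B C D z n₀ X) (hc : c ≠ 0)
    (ht : Tendsto (fun n : ℕ => X n / l ^ n) atTop (𝓝 c)) : IsMinimal q A B C D z n₀ X := by
  refine ⟨hX, ?_, fun Y hY h => ?_⟩
  · obtain ⟨n, hn⟩ := (ht.eventually_ne hc).exists
    exact ⟨n, by omega, (div_ne_zero_iff.1 hn).1⟩
  · obtain ⟨w, hw, hW⟩ := hX.exists_tendsto_casoratian hq0 hq1 hn₀ hA0 hB0 hC0 hD0 hA hB hC hD hY h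
    rw [← hlm] at hW
    have := tendsto_div_of_casoratian (y := fun n => Y n)
      (ne_zero_of_mul_eq_div hq0 hA0 hB0 hC0 hD0 hlm)
      (ne_zero_of_mul_eq_div hq0 hA0 hB0 hC0 hD0 ((mul_comm _ _).trans hlm)) hρ ht hc hW hw
    rw [← Nat.map_cast_int_atTop, eventually_map, tendsto_map'_iff]
    exact this

/-- Were the two independent, `X/Y` and `Y/X` would both tend to `0`, although their product is
eventually `1`. -/
theorem IsMinimal.exists_eq_mul (hX : IsMinimal q A B C D z n₀ X)
    (hY : IsMinimal q A B C D z n₀ Y) :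
    ∃ c : ℂ, c ≠ 0 ∧ ∀ n : ℤ, n₀ ≤ n → Y n = c * X n := by
  by_cases h : IndepSeq n₀ X Y
  · exfalso
    obtain ⟨h1, h2⟩ := hX.2.2 Y hY.1 h
    obtain ⟨h3, h4⟩ := hY.2.2 X hX.1 h.symm
    have h5 := h2.mul h4
    rw [zero_mul] at h5
    have h6 : Tendsto (fun _ : ℤ => (1 : ℂ)) atTop (𝓝 0) := by
      refine h5.congr' ?_
      filter_upwards [h1, h3] with n hn hn'
      field_simp
    exact one_ne_zero (tendsto_nhds_unique tendsto_const_nhds h6)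
  · rw [IndepSeq, LinearIndependent.pair_iff] at h
    push Not at h
    obtain ⟨s, t, hst, hne⟩ := h
    have hst' : ∀ n, n₀ ≤ n → s * X n + t * Y n = 0 := fun n hn => congrFun hst ⟨n, hn⟩
    obtain ⟨k, hk, hXk⟩ := hX.2.1
    obtain ⟨j, hj, hYj⟩ := hY.2.1
    have ht : t ≠ 0 := by
      rintro rfl
      have := hst' k hk
      rw [zero_mul, add_zero] at this
      exact hne ((mul_eq_zero.1 this).resolve_right hXk) rfl
    have hYX : ∀ n, n₀ ≤ n → Y n = -s / t * X n := fun n hn => by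
      field_simp
      linear_combination hst' n hn
    refine ⟨-s / t, fun h0 => hYj ?_, hYX⟩
    rw [hYX j hj, h0, zero_mul]

/-- The limit is a nonzero constant times `hahnV` at `0`, that is `(q l/m)_∞`. It is nonzero because
`‖l / m‖ < 1`, so general position is not needed. -/
theorem exists_tendsto_X1 (hq0 : q ≠ 0) (hq1 : ‖q‖ < 1) (hn₀ : n₀ ≤ 0)
    (hA0 : A ≠ 0) (hB0 : B ≠ 0) (hC0 : C ≠ 0) (hD0 : D ≠ 0)
    (hA : ∀ m : ℤ, n₀ ≤ m → A * q ^ m ≠ 1) (hB : ∀ m : ℤ, n₀ ≤ m → B * q ^ m ≠ 1)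
    (hC : ∀ m : ℤ, n₀ ≤ m → C * q ^ m ≠ 1) (hD : ∀ m : ℤ, n₀ ≤ m → D * q ^ m ≠ 1)
    {l m : ℂ} (hlm : l * m = q / (A * B * C * D)) (hρ : ‖l / m‖ < 1)
    (hX : X1Defined q A B C D l n₀) :
    ∃ c : ℂ, c ≠ 0 ∧ Tendsto (fun n : ℕ => X1 q A B C D l n / l ^ n) atTop (𝓝 c) := by
  have hl := ne_zero_of_mul_eq_div hq0 hA0 hB0 hC0 hD0 hlm
  have hV0 := hahnV_zero hq0 hq1 hA0 hB0 hC0 hD0 hlm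
  have hV0' : qInf q (q * (l / m)) ≠ 0 := by
    refine qInf_ne_zero hq1 (mul_pow_ne_one_of_norm_lt hq1 ?_)
    rw [norm_mul]
    exact mul_lt_one_of_nonneg_of_lt_one_left (norm_nonneg _) hq1 hρ.le
  have hV : Tendsto (fun n : ℕ => hahnV q A B C D l (q ^ n)) atTop (𝓝 (hahnV q A B C D l 0)) :=
    ((differentiable_hahnV hq0 hq1 A B C D l).continuous.tendsto 0).comp
      (tendsto_pow_atTop_nhds_zero_of_norm_lt_one hq1)
  have ht := (((tendsto_qInf_mul_pow hq1 A).mul (tendsto_qInf_mul_pow hq1 B)).mul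
    (tendsto_qInf_mul_pow hq1 C)).mul (tendsto_qInf_mul_pow hq1 D)
  simp only [mul_one] at ht
  have h := (hV.div ht one_ne_zero).const_mul (qInf q A * qInf q B * qInf q C * qInf q D
      / (qInf q (B * C * D * l) * qInf q (A * B * C * l) * qInf q (A * D * l)))
  rw [div_one, hV0] at h
  refine ⟨_, mul_ne_zero (div_ne_zero ?_ ?_) hV0', h.congr fun n => ?_⟩
  · exact mul_ne_zero (mul_ne_zero (mul_ne_zero (qInf_ne_zero_of_zpow hq0 hq1 hn₀ hA)
      (qInf_ne_zero_of_zpow hq0 hq1 hn₀ hB)) (qInf_ne_zero_of_zpow hq0 hq1 hn₀ hC))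
      (qInf_ne_zero_of_zpow hq0 hq1 hn₀ hD)
  · exact mul_ne_zero (mul_ne_zero (qInf_ne_zero_of_zpow hq0 hq1 hn₀ hX.1)
      (qInf_ne_zero_of_zpow hq0 hq1 hn₀ hX.2.1)) (qInf_ne_zero hq1 hX.2.2)
  · rw [X1_eq hq0 hq1 hn₀ hA hB hC hD hX (by omega : n₀ ≤ (n : ℤ)), zpow_natCast, zpow_natCast]
    rw [eq_div_iff (pow_ne_zero _ hl), Pi.div_apply]
    ring

end

/-! ### The choice of the square root -/

/-- Both numbers lie on the unit circle, hence are conjugate, and their half-sum is `Re u`. -/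
theorem mem_image_Icc_of_norm_eq {u v : ℂ} (huv : u * v = 1) (h : ‖u‖ = ‖v‖) :
    (u + v) / 2 ∈ Complex.ofReal '' Set.Icc (-1 : ℝ) 1 := by
  have hu : ‖u‖ = 1 := by
    have h1 : ‖u‖ * ‖v‖ = 1 := by rw [← norm_mul, huv, norm_one]
    rw [← h] at h1
    nlinarith [norm_nonneg u]
  have hv : v = (starRingEnd ℂ) u := by
    have h0 : u ≠ 0 := left_ne_zero_of_mul_eq_one huv
    refine mul_left_cancel₀ h0 ?_
    rw [huv, Complex.mul_conj, Complex.normSq_eq_norm_sq, hu]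
    norm_num
  refine ⟨u.re, ?_, ?_⟩
  · have := Complex.abs_re_le_norm u
    rw [hu] at this
    exact abs_le.1 this
  · rw [hv, Complex.add_conj]
    push_cast
    ring

/-- The normalised roots `2αλ_±` have product `1` and half-sum `αz`, so they cannot have equal
modulus. The only other choice, `-r`, exchanges them, and exactly one choice makes `λ₋` the smaller.
-/
theorem existsUnique_root {w z α : ℂ} (hq0 : q ≠ 0) (hw : w ≠ 0) (hα : α ^ 2 = w / (4 * q))
    (hx : α * z ∉ Complex.ofReal '' Set.Icc (-1 : ℝ) 1) :
    ∃! r : ℂ, r ^ 2 = z ^ 2 - 4 * q / w ∧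
      Tendsto (fun n : ℕ => (lamM z r / lamP z r) ^ n) atTop (𝓝 0) := by
  simp only [tendsto_pow_atTop_nhds_zero_iff_norm_lt_one]
  have hα0 : α ≠ 0 := by
    rintro rfl
    rw [zero_pow two_ne_zero, eq_comm, div_eq_zero_iff] at hα
    simp [hw, hq0] at hα
  have hneg : ∀ r : ℂ, lamM z (-r) = lamP z r ∧ lamP z (-r) = lamM z r := fun r => by
    rw [lamM, lamP, lamM, lamP]
    exact ⟨by ring, by ring⟩
  have hne : ∀ r : ℂ, r ^ 2 = z ^ 2 - 4 * q / w → lamM z r ≠ 0 ∧ lamP z r ≠ 0 ∧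
      ‖lamM z r‖ ≠ ‖lamP z r‖ := by
    intro r hr
    have hl := lamP_mul_lamM hr
    have h0 : lamP z r * lamM z r ≠ 0 := by
      rw [hl]
      exact div_ne_zero hq0 hw
    refine ⟨right_ne_zero_of_mul h0, left_ne_zero_of_mul h0, fun h => hx ?_⟩
    have h1 := mem_image_Icc_of_norm_eq (u := 2 * α * lamP z r) (v := 2 * α * lamM z r) (by
      rw [show 2 * α * lamP z r * (2 * α * lamM z r) = 4 * α ^ 2 * (lamP z r * lamM z r) by ring,
        hα, hl]
      field_simp) (by rw [norm_mul, norm_mul _ (lamM z r), h])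
    rwa [show (2 * α * lamP z r + 2 * α * lamM z r) / 2 = α * (lamP z r + lamM z r) by ring,
      lamP_add_lamM] at h1
  have hlt : ∀ r : ℂ, r ^ 2 = z ^ 2 - 4 * q / w →
      (‖lamM z r / lamP z r‖ < 1 ↔ ‖lamM z r‖ < ‖lamP z r‖) := fun r hr => by
    rw [norm_div, div_lt_one (norm_pos_iff.2 (hne r hr).2.1)]
  obtain ⟨r, hr⟩ : ∃ r : ℂ, r ^ 2 = z ^ 2 - 4 * q / w := IsAlgClosed.exists_pow_nat_eq _ two_pos
  have hr' : (-r) ^ 2 = z ^ 2 - 4 * q / w := by rw [neg_sq, hr]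
  have hex : ∃ s : ℂ, s ^ 2 = z ^ 2 - 4 * q / w ∧ ‖lamM z s / lamP z s‖ < 1 := by
    rcases lt_or_gt_of_ne (hne r hr).2.2 with h | h
    · exact ⟨r, hr, (hlt r hr).2 h⟩
    · exact ⟨-r, hr', (hlt _ hr').2 (by rwa [(hneg r).1, (hneg r).2])⟩
  obtain ⟨s, hs, hs1⟩ := hex
  refine ⟨s, ⟨hs, hs1⟩, ?_⟩
  rintro t ⟨ht, ht1⟩
  rcases sq_eq_sq_iff_eq_or_eq_neg.1 (ht.trans hs.symm) with h | h
  · exact h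
  · have h1 := (hlt t ht).1 ht1
    rw [h, (hneg s).1, (hneg s).2] at h1
    exact absurd ((hlt s hs).1 hs1) h1.not_gt

end QHahn

end

open Filter Topology QHahn in
theorem theorem1 (q A B C D z : ℂ) (n₀ : ℤ)
    (hq0 : q ≠ 0) (hq1 : ‖q‖ < 1)
    (hA0 : A ≠ 0) (hB0 : B ≠ 0) (hC0 : C ≠ 0) (hD0 : D ≠ 0) (hn₀ : n₀ ≤ 0)
    (hA : ∀ m : ℤ, n₀ ≤ m → A * q ^ m ≠ 1) (hB : ∀ m : ℤ, n₀ ≤ m → B * q ^ m ≠ 1)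
    (hC : ∀ m : ℤ, n₀ ≤ m → C * q ^ m ≠ 1) (hD : ∀ m : ℤ, n₀ ≤ m → D * q ^ m ≠ 1) :
    (∀ r : ℂ, r ^ 2 = z ^ 2 - 4 * q / (A * B * C * D) →
      (∀ i : Fin 6, familyDefined q A B C D (lamP z r) (lamM z r) n₀ i →
        IsSolution q A B C D z n₀ (family q A B C D (lamP z r) (lamM z r) i)) ∧
      (GeneralPosition q A B C D (lamP z r) (lamM z r) →
        (∀ i : Fin 6, familyDefined q A B C D (lamP z r) (lamM z r) n₀ i) ∧
        Pairwise fun i j : Fin 6 =>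
          IndepSeq n₀ (family q A B C D (lamP z r) (lamM z r) i)
            (family q A B C D (lamP z r) (lamM z r) j))) ∧
    ∀ α : ℂ, α ^ 2 = A * B * C * D / (4 * q) →
      α * z ∉ Complex.ofReal '' Set.Icc (-1 : ℝ) 1 →
      (∃! r : ℂ, r ^ 2 = z ^ 2 - 4 * q / (A * B * C * D) ∧
        Tendsto (fun n : ℕ => (lamM z r / lamP z r) ^ n) atTop (𝓝 0)) ∧
      ∀ r : ℂ, r ^ 2 = z ^ 2 - 4 * q / (A * B * C * D) →
        Tendsto (fun n : ℕ => (lamM z r / lamP z r) ^ n) atTop (𝓝 0) →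
        X1Defined q A B C D (lamM z r) n₀ →
        ∀ Y : ℤ → ℂ, IsMinimal q A B C D z n₀ Y ↔
          ∃ c : ℂ, c ≠ 0 ∧ ∀ n : ℤ, n₀ ≤ n → Y n = c * X1 q A B C D (lamM z r) n := by
  have hw : A * B * C * D ≠ 0 := mul_ne_zero (mul_ne_zero (mul_ne_zero hA0 hB0) hC0) hD0
  refine ⟨fun r hr => ⟨fun i hi =>
      isSolution_family hq0 hq1 hn₀ hA0 hB0 hC0 hD0 hA hB hC hD hr i hi,
    fun hgp => ?_⟩, fun α hα hx => ⟨existsUnique_root hq0 hw hα hx, fun r hr hρ hX Y => ?_⟩⟩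
  · have g : Generic q A B C D (lamP z r) (lamM z r) :=
      ⟨hA0, hB0, hC0, hD0, lamP_mul_lamM hr, hgp⟩
    exact ⟨g.familyDefined hq0 n₀, g.pairwise_indepSeq hq0 hq1 hn₀⟩
  · have hl := (mul_comm _ _).trans (lamP_mul_lamM hr)
    rw [tendsto_pow_atTop_nhds_zero_iff_norm_lt_one] at hρ
    have hsol : IsSolution q A B C D z n₀ (X1 q A B C D (lamM z r)) :=
      isSolution_family hq0 hq1 hn₀ hA0 hB0 hC0 hD0 hA hB hC hD hr 1 hX
    obtain ⟨c, hc, ht⟩ := exists_tendsto_X1 hq0 hq1 hn₀ hA0 hB0 hC0 hD0 hA hB hC hD hl hρ hX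
    have hmin := isMinimal_of_tendsto hq0 hq1 hn₀ hA0 hB0 hC0 hD0 hA hB hC hD hl hρ hsol hc ht
    refine ⟨hmin.exists_eq_mul, ?_⟩
    rintro ⟨k, hk, hY⟩
    refine isMinimal_of_tendsto hq0 hq1 hn₀ hA0 hB0 hC0 hD0 hA hB hC hD hl hρ
      (hsol.const_mul k hY) (mul_ne_zero hk hc) ((ht.const_mul k).congr fun n => ?_)
    rw [hY n (by omega), mul_div_assoc]
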